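/- **Definitions.** Let $m\ge 2$, let $\mu_1,\dots,\mu_m$ be finite positive measures on $\mathbb R^N$ and $\lambda_1,\dots,\lambda_m>0$ constants. Pairwise disjoint domains (non-empty connected open sets) $\Omega_1,\dots,\Omega_m\subset\mathbb R^N$ with $\operatorname{supp}\mu_i\subset\Omega_i$ form an *$m$-phase quadrature domain* for $(\mu_i)$ and $(\lambda_i)$ if for all $i\ne j$ $$\int_{\Omega_i}\lambda_i h\,dx-\int_{\Omega_j}\lambda_j h\,dx=\int h\,d\mu_i-\int h\,d\mu_j$$ (with $h$ integrable with respect to $\mu_i$ and $\mu_j$) for every integrable harmonic function $h$ on $\Omega_i\cup\Omega_j$ that has a continuous extension to $\Omega_i\cup\Omega_j\cup(\partial\Omega_i\cap\partial\Omega_j)\cup\bigcup_{k\ne i,j}\partial\Omega_k$ with $h=0$ on $\bigcup_{k\ne i,j}\partial\Omega_k$. A *triple junction point* of a three-phase quadrature domain is a point of $\partial\Omega_1\cap\partial\Omega_2\cap\partial\Omega_3$. In $\mathbb R^2$ put, for $i=1,2,3$, $$\Pi_i=\{(r\cos\theta,r\sin\theta): r>0,\ 2(i-1)\pi/3<\theta<2i\pi/3\},\qquad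 z_i=\bigl(\cos\tfrac{(2i-1)\pi}{3},\sin\tfrac{(2i-1)\pi}{3}\bigr),\qquad \mu_i=\chi_{B_{1/5}(z_i)}\,dx .$$ **Theorem.** Three-phase quadrature domains in the plane with a triple junction point that does not touch the support of the measures exist. More precisely, there is $j_0>0$ such that for every real $j\ge j_0$ there is a continuous function $u$ on $\mathbb R^2$ with the following properties. 1. $u$ is a minimizer of $\displaystyle\int_{\Pi_1}\bigl(\tfrac12|\nabla w|^2-f_jw\bigr)\,dx$, with $f_j=-1+j\chi_{B_{1/5}(z_1)}$, among all $w\in W^{1,2}_0(\Pi_1)$ with $w\ge0$, functions on $\Pi_1$ being extended by zero. 2. Let $u_1=u$, let $u_2$ and $u_3$ be the even reflections of $u$ in the boundary rays $\theta=2\pi/3$ and $\theta=0$ of $\Pi_1$, and $\Omega_i=\{u_i>0\}$. Then $u_i\ge 0$, the sets $\Omega_i$ are pairwise disjoint and bounded, and for $i\neq l$, with $k$ the third index, $$\Delta(u_i-u_l)=(\chi_{\Omega_i}-\chi_{\Omega_l})-j(\mu_i-\mu_l)\quad\text{in the sense of distributions in }\mathbb R^2\setminus\overline{\Omega_k}.$$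 3. $(\Omega_1,\Omega_2,\Omega_3)$ is a three-phase quadrature domain for the measures $j\mu_1,j\mu_2,j\mu_3$ and $\lambda_1=\lambda_2=\lambda_3=1$. 4. $u(x)\ge \tfrac12x_2(x_2+\sqrt3\,x_1)$ for $x\in B_{3/4}(0)\cap\Pi_1$, and $B_{3/4}(0)\cap\Pi_i\subset\Omega_i$ for $i=1,2,3$. 5. The origin is a triple junction point of $(\Omega_1,\Omega_2,\Omega_3)$, and $B_{3/4}(0)$ does not meet the supports of the measures. -/

import Mathlib

open MeasureTheory Filter Topology
open scoped ContDiff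

noncomputable section

namespace MPQD

section General

variable {E : Type*} [NormedAddCommGroup E] [InnerProductSpace ℝ E] [FiniteDimensional ℝ E]
  [MeasurableSpace E] [BorelSpace E]

/-- A smooth function with compact support contained in `U`. -/
def IsTestFunction (U : Set E) (φ : E → ℝ) : Prop :=
  ContDiff ℝ ∞ φ ∧ HasCompactSupport φ ∧ tsupport φ ⊆ U

/-- `u` (extended by zero to the whole space) lies in the Sobolev space `W₀^{1,2}(U)` and has weak
gradient `g`: the pair `(u, g)` is a limit in `L² × L²` of pairs `(φ, ∇φ)`, where the `φ` are
smooth functions with compact support in `U`. -/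
def MemW012 (U : Set E) (u : E → ℝ) (g : E → E) : Prop :=
  MemLp u 2 volume ∧ MemLp g 2 volume ∧
    ∃ φ : ℕ → E → ℝ, (∀ n, IsTestFunction U (φ n)) ∧
      Tendsto (fun n => eLpNorm (fun x => φ n x - u x) 2 volume) atTop (𝓝 0) ∧
      Tendsto (fun n => eLpNorm (fun x => gradient (φ n) x - g x) 2 volume) atTop (𝓝 0)

/-- The energy `∫_U (½ |∇u|² - f u)`, where `g` stands for the weak gradient of `u`. -/
def energy (U : Set E) (f : E → ℝ) (u : E → ℝ) (g : E → E) : ℝ :=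
  ∫ x in U, (1 / 2 * ‖g x‖ ^ 2 - f x * u x)

/-- The competitors of the obstacle problem in `U`: nonnegative functions in `W₀^{1,2}(U)` with
finite energy. (For `f` bounded, with `f⁺` compactly supported, a nonnegative function in
`W₀^{1,2}(U)` such that `f u` is not integrable has energy `+∞`.) -/
def IsCompetitor (U : Set E) (f : E → ℝ) (u : E → ℝ) (g : E → E) : Prop :=
  MemW012 U u g ∧ (∀ᵐ x ∂volume, 0 ≤ u x) ∧ IntegrableOn (fun x => f x * u x) U volume

/-- `u` solves the obstacle problem in `U` with force term `f` and zero boundary values: it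
minimizes `∫_U (½ |∇u|² - f u)` among the nonnegative functions in `W₀^{1,2}(U)`. -/
def IsObstacleMinimizer (U : Set E) (f : E → ℝ) (u : E → ℝ) : Prop :=
  ∃ g : E → E, IsCompetitor U f u g ∧
    ∀ (v : E → ℝ) (g' : E → E), IsCompetitor U f v g' → energy U f u g ≤ energy U f v g'

variable {ι : Type*}

/-- The test functions of the quadrature identity for the pair of phases `i`, `j`: integrable
harmonic functions on `Ω i ∪ Ω j` with a continuous extension to `∂(Ω i) ∩ ∂(Ω j)` and to the
boundaries of all the other phases, the extension being zero on the latter. -/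
structure IsPairTest (Ω : ι → Set E) (i j : ι) (h : E → ℝ) : Prop where
  integrable : IntegrableOn h (Ω i ∪ Ω j) volume
  harmonic : InnerProductSpace.HarmonicOnNhd h (Ω i ∪ Ω j)
  continuous : ContinuousOn h
    (Ω i ∪ Ω j ∪ (frontier (Ω i) ∩ frontier (Ω j)) ∪ ⋃ k ∈ {k | k ≠ i ∧ k ≠ j}, frontier (Ω k))
  zero : ∀ k, k ≠ i → k ≠ j → ∀ x ∈ frontier (Ω k), h x = 0

/-- `{Ω i}` is a multi-phase quadrature domain (with at least two phases) with respect to the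
bounded positive measures `μ i` and the positive constants `lam i`. -/
structure IsMultiPhaseQD [Nontrivial ι] (μ : ι → Measure E) (lam : ι → ℝ) (Ω : ι → Set E) :
    Prop where
  finite : ∀ i, IsFiniteMeasure (μ i)
  lam_pos : ∀ i, 0 < lam i
  isOpen : ∀ i, IsOpen (Ω i)
  isConnected : ∀ i, IsConnected (Ω i)
  disjoint : ∀ i j, i ≠ j → Disjoint (Ω i) (Ω j)
  support_subset : ∀ i, (μ i).support ⊆ Ω i
  identity : ∀ i j, i ≠ j → ∀ h : E → ℝ, IsPairTest Ω i j h →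
    Integrable h (μ i) ∧ Integrable h (μ j) ∧
      (∫ x in Ω i, h x * lam i) - (∫ x in Ω j, h x * lam j) = (∫ x, h x ∂μ i) - ∫ x, h x ∂μ j

/-- `u = (u i)` solves the multi-phase free boundary problem: the `u i` are nonnegative with
pairwise disjoint positivity sets `Ω i = {u i > 0}` and, in the sense of distributions,
`Δ(u i - u j) = (lam i χ_{Ω i} - lam j χ_{Ω j}) - (μ i - μ j)` outside the closures of the other
positivity sets. -/
structure IsMultiPhaseSolution (μ : ι → Measure E) (lam : ι → ℝ) (u : ι → E → ℝ) : Prop where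
  locallyIntegrable : ∀ i, LocallyIntegrable (u i) volume
  nonneg : ∀ i x, 0 ≤ u i x
  disjoint : ∀ i j, i ≠ j → Disjoint {x | 0 < u i x} {x | 0 < u j x}
  equation : ∀ i j, i ≠ j → ∀ φ : E → ℝ,
    IsTestFunction (⋃ k ∈ {k | k ≠ i ∧ k ≠ j}, closure {x | 0 < u k x})ᶜ φ →
      ∫ x, (u i x - u j x) * Laplacian.laplacian φ x =
        ((∫ x in {x | 0 < u i x}, lam i * φ x) - ∫ x in {x | 0 < u j x}, lam j * φ x)
          - ((∫ x, φ x ∂μ i) - ∫ x, φ x ∂μ j)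

/-- `p` is a junction point of the phases `Ω i`, `i : ι`: all of them meet at `p`. -/
def IsJunctionPoint (Ω : ι → Set E) (p : E) : Prop :=
  ∀ i, p ∈ frontier (Ω i)

end General

/-- The Euclidean plane; `x 0` and `x 1` are the coordinates `x₁` and `x₂`. -/
abbrev Plane : Type := EuclideanSpace ℝ (Fin 2)

/-- The point with polar coordinates `r`, `θ`. -/
def polarPoint (r θ : ℝ) : Plane := !₂[r * Real.cos θ, r * Real.sin θ]

/-- The open cone of the directions between the angles `a` and `b`. -/
def sector (a b : ℝ) : Set Plane :=
  {x | ∃ r θ : ℝ, 0 < r ∧ a < θ ∧ θ < b ∧ x = polarPoint r θ}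

/-- The three open cones of opening `2π/3` with vertex at the origin; `cone 0` is
`{(r cos θ, r sin θ) : r > 0, 0 < θ < 2π/3}`. -/
def cone (i : Fin 3) : Set Plane :=
  sector (2 * (i : ℕ) * Real.pi / 3) (2 * ((i : ℕ) + 1) * Real.pi / 3)

/-- The unit vector on the axis of `cone i`. -/
def center (i : Fin 3) : Plane := polarPoint 1 ((2 * (i : ℕ) + 1) * Real.pi / 3)

/-- The measure `j χ_{B_{1/5}(center i)} dx` (for `j ≥ 0`). -/
def phaseMeasure (j : ℝ) (i : Fin 3) : Measure Plane :=
  ENNReal.ofReal j • (volume : Measure Plane).restrict (Metric.ball (center i) (1 / 5))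

/-- The force term `-1 + j χ_{B_{1/5}(center 0)}`. -/
def force (j : ℝ) : Plane → ℝ := fun x =>
  -1 + j * (Metric.ball (center 0) (1 / 5)).indicator (fun _ => (1 : ℝ)) x

/-- Reflection of the plane in the line through the origin with direction angle `θ`. -/
def rayReflection (θ : ℝ) (x : Plane) : Plane :=
  (Submodule.span ℝ {polarPoint 1 θ}).reflection x

/-- A function on `cone 0`, extended by zero, together with its even reflections in the two
boundary rays of `cone 0`, which live on `cone 1` and `cone 2`. -/
def reflectedTriple (u : Plane → ℝ) : Fin 3 → Plane → ℝ :=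
  ![u, fun x => u (rayReflection (2 * Real.pi / 3) x), fun x => u (rayReflection 0 x)]

end MPQD

end

namespace MPQD

/-- The partial derivative in the direction of the `i`-th coordinate vector. -/
noncomputable def pd (i : Fin 2) (f : Plane → ℝ) (x : Plane) : ℝ :=
  fderiv ℝ f x (EuclideanSpace.single i 1)

lemma gradient_apply (f : Plane → ℝ) (x : Plane) (i : Fin 2) : gradient f x i = pd i f x := by
  have h := inner_gradient_left (𝕜 := ℝ) (f := f) (x := x) (y := EuclideanSpace.single i (1 : ℝ))
  rw [pd, ← h, EuclideanSpace.inner_single_right]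
  simp

lemma inner_plane (v w : Plane) : inner ℝ v w = ∑ i, v i * w i := by
  rw [PiLp.inner_apply]
  simp [mul_comm]

lemma inner_gradient (v : Plane) (f : Plane → ℝ) (x : Plane) :
    inner ℝ v (gradient f x) = ∑ i, v i * pd i f x := by
  simp only [inner_plane, gradient_apply]

lemma inner_gradient_gradient (f g : Plane → ℝ) (x : Plane) :
    inner ℝ (gradient f x) (gradient g x) = ∑ i, pd i f x * pd i g x := by
  simp only [inner_plane, gradient_apply]

lemma norm_sq_gradient (f : Plane → ℝ) (x : Plane) :
    ‖gradient f x‖ ^ 2 = ∑ i, pd i f x ^ 2 := by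
  rw [← real_inner_self_eq_norm_sq, inner_gradient_gradient]
  simp only [sq]

lemma norm_gradient (f : Plane → ℝ) (x : Plane) : ‖gradient f x‖ = ‖fderiv ℝ f x‖ := by
  rw [gradient, LinearIsometryEquiv.norm_map]

lemma contDiff_pd {n : ℕ∞} {f : Plane → ℝ} (hf : ContDiff ℝ (n + 1) f) (i : Fin 2) :
    ContDiff ℝ n (pd i f) :=
  (hf.fderiv_right (m := n) le_rfl).clm_apply contDiff_const

lemma contDiff_pd_one {f : Plane → ℝ} (hf : ContDiff ℝ 2 f) (i : Fin 2) :
    ContDiff ℝ 1 (pd i f) :=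
  contDiff_pd (n := 1) (by simpa [one_add_one_eq_two] using hf) i

lemma contDiff_pd_infty {f : Plane → ℝ} (hf : ContDiff ℝ ∞ f) (i : Fin 2) :
    ContDiff ℝ ∞ (pd i f) :=
  contDiff_pd (n := ⊤) (by simpa using hf) i

lemma continuous_pd {f : Plane → ℝ} (hf : ContDiff ℝ 1 f) (i : Fin 2) :
    Continuous (pd i f) :=
  (contDiff_pd (n := 0) (by simpa using hf) i).continuous

lemma continuous_gradient {f : Plane → ℝ} (hf : ContDiff ℝ 1 f) :
    Continuous (gradient f) := by
  have : Continuous (fderiv ℝ f) := hf.continuous_fderiv (by simp)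
  exact (InnerProductSpace.toDual ℝ Plane).symm.continuous.comp this

lemma tsupport_pd_subset (i : Fin 2) (f : Plane → ℝ) : tsupport (pd i f) ⊆ tsupport f :=
  tsupport_fderiv_apply_subset ℝ _

lemma tsupport_gradient_subset (f : Plane → ℝ) : tsupport (gradient f) ⊆ tsupport f := by
  refine closure_minimal (fun x hx => ?_) isClosed_closure
  by_contra h
  apply hx
  have : fderiv ℝ f x = 0 := by
    by_contra h2
    exact h (support_fderiv_subset ℝ h2)
  simp [gradient, this]

lemma hasCompactSupport_pd {f : Plane → ℝ} (hf : HasCompactSupport f) (i : Fin 2) :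
    HasCompactSupport (pd i f) :=
  hf.mono' ((subset_tsupport _).trans (tsupport_pd_subset i f))

lemma hasCompactSupport_gradient {f : Plane → ℝ} (hf : HasCompactSupport f) :
    HasCompactSupport (gradient f) :=
  hf.mono' ((subset_tsupport _).trans (tsupport_gradient_subset f))

lemma pd_pd {f : Plane → ℝ} {x : Plane} (hf : ContDiffAt ℝ 2 f x) (i k : Fin 2) :
    pd i (pd k f) x =
      fderiv ℝ (fderiv ℝ f) x (EuclideanSpace.single i 1) (EuclideanSpace.single k 1) := by
  have h : DifferentiableAt ℝ (fderiv ℝ f) x :=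
    (hf.fderiv_right (m := 1) (by simp [one_add_one_eq_two])).differentiableAt (by simp)
  unfold pd
  rw [fderiv_clm_apply h (differentiableAt_const _)]
  simp

lemma pd_comm {f : Plane → ℝ} {x : Plane} (hf : ContDiffAt ℝ 2 f x) (i k : Fin 2) :
    pd i (pd k f) x = pd k (pd i f) x := by
  rw [pd_pd hf, pd_pd hf]
  exact (hf.isSymmSndFDerivAt (by simp)) _ _

lemma laplacian_eq {f : Plane → ℝ} {x : Plane} (hf : ContDiffAt ℝ 2 f x) :
    Laplacian.laplacian f x = ∑ i, pd i (pd i f) x := by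
  rw [InnerProductSpace.laplacian_eq_iteratedFDeriv_orthonormalBasis f
    (EuclideanSpace.basisFun (Fin 2) ℝ)]
  refine Finset.sum_congr rfl fun i _ => ?_
  rw [pd_pd hf, iteratedFDeriv_two_apply]
  simp

lemma pd_congr {f g : Plane → ℝ} {x : Plane} (h : f =ᶠ[𝓝 x] g) (i : Fin 2) :
    pd i f x = pd i g x := by
  rw [pd, pd, h.fderiv_eq]

lemma pd_mul {f g : Plane → ℝ} {x : Plane} (hf : DifferentiableAt ℝ f x)
    (hg : DifferentiableAt ℝ g x) (i : Fin 2) :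
    pd i (fun y => f y * g y) x = f x * pd i g x + pd i f x * g x := by
  unfold pd
  rw [fderiv_fun_mul hf hg]
  simp [mul_comm]

lemma pd_add {f g : Plane → ℝ} {x : Plane} (hf : DifferentiableAt ℝ f x)
    (hg : DifferentiableAt ℝ g x) (i : Fin 2) :
    pd i (fun y => f y + g y) x = pd i f x + pd i g x := by
  unfold pd
  rw [fderiv_fun_add hf hg]
  simp

lemma pd_sub {f g : Plane → ℝ} {x : Plane} (hf : DifferentiableAt ℝ f x)
    (hg : DifferentiableAt ℝ g x) (i : Fin 2) :
    pd i (fun y => f y - g y) x = pd i f x - pd i g x := by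
  unfold pd
  rw [fderiv_fun_sub hf hg]
  simp

lemma pd_neg (f : Plane → ℝ) (x : Plane) (i : Fin 2) :
    pd i (fun y => -f y) x = -pd i f x := by
  unfold pd
  rw [fderiv_fun_neg]
  simp

lemma pd_sub_const (f : Plane → ℝ) (c : ℝ) (x : Plane) (i : Fin 2) :
    pd i (fun y => f y - c) x = pd i f x := by
  unfold pd
  rw [fderiv_sub_const]

lemma pd_const_mul {f : Plane → ℝ} {x : Plane} (hf : DifferentiableAt ℝ f x) (c : ℝ)
    (i : Fin 2) : pd i (fun y => c * f y) x = c * pd i f x := by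
  unfold pd
  rw [fderiv_const_mul hf]
  simp

lemma pd_comp {F : ℝ → ℝ} {f : Plane → ℝ} {x : Plane} (hF : DifferentiableAt ℝ F (f x))
    (hf : DifferentiableAt ℝ f x) (i : Fin 2) :
    pd i (fun y => F (f y)) x = deriv F (f x) * pd i f x := by
  have := fderiv_fun_comp (f := f) (g := F) x hF hf
  unfold pd
  rw [this]
  simp [mul_comm]

lemma pd_coord (i k : Fin 2) (x : Plane) : pd i (fun y => y k) x = if k = i then 1 else 0 := by
  have : HasFDerivAt (fun y : Plane => y k) (EuclideanSpace.proj k : Plane →L[ℝ] ℝ) x :=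
    (EuclideanSpace.proj k : Plane →L[ℝ] ℝ).hasFDerivAt
  unfold pd
  rw [this.fderiv]
  simp

lemma pd_const (i : Fin 2) (c : ℝ) (x : Plane) : pd i (fun _ => c) x = 0 := by
  simp [pd]

lemma integral_mul_pd {f g : Plane → ℝ} (hf : ContDiff ℝ 1 f) (hg : ContDiff ℝ 1 g)
    (hc : HasCompactSupport f ∨ HasCompactSupport g) (i : Fin 2) :
    ∫ x, f x * pd i g x = - ∫ x, pd i f x * g x := by
  have key : ∀ p q : Plane → ℝ, Continuous p → Continuous q →
      HasCompactSupport p ∨ HasCompactSupport q → Integrable (fun x => p x * q x) := by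
    intro p q hp hq h
    refine (hp.mul hq).integrable_of_hasCompactSupport ?_
    rcases h with h | h
    · exact h.mul_right
    · exact h.mul_left
  refine integral_mul_fderiv_eq_neg_fderiv_mul_of_integrable (μ := volume) ?_ ?_ ?_
    (fun x _ => hf.differentiable (by simp) x) (fun x _ => hg.differentiable (by simp) x)
  · exact key _ _ (continuous_pd hf i) hg.continuous
      (hc.imp (fun h => hasCompactSupport_pd h i) id)
  · exact key _ _ hf.continuous (continuous_pd hg i)
      (hc.imp id (fun h => hasCompactSupport_pd h i))
  · exact key _ _ hf.continuous hg.continuous hc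

lemma continuous_laplacian {f : Plane → ℝ} (hf : ContDiff ℝ 2 f) :
    Continuous (Laplacian.laplacian f) := by
  have : Laplacian.laplacian f = fun x => ∑ i, pd i (pd i f) x := by
    funext x
    exact laplacian_eq hf.contDiffAt
  rw [this]
  exact continuous_finsetSum _ fun i _ => continuous_pd (contDiff_pd_one hf i) i

lemma tsupport_laplacian_subset (f : Plane → ℝ) :
    tsupport (Laplacian.laplacian f) ⊆ tsupport f := by
  refine closure_minimal (fun x hx => ?_) isClosed_closure
  by_contra h
  apply hx
  have h0 : f =ᶠ[𝓝 x] fun _ => 0 := notMem_tsupport_iff_eventuallyEq.mp h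
  rw [InnerProductSpace.laplacian_congr_nhds h0 |>.self_of_nhds]
  exact congrFun InnerProductSpace.laplacian_const x

lemma hasCompactSupport_laplacian {f : Plane → ℝ} (hf : HasCompactSupport f) :
    HasCompactSupport (Laplacian.laplacian f) :=
  hf.mono' ((subset_tsupport _).trans (tsupport_laplacian_subset f))

/-- Green's first identity. -/
lemma integral_mul_laplacian {f g : Plane → ℝ} (hf : ContDiff ℝ 1 f) (hg : ContDiff ℝ 2 g)
    (hc : HasCompactSupport f ∨ HasCompactSupport g) :
    ∫ x, f x * Laplacian.laplacian g x = - ∫ x, inner ℝ (gradient f x) (gradient g x) := by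
  have int : ∀ p q : Plane → ℝ, Continuous p → Continuous q →
      HasCompactSupport p ∨ HasCompactSupport q → Integrable (fun x => p x * q x) := by
    intro p q hp hq h
    refine (hp.mul hq).integrable_of_hasCompactSupport ?_
    rcases h with h | h
    · exact h.mul_right
    · exact h.mul_left
  simp only [inner_gradient_gradient, laplacian_eq hg.contDiffAt, Finset.mul_sum]
  rw [integral_finsetSum, integral_finsetSum, ← Finset.sum_neg_distrib]
  · exact Finset.sum_congr rfl fun i _ => integral_mul_pd hf (contDiff_pd_one hg i)
      (hc.imp id (fun h => hasCompactSupport_pd h i)) i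
  · intro i _
    exact int _ _ (continuous_pd hf i) (continuous_pd (hg.of_le (by simp)) i)
      (hc.imp (fun h => hasCompactSupport_pd h i) (fun h => hasCompactSupport_pd h i))
  · intro i _
    exact int _ _ hf.continuous (continuous_pd (contDiff_pd_one hg i) i)
      (hc.imp id (fun h => hasCompactSupport_pd (hasCompactSupport_pd h i) i))

/-- Green's second identity. -/
lemma integral_mul_laplacian_comm {f g : Plane → ℝ} (hf : ContDiff ℝ 2 f) (hg : ContDiff ℝ 2 g)
    (hc : HasCompactSupport f ∨ HasCompactSupport g) :
    ∫ x, f x * Laplacian.laplacian g x = ∫ x, g x * Laplacian.laplacian f x := by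
  rw [integral_mul_laplacian (hf.of_le (by simp)) hg hc,
    integral_mul_laplacian (hg.of_le (by simp)) hf hc.symm]
  simp only [real_inner_comm]

lemma laplacian_mul {f g : Plane → ℝ} (hf : ContDiff ℝ 2 f) (hg : ContDiff ℝ 2 g) (x : Plane) :
    Laplacian.laplacian (fun y => f y * g y) x =
      f x * Laplacian.laplacian g x + 2 * inner ℝ (gradient f x) (gradient g x)
        + g x * Laplacian.laplacian f x := by
  have d1 : ∀ x, DifferentiableAt ℝ f x := fun x => hf.differentiable (by simp) x
  have d2 : ∀ x, DifferentiableAt ℝ g x := fun x => hg.differentiable (by simp) x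
  have d3 : ∀ i x, DifferentiableAt ℝ (pd i f) x := fun i x =>
    (contDiff_pd_one hf i).differentiable (by simp) x
  have d4 : ∀ i x, DifferentiableAt ℝ (pd i g) x := fun i x =>
    (contDiff_pd_one hg i).differentiable (by simp) x
  rw [laplacian_eq (hf.mul hg).contDiffAt, laplacian_eq hf.contDiffAt, laplacian_eq hg.contDiffAt,
    inner_gradient_gradient, Finset.mul_sum, Finset.mul_sum, Finset.mul_sum,
    ← Finset.sum_add_distrib, ← Finset.sum_add_distrib]
  refine Finset.sum_congr rfl fun i _ => ?_
  have : pd i (fun y => f y * g y) = fun y => f y * pd i g y + pd i f y * g y := by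
    funext y
    exact pd_mul (d1 y) (d2 y) i
  rw [this, pd_add ((d1 x).fun_mul (d4 i x)) ((d3 i x).fun_mul (d2 x)), pd_mul (d1 x) (d4 i x),
    pd_mul (d3 i x) (d2 x)]
  ring

lemma laplacian_comp {F : ℝ → ℝ} {f : Plane → ℝ} (hF : ContDiff ℝ 2 F) (hf : ContDiff ℝ 2 f)
    (x : Plane) :
    Laplacian.laplacian (fun y => F (f y)) x =
      deriv F (f x) * Laplacian.laplacian f x + deriv (deriv F) (f x) * ‖gradient f x‖ ^ 2 := by
  have hF1 : ContDiff ℝ 1 (deriv F) :=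
    ((contDiff_succ_iff_deriv (n := 1)).1 (by simpa [one_add_one_eq_two] using hF)).2.2
  have d1 : ∀ x, DifferentiableAt ℝ f x := fun x => hf.differentiable (by simp) x
  have d3 : ∀ i x, DifferentiableAt ℝ (pd i f) x := fun i x =>
    (contDiff_pd_one hf i).differentiable (by simp) x
  have e1 : ∀ t, DifferentiableAt ℝ F t := fun t => hF.differentiable (by simp) t
  have e2 : ∀ t, DifferentiableAt ℝ (deriv F) t := fun t => hF1.differentiable (by simp) t
  have hFf : ContDiff ℝ 2 fun y => F (f y) := hF.comp hf
  rw [laplacian_eq hFf.contDiffAt, laplacian_eq hf.contDiffAt,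
    norm_sq_gradient, Finset.mul_sum, Finset.mul_sum, ← Finset.sum_add_distrib]
  refine Finset.sum_congr rfl fun i _ => ?_
  have : pd i (fun y => F (f y)) = fun y => deriv F (f y) * pd i f y := by
    funext y
    exact pd_comp (e1 _) (d1 y) i
  have e3 : DifferentiableAt ℝ (fun y => deriv F (f y)) x := (e2 _).comp x (d1 x)
  rw [this, pd_mul e3 (d3 i x), pd_comp (e2 _) (d1 x)]
  ring

lemma two_le_infty : (2 : WithTop ℕ∞) ≤ ∞ := ENat.LEInfty.out

/-! ### Polynomial averaging kernels and interior estimates -/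

lemma hasDerivAt_max_pow (m : ℕ) (t : ℝ) :
    HasDerivAt (fun t : ℝ => max t 0 ^ (m + 2)) ((m + 2) * max t 0 ^ (m + 1)) t := by
  rcases lt_trichotomy t 0 with h | h | h
  · have : (fun t : ℝ => max t 0 ^ (m + 2)) =ᶠ[𝓝 t] fun _ => 0 := by
      filter_upwards [gt_mem_nhds h] with s hs
      simp [max_eq_right hs.le]
    rw [max_eq_right h.le]
    simpa using (hasDerivAt_const t (0 : ℝ)).congr_of_eventuallyEq this
  · subst h
    rw [hasDerivAt_iff_isLittleO]
    simp only [max_self, ne_eq, Nat.add_eq_zero_iff, OfNat.ofNat_ne_zero, and_false,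
      not_false_eq_true, zero_pow, one_ne_zero, mul_zero, smul_zero, sub_zero]
    refine Asymptotics.IsBigO.trans_isLittleO (g := fun t : ℝ => t ^ (m + 2)) ?_ ?_
    · refine Asymptotics.isBigO_of_le _ fun s => ?_
      rw [norm_pow, norm_pow]
      gcongr
      rw [Real.norm_eq_abs, Real.norm_eq_abs, abs_of_nonneg (le_max_right _ _)]
      exact max_le (le_abs_self _) (abs_nonneg _)
    · have := Asymptotics.isLittleO_pow_pow (𝕜 := ℝ) (m := 1) (n := m + 2) (by omega)
      simpa using this
  · have : (fun t : ℝ => max t 0 ^ (m + 2)) =ᶠ[𝓝 t] fun t => t ^ (m + 2) := by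
      filter_upwards [lt_mem_nhds h] with s hs
      simp [max_eq_left hs.le]
    rw [max_eq_left h.le]
    have h2 := (hasDerivAt_pow (m + 2) t).congr_of_eventuallyEq this
    refine h2.congr_deriv ?_
    push_cast
    rfl

/-- The averaging kernel `((1 - |y|²)⁺)ᵐ`. -/
noncomputable def kernel (m : ℕ) (y : Plane) : ℝ := max (1 - ‖y‖ ^ 2) 0 ^ m

lemma kernel_nonneg (m : ℕ) (y : Plane) : 0 ≤ kernel m y :=
  pow_nonneg (le_max_right _ _) m

lemma kernel_eq_zero {m : ℕ} {y : Plane} (hy : 1 ≤ ‖y‖) : kernel (m + 1) y = 0 := by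
  have : 1 - ‖y‖ ^ 2 ≤ 0 := by nlinarith
  simp [kernel, max_eq_right this]

lemma continuous_kernel (m : ℕ) : Continuous (kernel m) := by
  unfold kernel
  fun_prop

lemma hasCompactSupport_kernel (m : ℕ) : HasCompactSupport (kernel (m + 1)) := by
  refine HasCompactSupport.intro (isCompact_closedBall (0 : Plane) 1) fun x hx => ?_
  rw [mem_closedBall_zero_iff, not_le] at hx
  exact kernel_eq_zero hx.le

lemma contDiff_kernel (m : ℕ) : ContDiff ℝ 1 (kernel (m + 2)) := by
  have h1 : ContDiff ℝ 1 (fun t : ℝ => max t 0 ^ (m + 2)) := by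
    rw [contDiff_one_iff_deriv]
    refine ⟨fun t => (hasDerivAt_max_pow m t).differentiableAt, ?_⟩
    have : deriv (fun t : ℝ => max t 0 ^ (m + 2)) = fun t : ℝ => (m + 2) * max t 0 ^ (m + 1) :=
      funext fun t => (hasDerivAt_max_pow m t).deriv
    rw [this]
    fun_prop
  exact h1.comp (contDiff_const.sub (contDiff_norm_sq ℝ))

lemma pd_norm_sq (i : Fin 2) (y : Plane) : pd i (fun y => ‖y‖ ^ 2) y = 2 * y i := by
  unfold pd
  rw [fderiv_norm_sq_apply]
  simp [EuclideanSpace.inner_single_right]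

lemma pd_kernel (m : ℕ) (i : Fin 2) (y : Plane) :
    pd i (kernel (m + 2)) y = -(2 * (m + 2)) * (y i * kernel (m + 1) y) := by
  have hd : DifferentiableAt ℝ (fun y : Plane => ‖y‖ ^ 2) y :=
    (contDiff_norm_sq ℝ (n := 1)).differentiable (by simp) y
  have := pd_comp (F := fun t : ℝ => max t 0 ^ (m + 2)) (f := fun y : Plane => 1 - ‖y‖ ^ 2) (x := y)
    (hasDerivAt_max_pow m _).differentiableAt ((differentiableAt_const _).sub hd) i
  rw [(hasDerivAt_max_pow m _).deriv, pd_sub (differentiableAt_const _) hd, pd_const,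
    pd_norm_sq] at this
  unfold kernel
  rw [this]
  ring

lemma integral_kernel_pos (m : ℕ) : 0 < ∫ y, kernel (m + 1) y := by
  rw [integral_pos_iff_support_of_nonneg (kernel_nonneg _)
    ((continuous_kernel _).integrable_of_hasCompactSupport (hasCompactSupport_kernel _))]
  refine ((continuous_kernel (m + 1)).isOpen_support).measure_pos volume ⟨0, ?_⟩
  simp [kernel]

lemma pd_comp_affine {v : Plane → ℝ} (hv : ContDiff ℝ 1 v) (x : Plane) (r : ℝ) (i : Fin 2)
    (y : Plane) : pd i (fun y => v (x + r • y)) y = r * pd i v (x + r • y) := by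
  have h1 : HasFDerivAt (fun y : Plane => x + r • y)
      (r • ContinuousLinearMap.id ℝ Plane) y :=
    ((hasFDerivAt_id y).const_smul r).const_add x
  have h2 := (hv.differentiable (by simp) (x + r • y)).hasFDerivAt.comp y h1
  unfold pd
  change fderiv ℝ (v ∘ fun y => x + r • y) y _ = _
  rw [h2.fderiv]
  simp

lemma contDiff_comp_affine {n : WithTop ℕ∞} {v : Plane → ℝ} (hv : ContDiff ℝ n v) (x : Plane)
    (r : ℝ) : ContDiff ℝ n (fun y => v (x + r • y)) :=
  hv.comp (contDiff_const.add (contDiff_id.const_smul r))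

lemma fderiv_apply_eq_sum (v : Plane → ℝ) (x y : Plane) :
    fderiv ℝ v x y = ∑ i, y i * pd i v x := by
  rw [← inner_gradient, real_inner_comm, inner_gradient_left]

lemma integrable_mul_kernel {w : Plane → ℝ} (hw : Continuous w) (m : ℕ) :
    Integrable (fun y => w y * kernel (m + 1) y) :=
  (hw.mul (continuous_kernel _)).integrable_of_hasCompactSupport
    ((hasCompactSupport_kernel m).mul_left)

lemma hasDerivAt_average {v : Plane → ℝ} (hv : ContDiff ℝ 2 v) (x : Plane) (m : ℕ) (r : ℝ) :
    HasDerivAt (fun r : ℝ => ∫ y, v (x + r • y) * kernel (m + 1) y)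
      (r / (2 * (m + 2)) *
        ∫ y, Laplacian.laplacian v (x + r • y) * kernel (m + 2) y) r := by
  have hv1 : ContDiff ℝ 1 v := hv.of_le (by simp)
  have hcont : ∀ r : ℝ, Continuous fun y : Plane => x + r • y := fun r => by fun_prop
  have hfd : Continuous (fderiv ℝ v) := hv1.continuous_fderiv (by simp)
  obtain ⟨M, hM⟩ : ∃ M, ∀ s ∈ Metric.closedBall r 1, ∀ y ∈ Metric.closedBall (0 : Plane) 1,
      ‖fderiv ℝ v (x + s • y) y‖ ≤ M := by
    have hK : IsCompact (Metric.closedBall r 1 ×ˢ Metric.closedBall (0 : Plane) 1) :=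
      (isCompact_closedBall _ _).prod (isCompact_closedBall _ _)
    have hc : Continuous fun p : ℝ × Plane => fderiv ℝ v (x + p.1 • p.2) p.2 :=
      (hfd.comp (by fun_prop)).clm_apply continuous_snd
    obtain ⟨M, hM⟩ := hK.exists_bound_of_continuousOn hc.continuousOn
    exact ⟨M, fun s hs y hy => hM (s, y) ⟨hs, hy⟩⟩
  have key := (hasDerivAt_integral_of_dominated_loc_of_deriv_le (μ := (volume : Measure Plane))
    (F := fun s y => v (x + s • y) * kernel (m + 1) y)
    (F' := fun s y => fderiv ℝ v (x + s • y) y * kernel (m + 1) y) (x₀ := r)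
    (s := Metric.closedBall r 1) (bound := fun y => M * kernel (m + 1) y)
    (Metric.closedBall_mem_nhds r one_pos)
    (.of_forall fun s => ((hv.continuous.comp (hcont s)).mul
      (continuous_kernel _)).aestronglyMeasurable)
    (integrable_mul_kernel (hv.continuous.comp (hcont r)) m)
    (((hfd.comp (hcont r)).clm_apply continuous_id).mul
      (continuous_kernel _)).aestronglyMeasurable
    (.of_forall fun y s hs => by
      rw [norm_mul, Real.norm_of_nonneg (kernel_nonneg _ _)]
      by_cases hy : ‖y‖ ≤ 1
      · exact mul_le_mul_of_nonneg_right (hM s hs y (by simpa using hy)) (kernel_nonneg _ _)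
      · rw [kernel_eq_zero (not_le.1 hy).le]; simp)
    (integrable_mul_kernel continuous_const m)
    (.of_forall fun y s _ => by
      refine HasDerivAt.mul_const ?_ _
      have h1 : HasDerivAt (fun s : ℝ => x + s • y) y s := by
        simpa using ((hasDerivAt_id s).smul_const y).const_add x
      exact (hv1.differentiable (by simp) (x + s • y)).hasFDerivAt.comp_hasDerivAt s h1)).2
  refine key.congr_deriv ?_
  have hpd : ∀ i, ContDiff ℝ 1 fun y => pd i v (x + r • y) := fun i =>
    contDiff_comp_affine (contDiff_pd_one hv i) x r
  have hpd2 : ∀ i, Continuous fun y => pd i (pd i v) (x + r • y) := fun i =>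
    (continuous_pd (contDiff_pd_one hv i) i).comp (hcont r)
  have e1 : ∀ y, fderiv ℝ v (x + r • y) y * kernel (m + 1) y =
      ∑ i, -(1 / (2 * (m + 2)) : ℝ) * (pd i v (x + r • y) * pd i (kernel (m + 2)) y) := by
    intro y
    rw [fderiv_apply_eq_sum, Finset.sum_mul]
    refine Finset.sum_congr rfl fun i _ => ?_
    rw [pd_kernel]
    field_simp
  simp only [e1]
  rw [integral_finsetSum _ fun i _ => ?_]
  · simp only [laplacian_eq hv.contDiffAt, Finset.sum_mul]
    rw [integral_finsetSum _ fun i _ => integrable_mul_kernel (hpd2 i) (m + 1), Finset.mul_sum]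
    refine Finset.sum_congr rfl fun i _ => ?_
    rw [integral_const_mul, integral_mul_pd (hpd i) (contDiff_kernel m)
      (Or.inr (hasCompactSupport_kernel _))]
    simp only [pd_comp_affine (contDiff_pd_one hv i), mul_assoc]
    rw [integral_const_mul]
    ring
  · refine Integrable.const_mul ?_ _
    exact ((hpd i).continuous.mul (continuous_pd (contDiff_kernel m) i)).integrable_of_hasCompactSupport
      ((hasCompactSupport_pd (hasCompactSupport_kernel (m + 1)) i).mul_left)

lemma add_smul_mem_ball {x y : Plane} {r s : ℝ} (hr : 0 ≤ r) (hrs : r ≤ s) (hs : 0 < s)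
    (hy : ‖y‖ < 1) : x + r • y ∈ Metric.ball x s := by
  rw [mem_ball_iff_norm, add_sub_cancel_left, norm_smul, Real.norm_of_nonneg hr]
  nlinarith [norm_nonneg y]

lemma abs_integral_mul_kernel_le {w p : Plane → ℝ} {a Λ : ℝ} {m : ℕ}
    (hp : ∀ y, |p y| ≤ a * kernel (m + 1) y) (hw : ∀ y, ‖y‖ < 1 → |w y| ≤ Λ) :
    |∫ y, w y * p y| ≤ Λ * a * ∫ y, kernel (m + 1) y := by
  rw [← integral_const_mul]
  refine norm_integral_le_of_norm_le (f := fun y => w y * p y)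
    (((continuous_kernel _).integrable_of_hasCompactSupport
    (hasCompactSupport_kernel m)).const_mul _) (.of_forall fun y => ?_)
  rw [norm_mul, Real.norm_eq_abs, Real.norm_eq_abs]
  by_cases hy : ‖y‖ < 1
  · calc |w y| * |p y| ≤ Λ * (a * kernel (m + 1) y) :=
          mul_le_mul (hw y hy) (hp y) (abs_nonneg _) ((abs_nonneg _).trans (hw y hy))
      _ = _ := by ring
  · have h0 := kernel_eq_zero (m := m) (not_lt.1 hy)
    have := hp y
    rw [h0, mul_zero] at this
    rw [le_antisymm this (abs_nonneg _), h0]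
    simp

lemma average_le {v : Plane → ℝ} (hv : ContDiff ℝ 2 v) {x : Plane} {s Λ : ℝ} (hs : 0 < s)
    (hΛ : ∀ y ∈ Metric.ball x s, |Laplacian.laplacian v y| ≤ Λ) (m : ℕ) :
    ∫ y, v (x + s • y) * kernel (m + 1) y ≤
      v x * (∫ y, kernel (m + 1) y) + s ^ 2 * Λ * ∫ y, kernel (m + 2) y := by
  have hΛ0 : 0 ≤ Λ := (abs_nonneg _).trans (hΛ x (Metric.mem_ball_self hs))
  have hk := integral_kernel_pos (m + 1)
  have key := norm_image_sub_le_of_norm_deriv_le_segment' (a := 0) (b := s)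
    (C := s * Λ * ∫ y, kernel (m + 2) y)
    (fun r _ => (hasDerivAt_average hv x m r).hasDerivWithinAt) (fun r hr => ?_) s
    ⟨hs.le, le_rfl⟩
  · simp only [zero_smul, add_zero, integral_const_mul, sub_zero] at key
    have := (le_abs_self _).trans key
    linarith
  · have h1 := abs_integral_mul_kernel_le (a := 1) (m := m + 1) (p := kernel (m + 2))
      (w := fun y => Laplacian.laplacian v (x + r • y)) (Λ := Λ)
      (fun y => by rw [one_mul, abs_of_nonneg (kernel_nonneg _ _)])
      (fun y hy => hΛ _ (add_smul_mem_ball hr.1 hr.2.le hs hy))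
    rw [norm_mul, Real.norm_eq_abs, Real.norm_eq_abs, mul_assoc]
    refine mul_le_mul ?_ (by simpa using h1) (abs_nonneg _) hs.le
    rw [abs_of_nonneg (div_nonneg hr.1 (by positivity))]
    rw [div_le_iff₀ (by positivity)]
    have : (0 : ℝ) ≤ m := Nat.cast_nonneg m
    nlinarith [hr.1, hr.2, mul_nonneg hs.le this]

lemma le_average {v : Plane → ℝ} (hv : ContDiff ℝ 2 v) {x : Plane} {s Λ : ℝ} (hs : 0 < s)
    (hΛ : ∀ y ∈ Metric.ball x s, Λ ≤ Laplacian.laplacian v y) (m : ℕ) :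
    v x * (∫ y, kernel (m + 1) y) + s ^ 2 / (4 * (m + 2)) * Λ * (∫ y, kernel (m + 2) y) ≤
      ∫ y, v (x + s • y) * kernel (m + 1) y := by
  set c := ∫ y, kernel (m + 2) y
  have hd : ∀ r : ℝ, HasDerivAt (fun r : ℝ => (∫ y, v (x + r • y) * kernel (m + 1) y)
      - r ^ 2 / (4 * (m + 2)) * Λ * c) ((r / (2 * (m + 2)) *
        ∫ y, Laplacian.laplacian v (x + r • y) * kernel (m + 2) y)
        - r / (2 * (m + 2)) * (Λ * c)) r := by
    intro r
    refine (hasDerivAt_average hv x m r).sub ?_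
    have := (((hasDerivAt_pow 2 r).div_const (4 * (m + 2))).mul_const Λ).mul_const c
    refine this.congr_deriv ?_
    push_cast
    field_simp
    ring
  have hmono : MonotoneOn (fun r : ℝ => (∫ y, v (x + r • y) * kernel (m + 1) y)
      - r ^ 2 / (4 * (m + 2)) * Λ * c) (Set.Icc 0 s) := by
    refine monotoneOn_of_deriv_nonneg (convex_Icc 0 s)
      (fun r _ => (hd r).continuousAt.continuousWithinAt)
      (fun r _ => (hd r).differentiableAt.differentiableWithinAt) fun r hr => ?_
    rw [interior_Icc] at hr
    rw [(hd r).deriv, ← mul_sub]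
    refine mul_nonneg (div_nonneg hr.1.le (by positivity)) (sub_nonneg.2 ?_)
    rw [← integral_const_mul]
    refine integral_mono (integrable_mul_kernel continuous_const (m + 1))
      (integrable_mul_kernel ((continuous_laplacian hv).comp (by fun_prop)) (m + 1)) fun y => ?_
    by_cases hy : ‖y‖ < 1
    · exact mul_le_mul_of_nonneg_right (hΛ _ (add_smul_mem_ball hr.1.le hr.2.le hs hy))
        (kernel_nonneg _ _)
    · simp [kernel_eq_zero (not_lt.1 hy)]
  have := hmono ⟨le_rfl, hs.le⟩ ⟨hs.le, le_rfl⟩ hs.le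
  simp only [zero_smul, add_zero, integral_const_mul, ne_eq, OfNat.ofNat_ne_zero,
    not_false_eq_true, zero_pow, zero_div, zero_mul, sub_zero] at this
  linarith

lemma pd_laplacian {v : Plane → ℝ} (hv : ContDiff ℝ ∞ v) (i : Fin 2) (x : Plane) :
    Laplacian.laplacian (pd i v) x = pd i (Laplacian.laplacian v) x := by
  have h2 : ∀ {w : Plane → ℝ}, ContDiff ℝ ∞ w → ContDiff ℝ 2 w := fun h => h.of_le two_le_infty
  have hL : Laplacian.laplacian v = fun y => pd 0 (pd 0 v) y + pd 1 (pd 1 v) y := by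
    funext y
    rw [laplacian_eq (h2 hv).contDiffAt, Fin.sum_univ_two]
  have hd : ∀ k, DifferentiableAt ℝ (pd k (pd k v)) x := fun k =>
    (contDiff_pd_infty (contDiff_pd_infty hv k) k).differentiable (by simp) x
  have hc : ∀ k, pd k (pd k (pd i v)) x = pd i (pd k (pd k v)) x := by
    intro k
    have : pd k (pd i v) = pd i (pd k v) :=
      funext fun y => pd_comm (h2 hv).contDiffAt k i
    rw [this, pd_comm (h2 (contDiff_pd_infty hv k)).contDiffAt]
  rw [laplacian_eq (h2 (contDiff_pd_infty hv i)).contDiffAt, hL, pd_add (hd 0) (hd 1),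
    Fin.sum_univ_two, hc, hc]

/-- The interior gradient estimate for nonnegative functions with bounded Laplacian. -/
theorem exists_gradient_bound : ∃ C : ℝ, 0 < C ∧ ∀ v : Plane → ℝ, ContDiff ℝ ∞ v →
    ∀ (x : Plane) (s Λ : ℝ), 0 < s → (∀ y ∈ Metric.ball x s, 0 ≤ v y) →
      (∀ y ∈ Metric.ball x s, |Laplacian.laplacian v y| ≤ Λ) →
      ‖gradient v x‖ ≤ C * (v x / s + Λ * s) := by
  set c2 := ∫ y, kernel 2 y
  set c3 := ∫ y, kernel 3 y
  have hc2 : 0 < c2 := integral_kernel_pos 1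
  have hc3 : 0 < c3 := integral_kernel_pos 2
  refine ⟨2 * (6 * c2 / c3 + 7), by positivity, fun v hv x s Λ hs hpos hΛ => ?_⟩
  have hv2 : ContDiff ℝ 2 v := hv.of_le two_le_infty
  have hΛ0 : 0 ≤ Λ := (abs_nonneg _).trans (hΛ x (Metric.mem_ball_self hs))
  have hvx := hpos x (Metric.mem_ball_self hs)
  have hcoord : ∀ i (y : Plane), ‖y‖ < 1 → |y i| ≤ 1 := fun i y hy =>
    (PiLp.norm_apply_le y i).trans hy.le
  have hker : ∀ m i y, |pd i (kernel (m + 2)) y| ≤ 2 * (m + 2) * kernel (m + 1) y := by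
    intro m i y
    rw [pd_kernel, abs_mul, abs_mul, abs_neg, abs_of_pos (by positivity : (0 : ℝ) < 2 * (m + 2)),
      abs_of_nonneg (kernel_nonneg _ _)]
    by_cases hy : ‖y‖ < 1
    · have := mul_le_mul_of_nonneg_right (hcoord i y hy) (kernel_nonneg (m + 1) y)
      rw [one_mul] at this
      gcongr
    · simp [kernel_eq_zero (not_lt.1 hy)]
  have hmain : ∀ i, |pd i v x| ≤ (6 * c2 / c3 + 7) * (v x / s + Λ * s) := by
    intro i
    have hvi : ContDiff ℝ ∞ (pd i v) := contDiff_pd_infty hv i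
    have hvi2 : ContDiff ℝ 2 (pd i v) := hvi.of_le two_le_infty
    have hLv : ContDiff ℝ 1 (Laplacian.laplacian v) := by
      have : Laplacian.laplacian v = fun y => ∑ k, pd k (pd k v) y := by
        funext y
        rw [laplacian_eq hv2.contDiffAt]
      rw [this]
      exact ContDiff.sum fun k _ => (contDiff_pd_infty (contDiff_pd_infty hv k) k).of_le
        (by simp)
    have hder : ∀ r : ℝ, HasDerivAt (fun r : ℝ => ∫ y, pd i v (x + r • y) * kernel 3 y)
        (-(1 / 8) * ∫ y, Laplacian.laplacian v (x + r • y) * pd i (kernel 4) y) r := by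
      intro r
      refine (hasDerivAt_average hvi2 x 2 r).congr_deriv ?_
      rw [integral_mul_pd (contDiff_comp_affine hLv x r) (contDiff_kernel 2)
        (Or.inr (hasCompactSupport_kernel _))]
      simp only [pd_comp_affine hLv, pd_laplacian hv, mul_assoc]
      rw [integral_const_mul]
      push_cast
      ring
    have key := norm_image_sub_le_of_norm_deriv_le_segment' (a := 0) (b := s)
      (C := Λ * c3) (fun r _ => (hder r).hasDerivWithinAt) (fun r hr => ?_) s ⟨hs.le, le_rfl⟩
    · simp only [zero_smul, add_zero, integral_const_mul, sub_zero, Real.norm_eq_abs] at key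
      have h2 : |∫ y, pd i v (x + s • y) * kernel 3 y| ≤ 6 / s * (v x * c2 + s ^ 2 * Λ * c3) := by
        have e1 := integral_mul_pd (contDiff_comp_affine (hv2.of_le (by simp)) x s)
          (contDiff_kernel 1) (Or.inr (hasCompactSupport_kernel _)) i
        simp only [pd_comp_affine (hv2.of_le (by simp) : ContDiff ℝ 1 v), mul_assoc] at e1
        rw [integral_const_mul] at e1
        have e2 : ∫ y, pd i v (x + s • y) * kernel 3 y =
            -(1 / s) * ∫ y, v (x + s • y) * pd i (kernel 3) y := by
          rw [e1]; field_simp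
        have e3 : |∫ y, v (x + s • y) * pd i (kernel 3) y| ≤
            6 * ∫ y, v (x + s • y) * kernel 2 y := by
          rw [← integral_const_mul]
          refine norm_integral_le_of_norm_le (f := fun y => v (x + s • y) * pd i (kernel 3) y)
            ((integrable_mul_kernel (hv.continuous.comp (by fun_prop)) 1).const_mul _)
            (.of_forall fun y => ?_)
          rw [norm_mul, Real.norm_eq_abs, Real.norm_eq_abs]
          by_cases hy : ‖y‖ < 1
          · have hp := hpos _ (add_smul_mem_ball hs.le le_rfl hs hy)
            have hk := hker 1 i y
            rw [abs_of_nonneg hp]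
            calc v (x + s • y) * |pd i (kernel 3) y| ≤ v (x + s • y) *
                (2 * ((1 : ℕ) + 2) * kernel 2 y) := by gcongr
              _ = _ := by push_cast; ring
          · have h0 := kernel_eq_zero (m := 1) (not_lt.1 hy)
            have := hker 1 i y
            rw [h0, mul_zero] at this
            rw [show kernel 2 y = 0 from h0, le_antisymm this (abs_nonneg _)]
            simp
        rw [e2, abs_mul, abs_neg, abs_of_pos (by positivity : 0 < 1 / s)]
        calc 1 / s * |∫ y, v (x + s • y) * pd i (kernel 3) y|
            ≤ 1 / s * (6 * (v x * c2 + s ^ 2 * Λ * c3)) := by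
              gcongr
              exact e3.trans (by gcongr; exact average_le hv2 hs hΛ 1)
          _ = _ := by ring
      have h3 : |pd i v x| * c3 ≤ 6 / s * (v x * c2 + s ^ 2 * Λ * c3) + Λ * c3 * s := by
        rw [← abs_of_pos hc3, ← abs_mul, abs_of_pos hc3]
        have := abs_sub_abs_le_abs_sub (pd i v x * c3) (∫ y, pd i v (x + s • y) * kernel 3 y)
        rw [abs_sub_comm] at this
        linarith
      have h4 : |pd i v x| ≤ (6 / s * (v x * c2 + s ^ 2 * Λ * c3) + Λ * c3 * s) / c3 :=
        (le_div_iff₀ hc3).2 h3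
      refine h4.trans ?_
      have e5 : (6 / s * (v x * c2 + s ^ 2 * Λ * c3) + Λ * c3 * s) / c3 =
          6 * c2 / c3 * (v x / s) + 7 * (Λ * s) := by
        field_simp
        ring
      rw [e5]
      have a1 : 0 ≤ v x / s := by positivity
      have a2 : 0 ≤ Λ * s := by positivity
      have a3 : 0 ≤ 6 * c2 / c3 := by positivity
      nlinarith [mul_nonneg a3 a2]
    · have h1 := abs_integral_mul_kernel_le (a := 2 * ((2 : ℕ) + 2)) (m := 2) (p := pd i (kernel 4))
        (w := fun y => Laplacian.laplacian v (x + r • y)) (Λ := Λ) (hker 2 i)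
        (fun y hy => hΛ _ (add_smul_mem_ball hr.1 hr.2.le hs hy))
      rw [norm_mul, Real.norm_eq_abs, Real.norm_eq_abs]
      have : |(-(1 / 8) : ℝ)| = 1 / 8 := by norm_num
      rw [this]
      push_cast at h1
      have e : Λ * (2 * (2 + 2)) * ∫ y, kernel (2 + 1) y = 8 * (Λ * c3) := by
        simp only [c3]; ring
      rw [e] at h1
      linarith
  have hsum : ‖gradient v x‖ ≤ |pd 0 v x| + |pd 1 v x| := by
    refine abs_le_of_sq_le_sq' ?_ (by positivity) |>.2
    rw [norm_sq_gradient, Fin.sum_univ_two, ← sq_abs (pd 0 v x), ← sq_abs (pd 1 v x)]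
    nlinarith [mul_nonneg (abs_nonneg (pd 0 v x)) (abs_nonneg (pd 1 v x))]
  have h0 := hmain 0
  have h1 := hmain 1
  calc _ ≤ _ := hsum
    _ ≤ _ := add_le_add h0 h1
    _ = _ := by ring

/-! ### Convergence in `L²` and test functions -/

section L2

variable {F : Type*} [NormedAddCommGroup F]

/-- Convergence in `L²` of a sequence of functions on the plane. -/
def L2Tendsto (f : ℕ → Plane → F) (g : Plane → F) : Prop :=
  Tendsto (fun n => eLpNorm (fun x => f n x - g x) 2 volume) atTop (𝓝 0)

lemma L2Tendsto.toLp {f : ℕ → Plane → F} {g : Plane → F} (h : L2Tendsto f g)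
    (hf : ∀ n, MemLp (f n) 2 volume) (hg : MemLp g 2 volume) :
    Tendsto (fun n => (hf n).toLp) atTop (𝓝 hg.toLp) :=
  (Lp.tendsto_Lp_iff_tendsto_eLpNorm'' f hf g hg).2 h

lemma L2Tendsto.of_toLp {f : ℕ → Plane → F} {g : Plane → F}
    (hf : ∀ n, MemLp (f n) 2 volume) (hg : MemLp g 2 volume)
    (h : Tendsto (fun n => (hf n).toLp) atTop (𝓝 hg.toLp)) : L2Tendsto f g :=
  (Lp.tendsto_Lp_iff_tendsto_eLpNorm'' f hf g hg).1 h

lemma l2Tendsto_const (g : Plane → F) : L2Tendsto (fun _ => g) g := by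
  simp [L2Tendsto]

lemma L2Tendsto.of_le {G : Type*} [NormedAddCommGroup G] {f : ℕ → Plane → F} {g : Plane → F}
    {f' : ℕ → Plane → G} {g' : Plane → G} (h : L2Tendsto f g) (c : ℝ)
    (hle : ∀ n, ∀ᵐ x, ‖f' n x - g' x‖ ≤ c * ‖f n x - g x‖) : L2Tendsto f' g' := by
  refine tendsto_of_tendsto_of_tendsto_of_le_of_le tendsto_const_nhds
    (?_ : Tendsto (fun n => ENNReal.ofReal c * eLpNorm (fun x => f n x - g x) 2 volume) atTop (𝓝 0))
    (fun _ => zero_le) fun n => ?_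
  · have := ENNReal.Tendsto.const_mul (a := ENNReal.ofReal c) h (Or.inr ENNReal.ofReal_ne_top)
    simpa using this
  · exact eLpNorm_le_mul_eLpNorm_of_ae_le_mul (hle n) 2

lemma L2Tendsto.ae_eq {f : ℕ → Plane → F} {g h : Plane → F} (hf : ∀ n, MemLp (f n) 2 volume)
    (hg : MemLp g 2 volume) (hh : MemLp h 2 volume) (h1 : L2Tendsto f g) (h2 : L2Tendsto f h) :
    g =ᵐ[volume] h :=
  (MemLp.toLp_eq_toLp_iff hg hh).1 (tendsto_nhds_unique (h1.toLp hf hg) (h2.toLp hf hh))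

lemma L2Tendsto.comp_isometry {f : ℕ → Plane → F} {g : Plane → F}
    (hf : ∀ n, MemLp (f n) 2 volume) (hg : MemLp g 2 volume) (h : L2Tendsto f g)
    (ρ : Plane ≃ₗᵢ[ℝ] Plane) : L2Tendsto (fun n x => f n (ρ x)) (fun x => g (ρ x)) := by
  refine h.congr fun n => ?_
  have := eLpNorm_comp_measurePreserving (p := 2) (g := fun x => f n x - g x)
    ((hf n).1.sub hg.1) ρ.measurePreserving
  exact this.symm

variable [InnerProductSpace ℝ F]

lemma integral_inner_toLp {f g : Plane → F} (hf : MemLp f 2 volume) (hg : MemLp g 2 volume) :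
    inner ℝ hf.toLp hg.toLp = ∫ x, inner ℝ (f x) (g x) := by
  rw [L2.inner_def]
  refine integral_congr_ae ?_
  filter_upwards [hf.coeFn_toLp, hg.coeFn_toLp] with x h1 h2
  rw [h1, h2]

lemma integrable_inner_of_memLp {f g : Plane → F} (hf : MemLp f 2 volume)
    (hg : MemLp g 2 volume) : Integrable (fun x => inner ℝ (f x) (g x)) := by
  refine (L2.integrable_inner (𝕜 := ℝ) hf.toLp hg.toLp).congr ?_
  filter_upwards [hf.coeFn_toLp, hg.coeFn_toLp] with x h1 h2
  rw [h1, h2]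

lemma L2Tendsto.integral_inner {f h : ℕ → Plane → F} {g k : Plane → F}
    (hf : ∀ n, MemLp (f n) 2 volume) (hg : MemLp g 2 volume) (hh : ∀ n, MemLp (h n) 2 volume)
    (hk : MemLp k 2 volume) (h1 : L2Tendsto f g) (h2 : L2Tendsto h k) :
    Tendsto (fun n => ∫ x, inner ℝ (f n x) (h n x)) atTop (𝓝 (∫ x, inner ℝ (g x) (k x))) := by
  simp only [← integral_inner_toLp (hf _) (hh _), ← integral_inner_toLp hg hk]
  exact (h1.toLp hf hg).inner (h2.toLp hh hk)

lemma norm_toLp_sq {f : Plane → F} (hf : MemLp f 2 volume) :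
    ‖hf.toLp‖ ^ 2 = ∫ x, ‖f x‖ ^ 2 := by
  rw [← real_inner_self_eq_norm_sq, integral_inner_toLp]
  simp only [real_inner_self_eq_norm_sq]

lemma abs_integral_inner_le {f g : Plane → F} (hf : MemLp f 2 volume) (hg : MemLp g 2 volume) :
    |∫ x, inner ℝ (f x) (g x)| ≤ √(∫ x, ‖f x‖ ^ 2) * √(∫ x, ‖g x‖ ^ 2) := by
  rw [← integral_inner_toLp hf hg, ← norm_toLp_sq hf, ← norm_toLp_sq hg,
    Real.sqrt_sq (norm_nonneg _), Real.sqrt_sq (norm_nonneg _)]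
  exact abs_real_inner_le_norm _ _

lemma integrable_norm_sq {f : Plane → F} (hf : MemLp f 2 volume) :
    Integrable (fun x => ‖f x‖ ^ 2) := by
  simpa only [real_inner_self_eq_norm_sq] using integrable_inner_of_memLp hf hf

lemma L2Tendsto.integral_norm_sub_sq {f : ℕ → Plane → F} {g : Plane → F}
    (hf : ∀ n, MemLp (f n) 2 volume) (hg : MemLp g 2 volume) (h : L2Tendsto f g) :
    Tendsto (fun n => ∫ x, ‖f n x - g x‖ ^ 2) atTop (𝓝 0) := by
  have h1 : L2Tendsto (fun n x => f n x - g x) (fun _ => (0 : F)) :=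
    h.of_le 1 fun n => .of_forall fun x => by simp
  have hm : ∀ n, MemLp (fun x => f n x - g x) 2 volume := fun n => (hf n).sub hg
  have h0 : MemLp (fun _ : Plane => (0 : F)) 2 volume := MemLp.zero'
  simpa using h1.integral_inner hm h0 hm h0 h1

end L2

lemma integrable_mul_of_memLp {f g : Plane → ℝ} (hf : MemLp f 2 volume)
    (hg : MemLp g 2 volume) : Integrable (fun x => f x * g x) := by
  refine (integrable_inner_of_memLp hf hg).congr (.of_forall fun x => ?_)
  simp [mul_comm]

lemma L2Tendsto.integral_mul {f h : ℕ → Plane → ℝ} {g k : Plane → ℝ}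
    (hf : ∀ n, MemLp (f n) 2 volume) (hg : MemLp g 2 volume) (hh : ∀ n, MemLp (h n) 2 volume)
    (hk : MemLp k 2 volume) (h1 : L2Tendsto f g) (h2 : L2Tendsto h k) :
    Tendsto (fun n => ∫ x, f n x * h n x) atTop (𝓝 (∫ x, g x * k x)) := by
  have := h1.integral_inner hf hg hh hk h2
  simpa [mul_comm] using this

section Test

variable {U : Set Plane} {φ ψ : Plane → ℝ}

lemma IsTestFunction.contDiff_of (hφ : IsTestFunction U φ) {n : ℕ∞} : ContDiff ℝ n φ :=
  hφ.1.of_le (by exact_mod_cast le_top)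

lemma IsTestFunction.contDiff_one (hφ : IsTestFunction U φ) : ContDiff ℝ 1 φ :=
  hφ.contDiff_of (n := 1)

lemma IsTestFunction.contDiff_two (hφ : IsTestFunction U φ) : ContDiff ℝ 2 φ :=
  hφ.contDiff_of (n := 2)

lemma IsTestFunction.continuous (hφ : IsTestFunction U φ) : Continuous φ := hφ.1.continuous

lemma IsTestFunction.differentiable (hφ : IsTestFunction U φ) (x : Plane) :
    DifferentiableAt ℝ φ x := hφ.1.differentiable (by simp) x

lemma IsTestFunction.mono {V : Set Plane} (hφ : IsTestFunction U φ) (h : U ⊆ V) :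
    IsTestFunction V φ := ⟨hφ.1, hφ.2.1, hφ.2.2.trans h⟩

lemma IsTestFunction.eq_zero (hφ : IsTestFunction U φ) {x : Plane} (hx : x ∉ U) : φ x = 0 := by
  by_contra h
  exact hx (hφ.2.2 (subset_tsupport _ h))

lemma IsTestFunction.memLp (hφ : IsTestFunction U φ) : MemLp φ 2 volume :=
  hφ.continuous.memLp_of_hasCompactSupport hφ.2.1

lemma IsTestFunction.integrable (hφ : IsTestFunction U φ) : Integrable φ :=
  hφ.continuous.integrable_of_hasCompactSupport hφ.2.1

lemma IsTestFunction.memLp_gradient (hφ : IsTestFunction U φ) : MemLp (gradient φ) 2 volume :=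
  (continuous_gradient hφ.contDiff_one).memLp_of_hasCompactSupport
    (hasCompactSupport_gradient hφ.2.1)

lemma IsTestFunction.memLp_laplacian (hφ : IsTestFunction U φ) :
    MemLp (Laplacian.laplacian φ) 2 volume :=
  (continuous_laplacian hφ.contDiff_two).memLp_of_hasCompactSupport
    (hasCompactSupport_laplacian hφ.2.1)

lemma IsTestFunction.add_smul (hφ : IsTestFunction U φ) (hψ : IsTestFunction U ψ) (s t : ℝ) :
    IsTestFunction U (fun x => s * φ x + t * ψ x) := by
  have hsub : Function.support (fun x => s * φ x + t * ψ x) ⊆ tsupport φ ∪ tsupport ψ := by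
    intro x hx
    by_contra h
    rw [Set.mem_union, not_or] at h
    apply hx
    simp [image_eq_zero_of_notMem_tsupport h.1, image_eq_zero_of_notMem_tsupport h.2]
  refine ⟨(contDiff_const.mul hφ.1).add (contDiff_const.mul hψ.1), ?_, ?_⟩
  · exact (IsCompact.union hφ.2.1 hψ.2.1).of_isClosed_subset isClosed_closure
      (closure_minimal hsub ((isClosed_tsupport _).union (isClosed_tsupport _)))
  · exact (closure_minimal hsub ((isClosed_tsupport _).union (isClosed_tsupport _))).trans
      (Set.union_subset hφ.2.2 hψ.2.2)

lemma IsTestFunction.gradient_add_smul (hφ : IsTestFunction U φ) (hψ : IsTestFunction U ψ)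
    (s t : ℝ) (x : Plane) :
    gradient (fun x => s * φ x + t * ψ x) x = s • gradient φ x + t • gradient ψ x := by
  ext i
  rw [gradient_apply, pd_add ((hφ.differentiable x).const_mul s) ((hψ.differentiable x).const_mul t),
    pd_const_mul (hφ.differentiable x), pd_const_mul (hψ.differentiable x)]
  simp [gradient_apply]

lemma IsTestFunction.comp_isometry (hφ : IsTestFunction U φ) (ρ : Plane ≃ₗᵢ[ℝ] Plane)
    {V : Set Plane} (hV : ∀ x, ρ x ∈ U → x ∈ V) : IsTestFunction V (fun x => φ (ρ x)) := by
  have hts : tsupport (fun x => φ (ρ x)) = ρ ⁻¹' tsupport φ :=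
    tsupport_comp_eq_preimage φ ρ.toHomeomorph
  refine ⟨hφ.1.comp ρ.contDiff, ?_, ?_⟩
  · exact hφ.2.1.comp_homeomorph ρ.toHomeomorph
  · rw [hts]
    exact fun x hx => hV x (hφ.2.2 hx)

end Test

lemma norm_gradient_comp_isometry (f : Plane → ℝ) (ρ : Plane ≃ₗᵢ[ℝ] Plane) (x : Plane) :
    ‖gradient (fun x => f (ρ x)) x‖ = ‖gradient f (ρ x)‖ := by
  rw [norm_gradient, norm_gradient]
  have : fderiv ℝ (fun x => f (ρ x)) x = (fderiv ℝ f (ρ x)).comp (ρ : Plane →L[ℝ] Plane) :=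
    ρ.toContinuousLinearEquiv.comp_right_fderiv (f := f) (x := x)
  rw [this]
  exact ContinuousLinearMap.opNorm_comp_linearIsometryEquiv _ ρ

/-- The Poincaré inequality on bounded sets. -/
lemma exists_poincare {D : Set Plane} (hD : Bornology.IsBounded D) : ∃ C : ℝ, 0 < C ∧
    ∀ φ : Plane → ℝ, IsTestFunction D φ → ∫ x, φ x ^ 2 ≤ C * ∫ x, ‖gradient φ x‖ ^ 2 := by
  obtain ⟨R, hR⟩ := hD.subset_closedBall 0
  set K := Metric.closedBall (0 : Plane) R
  have hK : volume K < ⊤ := measure_closedBall_lt_top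
  have h2 : ((Module.finrank ℝ Plane : NNReal)).HolderConjugate 2 := by
    rw [finrank_euclideanSpace_fin]
    exact NNReal.HolderConjugate.two_two
  set c0 := eLpNormLESNormFDerivOneConst (volume : Measure Plane) 2
  set c := (c0 : ENNReal) * volume K ^ (1 / 2 : ℝ)
  have hc : c ≠ ⊤ := ENNReal.mul_ne_top ENNReal.coe_ne_top
    (ENNReal.rpow_ne_top_of_nonneg (by norm_num) hK.ne)
  refine ⟨c.toReal ^ 2 + 1, by positivity, fun φ hφ => ?_⟩
  have hsupp : Function.support (gradient φ) ⊆ K :=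
    (subset_tsupport _).trans ((tsupport_gradient_subset φ).trans (hφ.2.2.trans hR))
  have e1 : eLpNorm (fderiv ℝ φ) 1 volume = eLpNorm (gradient φ) 1 volume :=
    eLpNorm_congr_norm_ae (.of_forall fun x => (norm_gradient φ x).symm)
  have e2 := eLpNorm_le_eLpNorm_fderiv_one (volume : Measure Plane) hφ.contDiff_one hφ.2.1 h2
  have e3 : eLpNorm (gradient φ) 1 volume ≤
      eLpNorm (gradient φ) 2 volume * volume K ^ (1 / 2 : ℝ) := by
    rw [← eLpNorm_restrict_eq_of_support_subset (μ := volume) (p := 1) hsupp,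
      ← eLpNorm_restrict_eq_of_support_subset (μ := volume) (p := 2) hsupp]
    have := eLpNorm_le_eLpNorm_mul_rpow_measure_univ (μ := volume.restrict K) (p := 1) (q := 2)
      (by norm_num) hφ.memLp_gradient.1.restrict
    rw [Measure.restrict_apply_univ] at this
    refine this.trans_eq ?_
    norm_num
  have e4 : eLpNorm φ 2 volume ≤ c * eLpNorm (gradient φ) 2 volume := by
    rw [e1] at e2
    calc eLpNorm φ 2 volume ≤ c0 * eLpNorm (gradient φ) 1 volume := by exact_mod_cast e2
      _ ≤ c0 * (eLpNorm (gradient φ) 2 volume * volume K ^ (1 / 2 : ℝ)) := by gcongr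
      _ = _ := by ring
  have e5 : ‖hφ.memLp.toLp‖ ≤ c.toReal * ‖hφ.memLp_gradient.toLp‖ := by
    rw [Lp.norm_toLp, Lp.norm_toLp, ← ENNReal.toReal_mul]
    exact ENNReal.toReal_mono (ENNReal.mul_ne_top hc hφ.memLp_gradient.2.ne) e4
  have e6 := norm_toLp_sq hφ.memLp
  simp only [Real.norm_eq_abs, sq_abs] at e6
  rw [← e6, ← norm_toLp_sq hφ.memLp_gradient]
  calc ‖hφ.memLp.toLp‖ ^ 2 ≤ (c.toReal * ‖hφ.memLp_gradient.toLp‖) ^ 2 := by gcongr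
    _ = c.toReal ^ 2 * ‖hφ.memLp_gradient.toLp‖ ^ 2 := by ring
    _ ≤ _ := by gcongr; linarith

/-! ### Existence of minimizers -/

lemma exists_l2Tendsto {F : Type*} [NormedAddCommGroup F] [InnerProductSpace ℝ F]
    [CompleteSpace F] {f : ℕ → Plane → F} (hf : ∀ n, MemLp (f n) 2 volume) (K : ℝ)
    (h : ∀ N n k : ℕ, N ≤ n → N ≤ k → ∫ x, ‖f n x - f k x‖ ^ 2 ≤ K / (N + 1)) :
    ∃ g : Plane → F, StronglyMeasurable g ∧ MemLp g 2 volume ∧ L2Tendsto f g := by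
  have hc : CauchySeq fun n => (hf n).toLp := by
    refine cauchySeq_of_le_tendsto_0 (fun N : ℕ => √(K / (N + 1))) (fun n k N hn hk => ?_) ?_
    · rw [dist_eq_norm, ← MemLp.toLp_sub]
      refine Real.le_sqrt_of_sq_le ?_
      rw [norm_toLp_sq]
      exact h N n k hn hk
    · have : Tendsto (fun N : ℕ => K / ((N : ℝ) + 1)) atTop (𝓝 0) := by
        have := (tendsto_one_div_add_atTop_nhds_zero_nat (𝕜 := ℝ)).const_mul K
        simpa [div_eq_mul_inv] using this
      simpa using this.sqrt
  obtain ⟨g, hg⟩ := cauchySeq_tendsto_of_complete hc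
  have hgm : MemLp g 2 volume := Lp.memLp g
  refine ⟨g, Lp.stronglyMeasurable g, hgm, L2Tendsto.of_toLp hf hgm ?_⟩
  rwa [Lp.toLp_coeFn]

/-- The energy `∫ (½ |∇φ|² + φ⁺ - b φ)`. -/
noncomputable def relaxedEnergy (b φ : Plane → ℝ) : ℝ :=
  1 / 2 * (∫ x, ‖gradient φ x‖ ^ 2) + (∫ x, max (φ x) 0) - ∫ x, b x * φ x

section Existence

variable {D : Set Plane} {b : Plane → ℝ}

lemma IsTestFunction.integrable_max {φ : Plane → ℝ} (hφ : IsTestFunction D φ) :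
    Integrable fun x => max (φ x) 0 := hφ.integrable.pos_part

lemma relaxedEnergy_midpoint {φ ψ : Plane → ℝ} (hb : MemLp b 2 volume)
    (hφ : IsTestFunction D φ) (hψ : IsTestFunction D ψ) :
    relaxedEnergy b (fun x => 1 / 2 * φ x + 1 / 2 * ψ x)
      + 1 / 8 * ∫ x, ‖gradient φ x - gradient ψ x‖ ^ 2
      ≤ (relaxedEnergy b φ + relaxedEnergy b ψ) / 2 := by
  have hm := hφ.add_smul hψ (1 / 2) (1 / 2)
  have i1 := integrable_norm_sq hφ.memLp_gradient
  have i2 := integrable_norm_sq hψ.memLp_gradient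
  have i3 : Integrable fun x => ‖gradient φ x - gradient ψ x‖ ^ 2 :=
    integrable_norm_sq (hφ.memLp_gradient.sub hψ.memLp_gradient)
  have e1 : ∫ x, ‖gradient (fun x => 1 / 2 * φ x + 1 / 2 * ψ x) x‖ ^ 2 =
      1 / 2 * (∫ x, ‖gradient φ x‖ ^ 2) + 1 / 2 * (∫ x, ‖gradient ψ x‖ ^ 2)
        - 1 / 4 * ∫ x, ‖gradient φ x - gradient ψ x‖ ^ 2 := by
    rw [← integral_const_mul, ← integral_const_mul, ← integral_const_mul, ← integral_add,
      ← integral_sub]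
    · refine integral_congr_ae (.of_forall fun x => ?_)
      simp only [hφ.gradient_add_smul hψ, ← smul_add, norm_smul, mul_pow]
      have := parallelogram_law_with_norm ℝ (gradient φ x) (gradient ψ x)
      norm_num
      nlinarith
    · exact (i1.const_mul _).add (i2.const_mul _)
    · exact i3.const_mul _
    · exact i1.const_mul _
    · exact i2.const_mul _
  have e2 : ∫ x, max (1 / 2 * φ x + 1 / 2 * ψ x) 0 ≤
      1 / 2 * (∫ x, max (φ x) 0) + 1 / 2 * ∫ x, max (ψ x) 0 := by
    rw [← integral_const_mul, ← integral_const_mul, ← integral_add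
      (hφ.integrable_max.const_mul _) (hψ.integrable_max.const_mul _)]
    refine integral_mono hm.integrable_max ((hφ.integrable_max.const_mul _).add
      (hψ.integrable_max.const_mul _)) fun x => ?_
    refine max_le ?_ ?_
    · exact add_le_add (by gcongr; exact le_max_left _ _) (by gcongr; exact le_max_left _ _)
    · have := le_max_right (φ x) 0
      have := le_max_right (ψ x) 0
      positivity
  have e3 : ∫ x, b x * (1 / 2 * φ x + 1 / 2 * ψ x) =
      1 / 2 * (∫ x, b x * φ x) + 1 / 2 * ∫ x, b x * ψ x := by
    rw [← integral_const_mul, ← integral_const_mul, ← integral_add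
      ((integrable_mul_of_memLp hb hφ.memLp).const_mul _)
      ((integrable_mul_of_memLp hb hψ.memLp).const_mul _)]
    exact integral_congr_ae (.of_forall fun x => by ring)
  unfold relaxedEnergy
  rw [e1, e3]
  linarith

lemma exists_le_relaxedEnergy (hD : Bornology.IsBounded D) (hb : MemLp b 2 volume) :
    ∃ m : ℝ, ∀ φ, IsTestFunction D φ → m ≤ relaxedEnergy b φ := by
  obtain ⟨C, hC, hP⟩ := exists_poincare hD
  set B := ∫ x, ‖b x‖ ^ 2
  have hB : 0 ≤ B := integral_nonneg fun x => by positivity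
  refine ⟨-(B * C / 2), fun φ hφ => ?_⟩
  set A := ∫ x, ‖gradient φ x‖ ^ 2
  have hA : 0 ≤ A := integral_nonneg fun x => by positivity
  have h1 := abs_integral_inner_le hφ.memLp hb
  have h2 : ∫ x, ‖φ x‖ ^ 2 ≤ C * A := by simpa using hP φ hφ
  have h3 : |∫ x, b x * φ x| ≤ √(C * A) * √B := by
    refine le_trans ?_ (h1.trans (mul_le_mul_of_nonneg_right (Real.sqrt_le_sqrt h2)
      (Real.sqrt_nonneg _)))
    simp
  have h4 : 0 ≤ ∫ x, max (φ x) 0 := integral_nonneg fun x => le_max_right _ _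
  have h5 := (le_abs_self _).trans h3
  rw [Real.sqrt_mul hC.le] at h5
  unfold relaxedEnergy
  have a := Real.sq_sqrt hA
  have c := Real.sq_sqrt hC.le
  have d := Real.sq_sqrt hB
  have : B * C = (√B * √C) ^ 2 := by rw [mul_pow, c, d]
  nlinarith [sq_nonneg (√A - √B * √C)]

lemma relaxedEnergy_comp {φ : Plane → ℝ} (ρ : Plane ≃ₗᵢ[ℝ] Plane) (hb : ∀ x, b (ρ x) = b x) :
    relaxedEnergy b (fun x => φ (ρ x)) = relaxedEnergy b φ := by
  have key : ∀ f : Plane → ℝ, ∫ x, f (ρ x) = ∫ x, f x := fun f =>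
    ρ.measurePreserving.integral_comp ρ.toHomeomorph.measurableEmbedding f
  unfold relaxedEnergy
  simp only [norm_gradient_comp_isometry]
  rw [key fun x => ‖gradient φ x‖ ^ 2, key fun x => max (φ x) 0, ← key fun x => b x * φ x]
  simp only [hb]

lemma relaxedEnergy_add_smul {φ ψ : Plane → ℝ} (hb : MemLp b 2 volume)
    (hφ : IsTestFunction D φ) (hψ : IsTestFunction D ψ) (t : ℝ) :
    relaxedEnergy b (fun x => 1 * φ x + t * ψ x) = relaxedEnergy b φ
      + (t * (∫ x, inner ℝ (gradient φ x) (gradient ψ x))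
        + 1 / 2 * t ^ 2 * (∫ x, ‖gradient ψ x‖ ^ 2)
        + (∫ x, (max (φ x + t * ψ x) 0 - max (φ x) 0)) - t * ∫ x, b x * ψ x) := by
  have i1 := integrable_norm_sq hφ.memLp_gradient
  have i2 := integrable_norm_sq hψ.memLp_gradient
  have i3 := integrable_inner_of_memLp hφ.memLp_gradient hψ.memLp_gradient
  have e1 : ∫ x, ‖gradient (fun x => 1 * φ x + t * ψ x) x‖ ^ 2 =
      (∫ x, ‖gradient φ x‖ ^ 2) + 2 * t * (∫ x, inner ℝ (gradient φ x) (gradient ψ x))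
        + t ^ 2 * ∫ x, ‖gradient ψ x‖ ^ 2 := by
    rw [← integral_const_mul, ← integral_const_mul, ← integral_add, ← integral_add]
    · refine integral_congr_ae (.of_forall fun x => ?_)
      simp only [hφ.gradient_add_smul hψ, one_smul]
      rw [norm_add_sq_real, norm_smul, mul_pow, inner_smul_right, Real.norm_eq_abs, sq_abs]
      ring
    · exact i1.add (i3.const_mul _)
    · exact i2.const_mul _
    · exact i1
    · exact i3.const_mul _
  have e2 : ∫ x, max (1 * φ x + t * ψ x) 0 = (∫ x, max (φ x) 0) +
      ∫ x, (max (φ x + t * ψ x) 0 - max (φ x) 0) := by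
    have := (hφ.add_smul hψ 1 t).integrable_max
    simp only [one_mul] at this ⊢
    rw [integral_sub this hφ.integrable_max]
    ring
  have e3 : ∫ x, b x * (1 * φ x + t * ψ x) = (∫ x, b x * φ x) + t * ∫ x, b x * ψ x := by
    rw [← integral_const_mul, ← integral_add (integrable_mul_of_memLp hb hφ.memLp)
      ((integrable_mul_of_memLp hb hψ.memLp).const_mul _)]
    exact integral_congr_ae (.of_forall fun x => by ring)
  unfold relaxedEnergy
  rw [e1, e2, e3]
  ring

lemma tendsto_integral_max_sub {φ : ℕ → Plane → ℝ} {u ψ : Plane → ℝ}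
    (hφ : ∀ n, IsTestFunction D (φ n)) (hu : MemLp u 2 volume) (h : L2Tendsto φ u)
    (hψ : IsTestFunction D ψ) (t : ℝ) :
    Tendsto (fun n => ∫ x, (max (φ n x + t * ψ x) 0 - max (φ n x) 0)) atTop
      (𝓝 (∫ x, (max (u x + t * ψ x) 0 - max (u x) 0))) := by
  set K := tsupport ψ
  have hK : MeasurableSet K := (isClosed_tsupport ψ).measurableSet
  have hKfin : volume K ≠ ⊤ := hψ.2.1.measure_lt_top.ne
  have hind : MemLp (K.indicator fun _ => (1 : ℝ)) 2 volume := by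
    exact memLp_indicator_const 2 hK 1 (Or.inr hKfin)
  have hmem : ∀ {v : Plane → ℝ}, MemLp v 2 volume →
      MemLp (fun x => max (v x + t * ψ x) 0 - max (v x) 0) 2 volume := by
    intro v hv
    refine MemLp.of_le (hψ.memLp.const_mul t) ?_ (.of_forall fun x => ?_)
    · exact ((hv.1.add (hψ.memLp.const_mul t).1).sup aestronglyMeasurable_const).sub
        (hv.1.sup aestronglyMeasurable_const)
    · rw [Real.norm_eq_abs, Real.norm_eq_abs]
      have := abs_max_sub_max_le_abs (v x + t * ψ x) (v x) 0
      rwa [add_sub_cancel_left] at this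
  have hzero : ∀ (v : Plane → ℝ) x, (max (v x + t * ψ x) 0 - max (v x) 0) =
      (max (v x + t * ψ x) 0 - max (v x) 0) * K.indicator (fun _ => (1 : ℝ)) x := by
    intro v x
    by_cases hx : x ∈ K
    · simp [hx]
    · simp [image_eq_zero_of_notMem_tsupport hx]
  have hlim : L2Tendsto (fun n x => max (φ n x + t * ψ x) 0 - max (φ n x) 0)
      (fun x => max (u x + t * ψ x) 0 - max (u x) 0) := by
    refine h.of_le 2 fun n => .of_forall fun x => ?_
    have h1 := abs_max_sub_max_le_abs (φ n x + t * ψ x) (u x + t * ψ x) 0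
    have h2 := abs_max_sub_max_le_abs (φ n x) (u x) 0
    rw [Real.norm_eq_abs, Real.norm_eq_abs]
    rw [add_sub_add_right_eq_sub] at h1
    rw [abs_le] at *
    constructor <;> linarith [h1.1, h1.2, h2.1, h2.2]
  have := hlim.integral_mul (fun n => hmem (hφ n).memLp) (hmem hu) (fun _ => hind) hind
    (l2Tendsto_const _)
  simpa only [← hzero] using this

/-- The one-sided derivative of `φ ↦ φ⁺`. -/
noncomputable def posDeriv (s p : ℝ) : ℝ := if 0 < s then p else if s = 0 then max p 0 else 0

lemma tendsto_posDeriv (s p : ℝ) :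
    Tendsto (fun n : ℕ => ((n : ℝ) + 1) * (max (s + 1 / ((n : ℝ) + 1) * p) 0 - max s 0)) atTop
      (𝓝 (posDeriv s p)) := by
  have hlim : Tendsto (fun n : ℕ => s + 1 / ((n : ℝ) + 1) * p) atTop (𝓝 s) := by
    simpa using (tendsto_one_div_add_atTop_nhds_zero_nat (𝕜 := ℝ)).mul_const p |>.const_add s
  have hn : ∀ n : ℕ, (0 : ℝ) < (n : ℝ) + 1 := fun n => by positivity
  unfold posDeriv
  split_ifs with h1 h2
  · refine tendsto_const_nhds.congr' ?_
    filter_upwards [hlim.eventually (lt_mem_nhds h1)] with n h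
    rw [max_eq_left h.le, max_eq_left h1.le]
    field_simp [(hn n).ne']
    ring
  · refine tendsto_const_nhds.congr fun n => ?_
    rw [h2, max_self, sub_zero, zero_add]
    conv_rhs => rw [← abs_of_pos (hn n)]
    rw [abs_of_pos (hn n), mul_max_of_nonneg _ _ (hn n).le, mul_zero]
    field_simp [(hn n).ne']
  · have h3 : s < 0 := lt_of_le_of_ne (not_lt.1 h1) h2
    refine tendsto_const_nhds.congr' ?_
    filter_upwards [hlim.eventually (gt_mem_nhds h3)] with n h
    rw [max_eq_right h.le, max_eq_right h3.le]
    simp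

/-- Existence of minimizers of the relaxed energy over `W₀^{1,2}` of a bounded set, with the
Euler-Lagrange inequalities. -/
theorem exists_relaxed_minimizer (hD : Bornology.IsBounded D) (hb : MemLp b 2 volume)
    (ρ : Plane ≃ₗᵢ[ℝ] Plane) (hρ : ∀ x, ρ (ρ x) = x) (hρD : ∀ x, ρ x ∈ D → x ∈ D)
    (hbρ : ∀ x, b (ρ x) = b x) :
    ∃ (u : Plane → ℝ) (g : Plane → Plane), StronglyMeasurable u ∧ MemW012 D u g ∧
      (∀ᵐ x, u (ρ x) = u x) ∧ ∀ ψ, IsTestFunction D ψ →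
        0 ≤ (∫ x, inner ℝ (g x) (gradient ψ x)) + (∫ x, posDeriv (u x) (ψ x))
          - ∫ x, b x * ψ x := by
  obtain ⟨m0, hm0⟩ := exists_le_relaxedEnergy hD hb
  set S : Set ℝ := relaxedEnergy b '' {φ | IsTestFunction D φ}
  have hSne : S.Nonempty := ⟨_, fun _ => 0, ⟨contDiff_const, HasCompactSupport.zero, by
    simp [tsupport, Function.support_fun_zero]⟩, rfl⟩
  have hSb : BddBelow S := ⟨m0, by rintro _ ⟨φ, hφ, rfl⟩; exact hm0 φ hφ⟩
  set m := sInf S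
  have hm : ∀ φ, IsTestFunction D φ → m ≤ relaxedEnergy b φ := fun φ hφ =>
    csInf_le hSb ⟨φ, hφ, rfl⟩
  have hex : ∀ n : ℕ, ∃ φ, IsTestFunction D φ ∧ (∀ x, φ (ρ x) = φ x) ∧
      relaxedEnergy b φ ≤ m + 1 / ((n : ℝ) + 1) := by
    intro n
    obtain ⟨_, ⟨φ, hφ, rfl⟩, hlt⟩ := exists_lt_of_csInf_lt hSne
      (show sInf S < m + 1 / ((n : ℝ) + 1) from lt_add_of_pos_right _ (by positivity))
    have hφρ : IsTestFunction D fun x => φ (ρ x) := hφ.comp_isometry ρ hρD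
    refine ⟨_, hφ.add_smul hφρ (1 / 2) (1 / 2), fun x => ?_, ?_⟩
    · simp only [hρ]
      ring
    · have h1 := relaxedEnergy_midpoint hb hφ hφρ
      rw [relaxedEnergy_comp ρ hbρ] at h1
      have h2 : 0 ≤ ∫ x, ‖gradient φ x - gradient (fun x => φ (ρ x)) x‖ ^ 2 :=
        integral_nonneg fun x => by positivity
      linarith
  choose φ hφ hφρ hφm using hex
  obtain ⟨C, hC, hP⟩ := exists_poincare hD
  have hgrad : ∀ N n k : ℕ, N ≤ n → N ≤ k →
      ∫ x, ‖gradient (φ n) x - gradient (φ k) x‖ ^ 2 ≤ 8 / ((N : ℝ) + 1) := by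
    intro N n k hn hk
    have h1 := relaxedEnergy_midpoint hb (hφ n) (hφ k)
    have h2 := hm _ ((hφ n).add_smul (hφ k) (1 / 2) (1 / 2))
    have h3 : 1 / ((n : ℝ) + 1) ≤ 1 / ((N : ℝ) + 1) := by gcongr
    have h4 : 1 / ((k : ℝ) + 1) ≤ 1 / ((N : ℝ) + 1) := by gcongr
    have h5 := hφm n
    have h6 := hφm k
    have : 8 / ((N : ℝ) + 1) = 8 * (1 / ((N : ℝ) + 1)) := by ring
    rw [this]
    linarith
  have hval : ∀ N n k : ℕ, N ≤ n → N ≤ k →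
      ∫ x, ‖φ n x - φ k x‖ ^ 2 ≤ C * 8 / ((N : ℝ) + 1) := by
    intro N n k hn hk
    have h1 := hP _ ((hφ n).add_smul (hφ k) 1 (-1))
    simp only [(hφ n).gradient_add_smul (hφ k)] at h1
    simp only [one_smul, neg_smul, one_mul, neg_mul, ← sub_eq_add_neg] at h1
    simp only [Real.norm_eq_abs, sq_abs]
    refine h1.trans ?_
    rw [mul_div_assoc]
    exact mul_le_mul_of_nonneg_left (hgrad N n k hn hk) hC.le
  obtain ⟨g, -, hg, hgl⟩ := exists_l2Tendsto (fun n => (hφ n).memLp_gradient) _ hgrad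
  obtain ⟨u, hum, hu, hul⟩ := exists_l2Tendsto (fun n => (hφ n).memLp) _ hval
  refine ⟨u, g, hum, ⟨hu, hg, φ, hφ, hul, hgl⟩, ?_, fun ψ hψ => ?_⟩
  · have h1 := hul.comp_isometry (fun n => (hφ n).memLp) hu ρ
    simp only [hφρ] at h1
    exact h1.ae_eq (fun n => (hφ n).memLp)
      (hu.comp_measurePreserving ρ.measurePreserving) hu hul
  have hineq : ∀ t : ℝ, 0 ≤ t * (∫ x, inner ℝ (g x) (gradient ψ x))
        + 1 / 2 * t ^ 2 * (∫ x, ‖gradient ψ x‖ ^ 2)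
        + (∫ x, (max (u x + t * ψ x) 0 - max (u x) 0)) - t * ∫ x, b x * ψ x := by
    intro t
    have l1 := (hgl.integral_inner (fun n => (hφ n).memLp_gradient) hg
      (fun _ => hψ.memLp_gradient) hψ.memLp_gradient (l2Tendsto_const _)).const_mul t
    have l2 := tendsto_integral_max_sub hφ hu hul hψ t
    have l3 := ((l1.add_const (1 / 2 * t ^ 2 * (∫ x, ‖gradient ψ x‖ ^ 2))).add l2).sub_const
      (t * ∫ x, b x * ψ x)
    have l4 : Tendsto (fun n : ℕ => -(1 / ((n : ℝ) + 1))) atTop (𝓝 0) := by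
      simpa using (tendsto_one_div_add_atTop_nhds_zero_nat (𝕜 := ℝ)).neg
    refine le_of_tendsto_of_tendsto' l4 l3 fun n => ?_
    have h1 := hm _ ((hφ n).add_smul hψ 1 t)
    rw [relaxedEnergy_add_smul hb (hφ n) hψ] at h1
    have h2 := hφm n
    linarith
  set I := ∫ x, inner ℝ (g x) (gradient ψ x)
  set A := ∫ x, ‖gradient ψ x‖ ^ 2
  set Bψ := ∫ x, b x * ψ x
  have l1 : Tendsto (fun n : ℕ => ∫ x, ((n : ℝ) + 1) *
      (max (u x + 1 / ((n : ℝ) + 1) * ψ x) 0 - max (u x) 0)) atTop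
      (𝓝 (∫ x, posDeriv (u x) (ψ x))) := by
    refine tendsto_integral_of_dominated_convergence (fun x => ‖ψ x‖) (fun n => ?_)
      hψ.integrable.norm (fun n => .of_forall fun x => ?_)
      (.of_forall fun x => tendsto_posDeriv (u x) (ψ x))
    · exact (((hu.1.add (hψ.memLp.const_mul _).1).sup aestronglyMeasurable_const).sub
        (hu.1.sup aestronglyMeasurable_const)).const_mul _
    · have hn : (0 : ℝ) < (n : ℝ) + 1 := by positivity
      have h1 := abs_max_sub_max_le_abs (u x + 1 / ((n : ℝ) + 1) * ψ x) (u x) 0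
      rw [add_sub_cancel_left, abs_mul, abs_of_pos (by positivity : 0 < 1 / ((n : ℝ) + 1))] at h1
      rw [Real.norm_eq_abs, Real.norm_eq_abs, abs_mul, abs_of_pos hn]
      calc _ ≤ ((n : ℝ) + 1) * (1 / ((n : ℝ) + 1) * |ψ x|) := by gcongr
        _ = |ψ x| := by field_simp
  have l2 : Tendsto (fun n : ℕ => 1 / 2 * (1 / ((n : ℝ) + 1)) * A) atTop (𝓝 0) := by
    have := ((tendsto_one_div_add_atTop_nhds_zero_nat (𝕜 := ℝ)).const_mul (1 / 2)).mul_const A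
    rwa [mul_zero, zero_mul] at this
  have l3 := ((l2.const_add I).add l1).sub_const Bψ
  rw [add_zero] at l3
  refine ge_of_tendsto' l3 fun n => ?_
  have hn : (0 : ℝ) < (n : ℝ) + 1 := by positivity
  have h1 := mul_nonneg hn.le (hineq (1 / ((n : ℝ) + 1)))
  rw [integral_const_mul]
  refine h1.trans_eq ?_
  field_simp

end Existence

/-! ### The weak comparison principle -/

lemma contDiff_deriv_smoothTransition : ContDiff ℝ ∞ (deriv Real.smoothTransition) :=
  ((contDiff_infty_iff_deriv).1 Real.smoothTransition.contDiff).2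

lemma hasCompactSupport_deriv_smoothTransition :
    HasCompactSupport (deriv Real.smoothTransition) := by
  refine HasCompactSupport.intro (isCompact_Icc (a := (0 : ℝ)) (b := 1)) fun t ht => ?_
  rw [Set.mem_Icc, not_and_or, not_le, not_le] at ht
  have : ∃ c, Real.smoothTransition =ᶠ[𝓝 t] fun _ => c := by
    rcases ht with ht | ht
    · exact ⟨0, by filter_upwards [gt_mem_nhds ht] with s hs using
        Real.smoothTransition.zero_of_nonpos hs.le⟩
    · exact ⟨1, by filter_upwards [lt_mem_nhds ht] with s hs using
        Real.smoothTransition.one_of_one_le hs.le⟩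
  obtain ⟨c, hc⟩ := this
  rw [hc.deriv_eq, deriv_const]

lemma exists_smoothTransition_bound : ∃ K : ℝ, 1 ≤ K ∧
    (∀ t, |deriv Real.smoothTransition t| ≤ K) ∧
      ∀ t, |deriv (deriv Real.smoothTransition) t| ≤ K := by
  have h1 := hasCompactSupport_deriv_smoothTransition
  obtain ⟨K1, hK1⟩ := h1.exists_bound_of_continuous contDiff_deriv_smoothTransition.continuous
  obtain ⟨K2, hK2⟩ := h1.deriv.exists_bound_of_continuous
    (contDiff_deriv_smoothTransition.continuous_deriv (by simp))
  exact ⟨max 1 (max K1 K2), le_max_left _ _,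
    fun t => (hK1 t).trans ((le_max_left _ _).trans (le_max_right _ _)),
    fun t => (hK2 t).trans ((le_max_right _ _).trans (le_max_right _ _))⟩

lemma deriv_smoothTransition_nonneg (t : ℝ) : 0 ≤ deriv Real.smoothTransition t :=
  Real.smoothTransition.monotone.deriv_nonneg

lemma abs_smoothTransition_sub_le {K : ℝ} (hK : ∀ t, |deriv Real.smoothTransition t| ≤ K)
    (s t : ℝ) : |Real.smoothTransition s - Real.smoothTransition t| ≤ K * |s - t| :=
  Convex.norm_image_sub_le_of_norm_deriv_le (f := Real.smoothTransition) (s := Set.univ)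
    (fun x _ => (Real.smoothTransition.contDiffAt (n := 1)).differentiableAt (by simp))
    (fun x _ => hK x) convex_univ (Set.mem_univ _) (Set.mem_univ _)

/-- A smooth truncation of a function which is nonpositive on the boundary of `D`. -/
noncomputable def truncation (D : Set Plane) (w : Plane → ℝ) (ε : ℝ) : Plane → ℝ :=
  D.indicator fun x => Real.smoothTransition (w x - ε)

section Truncation

variable {D : Set Plane} {w : Plane → ℝ} {ε : ℝ}

lemma truncation_nonneg (x : Plane) : 0 ≤ truncation D w ε x :=
  Set.indicator_nonneg (fun _ _ => Real.smoothTransition.nonneg _) x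

lemma support_truncation_subset :
    Function.support (truncation D w ε) ⊆ closure D ∩ {x | ε ≤ w x} := by
  intro x hx
  have hxD : x ∈ D := by
    by_contra h
    exact hx (Set.indicator_of_notMem h _)
  refine ⟨subset_closure hxD, ?_⟩
  by_contra h
  apply hx
  rw [truncation, Set.indicator_of_mem hxD]
  exact Real.smoothTransition.zero_of_nonpos (by simp only [Set.mem_ofPred_eq, not_le] at h; linarith)

lemma isTestFunction_truncation (hDo : IsOpen D) (hDb : Bornology.IsBounded D)
    (hw : ContDiff ℝ ∞ w) (hfr : ∀ x ∈ frontier D, w x ≤ 0) (hε : 0 < ε) :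
    IsTestFunction D (truncation D w ε) := by
  have hKc : IsClosed (closure D ∩ {x | ε ≤ w x}) :=
    isClosed_closure.inter (isClosed_le continuous_const hw.continuous)
  have hK : IsCompact (closure D ∩ {x | ε ≤ w x}) :=
    hDb.isCompact_closure.inter_right (isClosed_le continuous_const hw.continuous)
  have hKD : closure D ∩ {x | ε ≤ w x} ⊆ D := by
    rintro x ⟨h1, h2⟩
    by_contra h
    have := hfr x ⟨h1, by rwa [hDo.interior_eq]⟩
    simp only [Set.mem_ofPred_eq] at h2
    linarith
  have hts : tsupport (truncation D w ε) ⊆ closure D ∩ {x | ε ≤ w x} :=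
    closure_minimal support_truncation_subset hKc
  refine ⟨?_, hK.of_isClosed_subset isClosed_closure hts, hts.trans hKD⟩
  rw [contDiff_iff_contDiffAt]
  intro x
  by_cases hx : x ∈ D
  · have : truncation D w ε =ᶠ[𝓝 x] fun x => Real.smoothTransition (w x - ε) := by
      filter_upwards [hDo.mem_nhds hx] with y hy using Set.indicator_of_mem hy _
    refine ContDiffAt.congr_of_eventuallyEq ?_ this
    exact (Real.smoothTransition.contDiff.comp (hw.sub contDiff_const)).contDiffAt
  · have : truncation D w ε =ᶠ[𝓝 x] fun _ => 0 :=
      notMem_tsupport_iff_eventuallyEq.1 fun h => hx (hKD (hts h))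
    exact contDiffAt_const.congr_of_eventuallyEq this

lemma gradient_truncation (hDo : IsOpen D) (hw : ContDiff ℝ ∞ w) {x : Plane} (hx : x ∈ D) :
    gradient (truncation D w ε) x = deriv Real.smoothTransition (w x - ε) • gradient w x := by
  have : truncation D w ε =ᶠ[𝓝 x] fun x => Real.smoothTransition (w x - ε) := by
    filter_upwards [hDo.mem_nhds hx] with y hy using Set.indicator_of_mem hy _
  ext i
  have hd : DifferentiableAt ℝ w x := hw.differentiable (by simp) x
  rw [gradient_apply, pd_congr this, pd_comp (f := fun x => w x - ε)
    ((Real.smoothTransition.contDiffAt (n := 1)).differentiableAt (by simp)) (hd.sub_const ε),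
    pd_sub_const]
  simp [gradient_apply]

end Truncation

/-- **Weak comparison principle.** -/
theorem MemW012.le_of_laplacian_le {D : Set Plane} {u a V : Plane → ℝ} {g : Plane → Plane}
    (hu : MemW012 D u g) (hDo : IsOpen D) (hDb : Bornology.IsBounded D)
    (hV : ContDiff ℝ ∞ V) (hVD : ∀ x ∈ frontier D, 0 ≤ V x)
    (ham : AEStronglyMeasurable a volume) {M : ℝ} (haM : ∀ x, |a x| ≤ M)
    (hEL : ∀ ψ, IsTestFunction D ψ → (∀ x, 0 ≤ ψ x) →
      ∫ x, inner ℝ (g x) (gradient ψ x) ≤ ∫ x, a x * ψ x)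
    (ha : ∀ᵐ x, x ∈ D → V x < u x → a x ≤ -Laplacian.laplacian V x) :
    ∀ᵐ x, x ∈ D → u x ≤ V x := by
  obtain ⟨huL, hgL, φ, hφ, hφu, hφg⟩ := hu
  obtain ⟨K, hK1, hK, -⟩ := exists_smoothTransition_bound
  have hK0 : 0 < K := by linarith
  obtain ⟨C, hC, hP⟩ := exists_poincare hDb
  have hV2 : ContDiff ℝ 2 V := hV.of_le two_le_infty
  have hDm : MeasurableSet D := hDo.measurableSet
  have hDfin : volume D ≠ ⊤ := hDb.measure_lt_top.ne
  have main : ∀ ε : ℝ, 0 < ε → ∀ᵐ x, x ∈ D → u x ≤ V x + ε := by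
    intro ε hε
    have hw : ∀ n, ContDiff ℝ ∞ fun x => φ n x - V x := fun n => (hφ n).1.sub hV
    set ψ : ℕ → Plane → ℝ := fun n => truncation D (fun x => φ n x - V x) ε with hψdef
    set ψ' : Plane → ℝ := truncation D (fun x => u x - V x) ε with hψ'def
    have hψ : ∀ n, IsTestFunction D (ψ n) := fun n =>
      isTestFunction_truncation hDo hDb (hw n) (fun x hx => by
        have : x ∉ D := by
          have := hx.2
          rwa [hDo.interior_eq] at this
        rw [(hφ n).eq_zero this]
        linarith [hVD x hx]) hε
    have hbd : ∀ v : Plane → ℝ, AEStronglyMeasurable v volume → ∀ B : ℝ, (∀ x ∈ D, |v x| ≤ B) →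
        MemLp (D.indicator v) 2 volume := by
      intro v hv B hB
      refine MemLp.of_le (memLp_indicator_const 2 hDm B (Or.inr hDfin))
        (hv.indicator hDm) (.of_forall fun x => ?_)
      by_cases hx : x ∈ D
      · simp only [hx, Set.indicator_of_mem, Real.norm_eq_abs]
        exact (hB x hx).trans (le_abs_self _)
      · simp [hx]
    have hψ'L : MemLp ψ' 2 volume := by
      refine hbd _ ?_ 1 fun x _ => ?_
      · exact Real.smoothTransition.continuous.comp_aestronglyMeasurable
          ((huL.1.sub hV.continuous.aestronglyMeasurable).sub aestronglyMeasurable_const)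
      · rw [abs_of_nonneg (Real.smoothTransition.nonneg _)]
        exact Real.smoothTransition.le_one _
    have hψψ' : L2Tendsto ψ ψ' := by
      refine L2Tendsto.of_le hφu K fun n => .of_forall fun x => ?_
      by_cases hx : x ∈ D
      · simp only [hψdef, hψ'def, truncation, hx, Set.indicator_of_mem, Real.norm_eq_abs]
        refine (abs_smoothTransition_sub_le hK _ _).trans_eq ?_
        congr 2
        ring
      · simp only [hψdef, hψ'def, truncation, hx, Set.indicator_of_notMem, not_false_eq_true,
          sub_zero, norm_zero]
        positivity
    obtain ⟨B, hB⟩ := hDb.isCompact_closure.exists_bound_of_continuousOn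
      (continuous_laplacian hV2).continuousOn
    set c : Plane → ℝ := D.indicator fun x => a x + Laplacian.laplacian V x
    have hc : MemLp c 2 volume := by
      refine hbd _ (ham.add (continuous_laplacian hV2).aestronglyMeasurable) (M + B) fun x hx => ?_
      exact (abs_add_le _ _).trans (add_le_add (haM x) (hB x (subset_closure hx)))
    have hβ := hψψ'.integral_mul (fun n => (hψ n).memLp) hψ'L (fun _ => hc) hc (l2Tendsto_const c)
    have hβle : ∫ x, ψ' x * c x ≤ 0 := by
      refine integral_nonpos_of_ae ?_
      filter_upwards [ha] with x hx
      by_cases hxD : x ∈ D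
      · by_cases hxu : V x < u x
        · refine mul_nonpos_of_nonneg_of_nonpos (truncation_nonneg x) ?_
          have := hx hxD hxu
          simp only [c, hxD, Set.indicator_of_mem]
          linarith
        · have : ψ' x = 0 := by
            simp only [hψ'def, truncation, hxD, Set.indicator_of_mem]
            exact Real.smoothTransition.zero_of_nonpos (by linarith)
          simp [this]
      · simp [c, hxD]
    have hα := L2Tendsto.integral_norm_sub_sq (fun n => (hφ n).memLp_gradient) hgL hφg
    have hA : ∀ n, ∫ x, ‖gradient (ψ n) x‖ ^ 2 ≤
        K ^ 2 * (∫ x, ‖gradient (φ n) x - g x‖ ^ 2) + 2 * K * ∫ x, ψ n x * c x := by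
      intro n
      set A := ∫ x, ‖gradient (ψ n) x‖ ^ 2
      set α := ∫ x, ‖gradient (φ n) x - g x‖ ^ 2
      have hA0 : 0 ≤ A := integral_nonneg fun x => by positivity
      have hα0 : 0 ≤ α := integral_nonneg fun x => by positivity
      have hgd : MemLp (fun x => gradient (φ n) x - g x) 2 volume := (hφ n).memLp_gradient.sub hgL
      have i1 := integrable_inner_of_memLp hgd (hψ n).memLp_gradient
      have i2 := integrable_inner_of_memLp hgL (hψ n).memLp_gradient
      have i3 : Integrable fun x => inner ℝ (gradient V x) (gradient (ψ n) x) :=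
        ((continuous_gradient (hV2.of_le (by simp))).inner
          (continuous_gradient (hψ n).contDiff_one)).integrable_of_hasCompactSupport
          ((hasCompactSupport_gradient (hψ n).2.1).mono' fun x hx => by
            refine subset_tsupport _ fun h => hx ?_
            simp [h])
      have s1 := hEL _ (hψ n) fun x => truncation_nonneg x
      have s2 := integral_mul_laplacian (hψ n).contDiff_one hV2 (Or.inl (hψ n).2.1)
      simp only [real_inner_comm (gradient V _)] at s2
      have s3 : A ≤ K * ((∫ x, inner ℝ (gradient (φ n) x - g x) (gradient (ψ n) x))
          + (∫ x, inner ℝ (g x) (gradient (ψ n) x))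
          - ∫ x, inner ℝ (gradient V x) (gradient (ψ n) x)) := by
        have i4 : Integrable fun x => inner ℝ (gradient (φ n) x - g x) (gradient (ψ n) x)
            + inner ℝ (g x) (gradient (ψ n) x) := i1.add i2
        rw [← integral_add i1 i2, ← integral_sub i4 i3, ← integral_const_mul]
        refine integral_mono (integrable_norm_sq (hψ n).memLp_gradient)
          ((i4.sub i3).const_mul K) fun x => ?_
        simp only
        rw [← inner_add_left, ← inner_sub_left, sub_add_cancel]
        by_cases hx : x ∈ D
        · have e1 : gradient (fun x => φ n x - V x) x = gradient (φ n) x - gradient V x := by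
            ext i
            rw [gradient_apply, pd_sub ((hφ n).differentiable x)
              (hV.differentiable (by simp) x)]
            simp [gradient_apply]
          have e2 : gradient (ψ n) x = _ := gradient_truncation hDo (hw n) hx
          rw [e2, e1, norm_smul, mul_pow, inner_smul_right, real_inner_self_eq_norm_sq,
            Real.norm_eq_abs, sq_abs, ← mul_assoc]
          refine mul_le_mul_of_nonneg_right ?_ (by positivity)
          rw [sq]
          exact mul_le_mul_of_nonneg_right ((le_abs_self _).trans (hK _))
            (deriv_smoothTransition_nonneg _)
        · have : gradient (ψ n) x = 0 := by
            by_contra h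
            exact hx ((hψ n).2.2 (tsupport_gradient_subset _ (subset_tsupport _ h)))
          simp [this]
      have s4 := (le_abs_self _).trans (abs_integral_inner_le hgd (hψ n).memLp_gradient)
      have s5 : ∫ x, ψ n x * c x = (∫ x, a x * ψ n x) +
          ∫ x, ψ n x * Laplacian.laplacian V x := by
        rw [← integral_add]
        · refine integral_congr_ae (.of_forall fun x => ?_)
          by_cases hx : x ∈ D
          · simp only [c, hx, Set.indicator_of_mem]
            ring
          · simp [(hψ n).eq_zero hx]
        · exact (hψ n).integrable.bdd_mul ham (.of_forall fun x => haM x)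
        · exact ((hψ n).continuous.mul (continuous_laplacian hV2)).integrable_of_hasCompactSupport
            (hψ n).2.1.mul_right
      have s6 : A ≤ K * (√α * √A + ∫ x, ψ n x * c x) := by
        refine s3.trans (mul_le_mul_of_nonneg_left ?_ hK0.le)
        linarith
      have q1 := Real.sq_sqrt hA0
      have q2 := Real.sq_sqrt hα0
      nlinarith [sq_nonneg (√A - K * √α)]
    have hlim : Tendsto (fun n => C * (K ^ 2 * (∫ x, ‖gradient (φ n) x - g x‖ ^ 2)
        + 2 * K * ∫ x, ψ n x * c x)) atTop (𝓝 (C * (K ^ 2 * 0 + 2 * K * ∫ x, ψ' x * c x))) :=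
      ((hα.const_mul _).add (hβ.const_mul _)).const_mul C
    have hsq := hψψ'.integral_mul (fun n => (hψ n).memLp) hψ'L (fun n => (hψ n).memLp) hψ'L hψψ'
    have hle : ∫ x, ψ' x * ψ' x ≤ 0 := by
      refine (le_of_tendsto_of_tendsto' hsq hlim fun n => ?_).trans ?_
      · simp only [← sq]
        exact (hP _ (hψ n)).trans (mul_le_mul_of_nonneg_left (hA n) hC.le)
      · rw [mul_zero, zero_add]
        have := mul_nonneg (mul_nonneg hC.le hK0.le) (neg_nonneg.2 hβle)
        nlinarith
    have hzero : (fun x => ψ' x * ψ' x) =ᵐ[volume] 0 := by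
      refine (integral_eq_zero_iff_of_nonneg (fun x => mul_self_nonneg _)
        (integrable_mul_of_memLp hψ'L hψ'L)).1 (le_antisymm hle ?_)
      exact integral_nonneg fun x => mul_self_nonneg _
    filter_upwards [hzero] with x hx hxD
    have h0 : ψ' x = 0 := mul_self_eq_zero.1 hx
    simp only [hψ'def, truncation, hxD, Set.indicator_of_mem,
      Real.smoothTransition.zero_iff_nonpos] at h0
    linarith
  have hall : ∀ᵐ x, ∀ n : ℕ, x ∈ D → u x ≤ V x + 1 / ((n : ℝ) + 1) :=
    ae_all_iff.2 fun n => main _ (by positivity)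
  filter_upwards [hall] with x hx hxD
  have := (tendsto_one_div_add_atTop_nhds_zero_nat (𝕜 := ℝ)).const_add (V x)
  rw [add_zero] at this
  exact ge_of_tendsto' this fun n => hx n hxD

/-! ### The geometry of the cones -/

/-- The inward unit normals to the two sides of `cone 0`. -/
noncomputable def normal : Fin 2 → Plane := ![!₂[0, 1], !₂[√3 / 2, 1 / 2]]

/-- The distances to the two lines bounding `cone 0`. -/
noncomputable def side (i : Fin 2) (x : Plane) : ℝ := inner ℝ (normal i) x

lemma side_zero (x : Plane) : side 0 x = x 1 := by
  simp [side, normal, inner_plane, Fin.sum_univ_two]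

lemma side_one (x : Plane) : side 1 x = (√3 * x 0 + x 1) / 2 := by
  simp [side, normal, inner_plane, Fin.sum_univ_two]
  ring

lemma sqrt_three_sq : √3 ^ 2 = (3 : ℝ) := Real.sq_sqrt (by norm_num)

lemma norm_normal (i : Fin 2) : ‖normal i‖ = 1 := by
  have h : ‖normal i‖ ^ 2 = 1 := by
    rw [← real_inner_self_eq_norm_sq, inner_plane, Fin.sum_univ_two]
    fin_cases i
    · simp [normal]
    · simp [normal]
      nlinarith [sqrt_three_sq]
  exact (pow_eq_one_iff_of_nonneg (norm_nonneg _) two_ne_zero).1 h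

lemma continuous_side (i : Fin 2) : Continuous (side i) :=
  continuous_const.inner continuous_id

lemma contDiff_side (i : Fin 2) {n : WithTop ℕ∞} : ContDiff ℝ n (side i) :=
  contDiff_const.inner ℝ contDiff_id

lemma abs_side_sub_le (i : Fin 2) (x y : Plane) : |side i x - side i y| ≤ dist x y := by
  rw [side, side, ← inner_sub_right, dist_eq_norm]
  simpa [norm_normal] using abs_real_inner_le_norm (normal i) (x - y)

lemma polarPoint_apply_zero (r t : ℝ) : polarPoint r t 0 = r * Real.cos t := by
  simp [polarPoint]

lemma polarPoint_apply_one (r t : ℝ) : polarPoint r t 1 = r * Real.sin t := by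
  simp [polarPoint]

lemma plane_ext {x y : Plane} (h0 : x 0 = y 0) (h1 : x 1 = y 1) : x = y := by
  ext i
  fin_cases i
  · exact h0
  · exact h1

lemma sqrt_three_cos_add_sin (t : ℝ) :
    √3 * Real.cos t + Real.sin t = 2 * Real.sin (t + Real.pi / 3) := by
  rw [Real.sin_add, Real.cos_pi_div_three, Real.sin_pi_div_three]
  ring

lemma mem_cone_zero {x : Plane} : x ∈ cone 0 ↔ ∀ i, 0 < side i x := by
  have hc : cone 0 = sector 0 (2 * Real.pi / 3) := by simp [cone]
  rw [hc, Fin.forall_fin_two, side_zero, side_one]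
  constructor
  · rintro ⟨r, t, hr, ht0, ht1, rfl⟩
    rw [polarPoint_apply_zero, polarPoint_apply_one]
    have h1 : 0 < Real.sin t := Real.sin_pos_of_pos_of_lt_pi ht0 (by linarith [Real.pi_pos])
    have h2 : 0 < Real.sin (t + Real.pi / 3) :=
      Real.sin_pos_of_pos_of_lt_pi (by linarith [Real.pi_pos]) (by linarith)
    refine ⟨mul_pos hr h1, ?_⟩
    have : √3 * (r * Real.cos t) + r * Real.sin t = r * (2 * Real.sin (t + Real.pi / 3)) := by
      rw [← sqrt_three_cos_add_sin]
      ring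
    rw [this]
    positivity
  · rintro ⟨h0, h1⟩
    set w : ℂ := ⟨x 0, x 1⟩ with hw
    have hw0 : w ≠ 0 := fun h => by
      have : w.im = 0 := by rw [h]; rfl
      exact h0.ne' this
    have hr : 0 < ‖w‖ := norm_pos_iff.2 hw0
    have hcos : ‖w‖ * Real.cos w.arg = x 0 := Complex.norm_mul_cos_arg w
    have hsin : ‖w‖ * Real.sin w.arg = x 1 := Complex.norm_mul_sin_arg w
    have hs : 0 < Real.sin w.arg := by
      rw [← hsin] at h0
      exact pos_of_mul_pos_right h0 hr.le
    have ha0 : 0 < w.arg := by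
      by_contra h
      exact absurd (Real.sin_nonpos_of_nonpos_of_neg_pi_le (not_lt.1 h) (Complex.neg_pi_lt_arg w).le)
        (not_le.2 hs)
    have h2 : 0 < Real.sin (w.arg + Real.pi / 3) := by
      have e : √3 * x 0 + x 1 = 2 * (‖w‖ * Real.sin (w.arg + Real.pi / 3)) := by
        rw [← hcos, ← hsin]
        have := sqrt_three_cos_add_sin w.arg
        linear_combination ‖w‖ * this
      have h3 : 0 < ‖w‖ * Real.sin (w.arg + Real.pi / 3) := by linarith
      exact pos_of_mul_pos_right h3 hr.le
    refine ⟨‖w‖, w.arg, hr, ha0, ?_, plane_ext ?_ ?_⟩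
    · by_contra h
      have h4 := Real.sin_nonneg_of_nonneg_of_le_pi (x := w.arg + Real.pi / 3 - Real.pi)
        (by linarith [not_lt.1 h]) (by linarith [Complex.arg_le_pi w])
      rw [Real.sin_sub_pi] at h4
      linarith
    · rw [polarPoint_apply_zero, hcos]
    · rw [polarPoint_apply_one, hsin]

lemma center_zero_apply : center 0 0 = 1 / 2 ∧ center 0 1 = √3 / 2 := by
  have : center 0 = polarPoint 1 (Real.pi / 3) := by simp [center]
  rw [this, polarPoint_apply_zero, polarPoint_apply_one, Real.cos_pi_div_three,
    Real.sin_pi_div_three]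
  simp

lemma norm_center_zero : ‖center 0‖ = 1 := by
  have h : ‖center 0‖ ^ 2 = 1 := by
    rw [← real_inner_self_eq_norm_sq, inner_plane, Fin.sum_univ_two, center_zero_apply.1,
      center_zero_apply.2]
    nlinarith [sqrt_three_sq]
  exact (pow_eq_one_iff_of_nonneg (norm_nonneg _) two_ne_zero).1 h

lemma side_center_zero (i : Fin 2) : side i (center 0) = √3 / 2 := by
  fin_cases i
  · exact (side_zero _).trans center_zero_apply.2
  · refine (side_one _).trans ?_
    rw [center_zero_apply.1, center_zero_apply.2]
    ring

/-- The coordinate along the axis of `cone 0`. -/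
noncomputable def axial (x : Plane) : ℝ := inner ℝ (center 0) x

lemma axial_eq (x : Plane) : √3 * axial x = side 0 x + side 1 x := by
  rw [side_zero, side_one, axial, inner_plane, Fin.sum_univ_two, center_zero_apply.1,
    center_zero_apply.2]
  linear_combination (x 1 / 2) * sqrt_three_sq

lemma continuous_axial : Continuous axial := continuous_const.inner continuous_id

lemma norm_sq_eq (x : Plane) :
    ‖x‖ ^ 2 = 4 / 3 * (side 0 x ^ 2 - side 0 x * side 1 x + side 1 x ^ 2) := by
  rw [← real_inner_self_eq_norm_sq, inner_plane, Fin.sum_univ_two, side_zero, side_one]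
  linear_combination (-(x 0) ^ 2 / 3) * sqrt_three_sq

lemma abs_axial_sub_le (x y : Plane) : |axial x - axial y| ≤ dist x y := by
  rw [axial, axial, ← inner_sub_right, dist_eq_norm]
  simpa [norm_center_zero] using abs_real_inner_le_norm (center 0) (x - y)

lemma norm_le_two_mul_axial {x : Plane} (hx : ∀ i, 0 ≤ side i x) : ‖x‖ ≤ 2 * axial x := by
  have h0 := hx 0
  have h1 := hx 1
  have ha := axial_eq x
  have h3 : 0 ≤ axial x := by
    have : 0 ≤ √3 * axial x := by rw [ha]; positivity
    exact nonneg_of_mul_nonneg_right this (by positivity)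
  refine abs_le_of_sq_le_sq' ?_ (by positivity) |>.2
  rw [norm_sq_eq]
  have : 3 * axial x ^ 2 = (side 0 x + side 1 x) ^ 2 := by
    rw [← ha, mul_pow, sqrt_three_sq]
  nlinarith [mul_nonneg h0 h1]

lemma isOpen_cone_zero : IsOpen (cone 0) := by
  have : cone 0 = ⋂ i, {x | 0 < side i x} := by
    ext x
    simp [mem_cone_zero]
  rw [this]
  exact isOpen_iInter_of_finite fun i => isOpen_lt continuous_const (continuous_side i)

lemma side_nonneg_of_mem_closure {x : Plane} (hx : x ∈ closure (cone 0)) (i : Fin 2) :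
    0 ≤ side i x := by
  have : closure (cone 0) ⊆ {x | 0 ≤ side i x} :=
    closure_minimal (fun y hy => (mem_cone_zero.1 hy i).le)
      (isClosed_le continuous_const (continuous_side i))
  exact this hx

lemma closedBall_center_subset : Metric.closedBall (center 0) (1 / 5) ⊆ cone 0 := by
  intro x hx
  rw [mem_cone_zero]
  intro i
  have h1 := (abs_le.1 (abs_side_sub_le i x (center 0))).1
  rw [side_center_zero] at h1
  rw [Metric.mem_closedBall] at hx
  have : (1 : ℝ) < √3 := by
    rw [show (1 : ℝ) = √1 by simp]
    exact Real.sqrt_lt_sqrt (by norm_num) (by norm_num)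
  linarith

lemma abs_axial_sub_one_le {x : Plane} : |axial x - 1| ≤ dist x (center 0) := by
  have h : axial (center 0) = 1 := by
    rw [axial, real_inner_self_eq_norm_sq, norm_center_zero, one_pow]
  rw [← h]
  exact abs_axial_sub_le _ _

/-- The reflection of the plane in the axis of `cone 0`. -/
noncomputable def axisReflection : Plane ≃ₗᵢ[ℝ] Plane :=
  (Submodule.span ℝ {polarPoint 1 (Real.pi / 3)}).reflection

lemma norm_polarPoint (t : ℝ) : ‖polarPoint 1 t‖ = 1 := by
  have h : ‖polarPoint 1 t‖ ^ 2 = 1 := by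
    rw [← real_inner_self_eq_norm_sq, inner_plane, Fin.sum_univ_two, polarPoint_apply_zero,
      polarPoint_apply_one]
    nlinarith [Real.sin_sq_add_cos_sq t]
  exact (pow_eq_one_iff_of_nonneg (norm_nonneg _) two_ne_zero).1 h

lemma rayReflection_eq (t : ℝ) (x : Plane) :
    rayReflection t x =
      (2 * (Real.cos t * x 0 + Real.sin t * x 1)) • polarPoint 1 t - x := by
  rw [rayReflection, Submodule.reflection_singleton_apply, norm_polarPoint]
  simp [inner_plane, Fin.sum_univ_two, polarPoint_apply_zero, polarPoint_apply_one,
    two_smul, two_mul, add_smul]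
  abel

lemma rayReflection_apply_zero (t : ℝ) (x : Plane) :
    rayReflection t x 0 = Real.cos (2 * t) * x 0 + Real.sin (2 * t) * x 1 := by
  rw [rayReflection_eq, Real.cos_two_mul, Real.sin_two_mul]
  simp [polarPoint_apply_zero]
  ring

lemma rayReflection_apply_one (t : ℝ) (x : Plane) :
    rayReflection t x 1 = Real.sin (2 * t) * x 0 - Real.cos (2 * t) * x 1 := by
  rw [rayReflection_eq, Real.cos_two_mul, Real.sin_two_mul]
  simp [polarPoint_apply_one]
  linear_combination (2 * x 1) * Real.sin_sq_add_cos_sq t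

lemma rayReflection_polarPoint (t r s : ℝ) :
    rayReflection t (polarPoint r s) = polarPoint r (2 * t - s) := by
  refine plane_ext ?_ ?_
  · rw [rayReflection_apply_zero, polarPoint_apply_zero, polarPoint_apply_zero,
      polarPoint_apply_one, Real.cos_sub]
    ring
  · rw [rayReflection_apply_one, polarPoint_apply_zero, polarPoint_apply_one,
      polarPoint_apply_one, Real.sin_sub]
    ring

lemma axisReflection_eq (x : Plane) : axisReflection x = rayReflection (Real.pi / 3) x := rfl

lemma axisReflection_axisReflection (x : Plane) : axisReflection (axisReflection x) = x :=
  Submodule.reflection_reflection _ _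

lemma cos_two_pi_div_three : Real.cos (2 * (Real.pi / 3)) = -(1 / 2) := by
  rw [Real.cos_two_mul, Real.cos_pi_div_three]
  norm_num

lemma sin_two_pi_div_three : Real.sin (2 * (Real.pi / 3)) = √3 / 2 := by
  rw [Real.sin_two_mul, Real.cos_pi_div_three, Real.sin_pi_div_three]
  ring

lemma side_zero_axisReflection (x : Plane) : side 0 (axisReflection x) = side 1 x := by
  rw [side_zero, axisReflection_eq, rayReflection_apply_one, side_one, cos_two_pi_div_three,
    sin_two_pi_div_three]
  ring

lemma side_one_axisReflection (x : Plane) : side 1 (axisReflection x) = side 0 x := by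
  rw [← side_zero_axisReflection, axisReflection_axisReflection]

lemma axisReflection_mem_cone {x : Plane} : axisReflection x ∈ cone 0 ↔ x ∈ cone 0 := by
  rw [mem_cone_zero, mem_cone_zero, Fin.forall_fin_two, Fin.forall_fin_two,
    side_zero_axisReflection, side_one_axisReflection, and_comm]

lemma axisReflection_center : axisReflection (center 0) = center 0 := by
  have : center 0 = polarPoint 1 (Real.pi / 3) := by simp [center]
  rw [this, axisReflection_eq, rayReflection_polarPoint]
  congr 1
  ring

lemma dist_axisReflection_center (x : Plane) :
    dist (axisReflection x) (center 0) = dist x (center 0) := by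
  conv_lhs => rw [← axisReflection_center]
  exact axisReflection.dist_map _ _

/-! ### Barriers -/

lemma pd_inner (v : Plane) (x : Plane) (i : Fin 2) : pd i (fun y => inner ℝ v y) x = v i := by
  have : HasFDerivAt (fun y : Plane => inner ℝ v y) (innerSL ℝ v) x := (innerSL ℝ v).hasFDerivAt
  unfold pd
  rw [this.fderiv]
  simp [EuclideanSpace.inner_single_right]

lemma contDiff_inner_left (v : Plane) {n : WithTop ℕ∞} :
    ContDiff ℝ n fun y : Plane => inner ℝ v y := contDiff_const.inner ℝ contDiff_id

lemma gradient_inner (v : Plane) (x : Plane) : gradient (fun y => inner ℝ v y) x = v := by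
  ext i
  rw [gradient_apply, pd_inner]

lemma laplacian_inner (v : Plane) (x : Plane) :
    Laplacian.laplacian (fun y : Plane => (inner ℝ v y : ℝ)) x = 0 := by
  rw [laplacian_eq (contDiff_inner_left v).contDiffAt]
  refine Finset.sum_eq_zero fun i _ => ?_
  have : pd i (fun y => inner ℝ v y) = fun _ => v i := funext fun y => pd_inner v y i
  rw [this, pd_const]

lemma laplacian_comp_inner {F : ℝ → ℝ} (hF : ContDiff ℝ 2 F) {v : Plane} (hv : ‖v‖ = 1)
    (x : Plane) :
    Laplacian.laplacian (fun y => F (inner ℝ v y)) x = deriv (deriv F) (inner ℝ v x) := by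
  rw [laplacian_comp hF (contDiff_inner_left v), laplacian_inner, gradient_inner, hv]
  ring

lemma pd_norm_sub_sq (p : Plane) (i : Fin 2) (x : Plane) :
    pd i (fun y => ‖y - p‖ ^ 2) x = 2 * (x i - p i) := by
  have h := fderiv_comp_sub (𝕜 := ℝ) (f := fun y : Plane => ‖y‖ ^ 2) (x := x) p
  unfold pd
  rw [h, fderiv_norm_sq_apply]
  simp [EuclideanSpace.inner_single_right]

lemma contDiff_norm_sub_sq (p : Plane) {n : WithTop ℕ∞} :
    ContDiff ℝ n fun y : Plane => ‖y - p‖ ^ 2 :=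
  (contDiff_id.sub contDiff_const).norm_sq ℝ

lemma gradient_norm_sub_sq (p x : Plane) :
    gradient (fun y => ‖y - p‖ ^ 2) x = (2 : ℝ) • (x - p) := by
  ext i
  rw [gradient_apply, pd_norm_sub_sq]
  simp

lemma laplacian_norm_sub_sq (p x : Plane) :
    Laplacian.laplacian (fun y : Plane => ‖y - p‖ ^ 2) x = 4 := by
  rw [laplacian_eq (contDiff_norm_sub_sq p).contDiffAt, Fin.sum_univ_two]
  have : ∀ i, pd i (pd i fun y => ‖y - p‖ ^ 2) x = 2 := by
    intro i
    have h : (pd i fun y => ‖y - p‖ ^ 2) = fun y => 2 * (y i - p i) :=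
      funext fun y => pd_norm_sub_sq p i y
    have hd : DifferentiableAt ℝ (fun y : Plane => y i) x :=
      (EuclideanSpace.proj i : Plane →L[ℝ] ℝ).differentiableAt
    rw [h, pd_const_mul (hd.sub_const _), pd_sub_const, pd_coord]
    simp
  rw [this, this]
  norm_num

/-- The explicit subsolution. -/
noncomputable def subsolution (x : Plane) : ℝ :=
  side 0 x * side 1 x * (Real.exp (300 - 75 * ‖x - center 0‖ ^ 2) - 1)

lemma contDiff_subsolution : ContDiff ℝ ∞ subsolution :=
  ((contDiff_side 0).mul (contDiff_side 1)).mul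
    ((Real.contDiff_exp.comp (contDiff_const.sub (contDiff_const.mul
      (contDiff_norm_sub_sq _)))).sub contDiff_const)

lemma laplacian_subsolution (x : Plane) : Laplacian.laplacian subsolution x =
    Real.exp (300 - 75 * ‖x - center 0‖ ^ 2) * (1 + 450 * axial x +
      300 * (side 0 x * side 1 x) * (75 * ‖x - center 0‖ ^ 2 - 3)) - 1 := by
  have hF : ContDiff ℝ 2 fun t : ℝ => Real.exp (300 - 75 * t) - 1 :=
    (Real.contDiff_exp.comp (contDiff_const.sub (contDiff_const.mul contDiff_id))).sub
      contDiff_const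
  have hF1 : deriv (fun t : ℝ => Real.exp (300 - 75 * t) - 1) =
      fun t => -75 * Real.exp (300 - 75 * t) := by
    funext t
    have := ((((hasDerivAt_id t).const_mul 75).const_sub 300).exp).sub_const 1
    refine (HasDerivAt.deriv this).trans ?_
    simp
    ring
  have hF2 : deriv (fun t : ℝ => -75 * Real.exp (300 - 75 * t)) =
      fun t => 5625 * Real.exp (300 - 75 * t) := by
    funext t
    have := ((((hasDerivAt_id t).const_mul 75).const_sub 300).exp).const_mul (-75)
    refine (HasDerivAt.deriv this).trans ?_
    simp
    ring
  set f : Plane → ℝ := fun y => ‖y - center 0‖ ^ 2 with hf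
  have hfc : ContDiff ℝ 2 f := contDiff_norm_sub_sq _
  set k : Plane → ℝ := fun y => Real.exp (300 - 75 * f y) - 1 with hk
  have hkc : ContDiff ℝ 2 k := hF.comp hfc
  have hk2 : Laplacian.laplacian k x = Real.exp (300 - 75 * f x) * (22500 * f x - 300) := by
    rw [hk, laplacian_comp hF hfc, hF1, hF2, hf, laplacian_norm_sub_sq, gradient_norm_sub_sq,
      norm_smul, mul_pow]
    norm_num
    ring
  have hgk : gradient k x = (-150 * Real.exp (300 - 75 * f x)) • (x - center 0) := by
    ext i
    rw [gradient_apply, hk, pd_comp (hF.differentiable (by simp) _)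
      (hfc.differentiable (by simp) _), hF1, hf, pd_norm_sub_sq]
    simp
    ring
  have hq : Laplacian.laplacian (fun y => side 0 y * side 1 y) x = 1 := by
    rw [laplacian_mul (contDiff_side 0) (contDiff_side 1)]
    unfold side
    rw [laplacian_inner, laplacian_inner, gradient_inner, gradient_inner, inner_plane,
      Fin.sum_univ_two]
    simp [normal, inner_plane, Fin.sum_univ_two]
  have hgq : gradient (fun y => side 0 y * side 1 y) x =
      side 0 x • normal 1 + side 1 x • normal 0 := by
    ext i
    rw [gradient_apply, pd_mul ((contDiff_side 0 (n := 1)).differentiable (by simp) x)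
      ((contDiff_side 1 (n := 1)).differentiable (by simp) x)]
    unfold side
    rw [pd_inner, pd_inner]
    simp
    ring
  have hz : ∀ i, inner ℝ (normal i) (center 0) = √3 / 2 := side_center_zero
  change Laplacian.laplacian (fun y => side 0 y * side 1 y * k y) x = _
  rw [laplacian_mul ((contDiff_side 0).mul (contDiff_side 1)) hkc, hk2, hq, hgk, hgq,
    inner_smul_right, inner_sub_right, inner_add_left, inner_add_left, inner_smul_left,
    inner_smul_left, inner_smul_left, inner_smul_left, hz, hz]
  have e0 : inner ℝ (normal 0) x = side 0 x := rfl
  have e1 : inner ℝ (normal 1) x = side 1 x := rfl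
  have ha := axial_eq x
  rw [e0, e1]
  simp only [hk, conj_trivial]
  linear_combination (-150 * √3 * Real.exp (300 - 75 * f x)) * ha
    + (150 * Real.exp (300 - 75 * f x) * axial x) * sqrt_three_sq

lemma one_add_le_exp_mul {s : ℝ} (hs : 1 ≤ s) : 2 ≤ Real.exp s := by
  have := Real.add_one_le_exp s
  linarith

lemma subsolution_ge {x : Plane} (hx : ∀ i, 0 ≤ side i x) (hn : ‖x‖ < 3 / 4) :
    side 0 x * side 1 x ≤ subsolution x := by
  have h1 : ‖x - center 0‖ ≤ 7 / 4 := by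
    have := norm_sub_le x (center 0)
    rw [norm_center_zero] at this
    linarith
  have h2 : 2 ≤ Real.exp (300 - 75 * ‖x - center 0‖ ^ 2) :=
    one_add_le_exp_mul (by nlinarith [norm_nonneg (x - center 0)])
  unfold subsolution
  have := mul_nonneg (hx 0) (hx 1)
  nlinarith

lemma subsolution_pos {x : Plane} (hx : ∀ i, 0 < side i x) (hn : ‖x - center 0‖ < 2) :
    0 < subsolution x := by
  unfold subsolution
  have : 1 < Real.exp (300 - 75 * ‖x - center 0‖ ^ 2) :=
    Real.one_lt_exp_iff.2 (by nlinarith [norm_nonneg (x - center 0)])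
  exact mul_pos (mul_pos (hx 0) (hx 1)) (by linarith)

lemma subsolution_nonpos {x : Plane} (hx : ∀ i, 0 ≤ side i x) (hn : 2 ≤ ‖x - center 0‖) :
    subsolution x ≤ 0 := by
  unfold subsolution
  have : Real.exp (300 - 75 * ‖x - center 0‖ ^ 2) ≤ 1 :=
    Real.exp_le_one_iff.2 (by nlinarith)
  exact mul_nonpos_of_nonneg_of_nonpos (mul_nonneg (hx 0) (hx 1)) (by linarith)

lemma one_le_laplacian_subsolution {x : Plane} (hx : ∀ i, 0 ≤ side i x)
    (hn : ‖x - center 0‖ < 2) (hB : 1 / 5 ≤ ‖x - center 0‖) :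
    1 ≤ Laplacian.laplacian subsolution x := by
  rw [laplacian_subsolution]
  have ha := norm_le_two_mul_axial hx
  have hq := mul_nonneg (hx 0) (hx 1)
  have hr : 0 ≤ 75 * ‖x - center 0‖ ^ 2 - 3 := by nlinarith
  have h3 : 0 ≤ 300 * (side 0 x * side 1 x) * (75 * ‖x - center 0‖ ^ 2 - 3) := by positivity
  have h4 : 0 ≤ axial x := by linarith [norm_nonneg x]
  set E := Real.exp (300 - 75 * ‖x - center 0‖ ^ 2)
  by_cases h : ‖x - center 0‖ ≤ 3 / 2
  · have : 2 ≤ E := one_add_le_exp_mul (by nlinarith)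
    nlinarith [mul_nonneg (by linarith : 0 ≤ E)
      (by positivity : 0 ≤ 450 * axial x + 300 * (side 0 x * side 1 x) *
        (75 * ‖x - center 0‖ ^ 2 - 3))]
  · have h5 : 1 / 2 ≤ ‖x‖ := by
      have := norm_sub_le x (center 0)
      rw [norm_center_zero] at this
      linarith
    have h6 : 1 ≤ E := Real.one_le_exp (by nlinarith)
    nlinarith [mul_nonneg (by linarith : 0 ≤ E) h3, mul_le_mul h6
      (by linarith : (1 : ℝ) ≤ 450 * axial x) zero_le_one (by linarith)]

lemma exists_laplacian_subsolution_bound :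
    ∃ M : ℝ, ∀ x ∈ Metric.ball (center 0) (1 / 5), M ≤ Laplacian.laplacian subsolution x := by
  obtain ⟨M, hM⟩ := (isCompact_closedBall (center 0) (1 / 5)).exists_bound_of_continuousOn
    (continuous_laplacian (contDiff_subsolution.of_le two_le_infty)).continuousOn
  exact ⟨-M, fun x hx => (abs_le.1 (hM x (Metric.ball_subset_closedBall hx))).1⟩

lemma laplacian_linear_barrier (A : ℝ) (i : Fin 2) (x : Plane) :
    Laplacian.laplacian (fun y => A * (1 - Real.exp (-side i y))) x =
      -(A * Real.exp (-side i x)) := by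
  have hF : ContDiff ℝ 2 fun t : ℝ => A * (1 - Real.exp (-t)) :=
    contDiff_const.mul (contDiff_const.sub (Real.contDiff_exp.comp contDiff_neg))
  have h := laplacian_comp_inner hF (norm_normal i) x
  have h1 : deriv (fun t : ℝ => A * (1 - Real.exp (-t))) = fun t => A * Real.exp (-t) := by
    funext t
    have := (((hasDerivAt_neg t).exp).const_sub 1).const_mul A
    rw [HasDerivAt.deriv this]
    ring
  have h2 : deriv (fun t : ℝ => A * Real.exp (-t)) = fun t => -(A * Real.exp (-t)) := by
    funext t
    have := ((hasDerivAt_neg t).exp).const_mul A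
    rw [HasDerivAt.deriv this]
    ring
  rw [h1, h2] at h
  exact h

/-- The profile of the barrier which bounds the positivity set. -/
noncomputable def cutProfile (T t : ℝ) : ℝ := (t - T) ^ 2 / 4 * (1 - Real.exp (-t))

lemma contDiff_cutProfile (T : ℝ) {n : WithTop ℕ∞} : ContDiff ℝ n (cutProfile T) :=
  (((contDiff_id.sub contDiff_const).pow 2).div_const 4).mul
    (contDiff_const.sub (Real.contDiff_exp.comp contDiff_neg))

lemma deriv_deriv_cutProfile (T t : ℝ) :
    deriv (deriv (cutProfile T)) t =
      1 / 2 - Real.exp (-t) * ((T - t + 2) ^ 2 - 2) / 4 := by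
  have hq : ∀ t, HasDerivAt (fun t : ℝ => (t - T) ^ 2 / 4) ((t - T) / 2) t := by
    intro t
    refine ((((hasDerivAt_id t).sub_const T).fun_pow 2).div_const 4).congr_deriv ?_
    simp
    ring
  have hl : ∀ t, HasDerivAt (fun t : ℝ => (t - T) / 2) (1 / 2) t := fun t =>
    ((hasDerivAt_id t).sub_const T).div_const 2
  have he : ∀ t, HasDerivAt (fun t : ℝ => 1 - Real.exp (-t)) (Real.exp (-t)) t := by
    intro t
    refine (((hasDerivAt_neg t).exp).const_sub 1).congr_deriv ?_
    ring
  have he2 : ∀ t, HasDerivAt (fun t : ℝ => Real.exp (-t)) (-Real.exp (-t)) t := by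
    intro t
    refine ((hasDerivAt_neg t).exp).congr_deriv ?_
    ring
  have h1 : deriv (cutProfile T) = fun t =>
      (t - T) / 2 * (1 - Real.exp (-t)) + (t - T) ^ 2 / 4 * Real.exp (-t) :=
    funext fun t => ((hq t).fun_mul (he t)).deriv
  rw [h1, (((hl t).fun_mul (he t)).fun_add ((hq t).fun_mul (he2 t))).deriv]
  ring

/-! ### The solution of the obstacle problem in a large bounded part of the cone -/

lemma MemW012.neg {U : Set Plane} {u : Plane → ℝ} {g : Plane → Plane} (h : MemW012 U u g) :
    MemW012 U (fun x => -u x) (fun x => -g x) := by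
  obtain ⟨hu, hg, φ, hφ, h1, h2⟩ := h
  have hneg : ∀ n, (fun x => (-1) * φ n x + 0 * φ n x) = fun x => -φ n x := fun n => by
    funext x
    ring
  have hφ' : ∀ n, IsTestFunction U fun x => -φ n x := fun n => by
    rw [← hneg]
    exact (hφ n).add_smul (hφ n) (-1) 0
  refine ⟨hu.neg, hg.neg, fun n x => -φ n x, hφ', ?_, ?_⟩
  · exact L2Tendsto.of_le h1 1 fun n => .of_forall fun x => by
      rw [one_mul, show -φ n x - -u x = -(φ n x - u x) by ring, norm_neg]
  · refine L2Tendsto.of_le h2 1 fun n => .of_forall fun x => ?_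
    have : gradient (fun x => -φ n x) x = -gradient (φ n) x := by
      ext i
      rw [gradient_apply, pd_neg]
      simp [gradient_apply]
    rw [this, one_mul, ← norm_neg]
    simp [sub_eq_add_neg, add_comm]

lemma MemW012.mono {U U' : Set Plane} {u : Plane → ℝ} {g : Plane → Plane} (h : MemW012 U u g)
    (hU : U ⊆ U') : MemW012 U' u g := by
  obtain ⟨hu, hg, φ, hφ, h1, h2⟩ := h
  exact ⟨hu, hg, φ, fun n => (hφ n).mono hU, h1, h2⟩

lemma MemW012.congr {U : Set Plane} {u u' : Plane → ℝ} {g : Plane → Plane} (h : MemW012 U u g)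
    (hu' : u =ᵐ[volume] u') : MemW012 U u' g := by
  obtain ⟨hu, hg, φ, hφ, h1, h2⟩ := h
  refine ⟨(memLp_congr_ae hu').1 hu, hg, φ, hφ, ?_, h2⟩
  refine L2Tendsto.of_le h1 1 fun n => ?_
  filter_upwards [hu'] with x hx
  rw [hx, one_mul]

lemma MemW012.ae_eq_zero {U : Set Plane} (hU : MeasurableSet U) {u : Plane → ℝ}
    {g : Plane → Plane} (h : MemW012 U u g) : ∀ᵐ x, x ∉ U → u x = 0 := by
  obtain ⟨hu, hg, φ, hφ, h1, h2⟩ := h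
  have hm : MemLp (Uᶜ.indicator u) 2 volume := hu.indicator hU.compl
  have hz : MemLp (fun _ : Plane => (0 : ℝ)) 2 volume := MemLp.zero'
  have h3 : L2Tendsto (fun _ _ => (0 : ℝ)) (Uᶜ.indicator u) := by
    refine L2Tendsto.of_le h1 1 fun n => .of_forall fun x => ?_
    by_cases hx : x ∈ U
    · simp [hx]
    · simp [hx, (hφ n).eq_zero hx]
  have h4 : Uᶜ.indicator u =ᵐ[volume] fun _ => (0 : ℝ) :=
    h3.ae_eq (fun _ => hz) hm hz (l2Tendsto_const _)
  filter_upwards [h4] with x hx hxU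
  rwa [Set.indicator_of_mem hxU] at hx

/-- The source term `j χ_B`. -/
noncomputable def load (j : ℝ) (x : Plane) : ℝ :=
  j * (Metric.ball (center 0) (1 / 5)).indicator (fun _ => (1 : ℝ)) x

lemma load_of_mem {j : ℝ} {x : Plane} (hx : x ∈ Metric.ball (center 0) (1 / 5)) :
    load j x = j := by
  rw [load, Set.indicator_of_mem hx, mul_one]

lemma load_of_notMem {j : ℝ} {x : Plane} (hx : x ∉ Metric.ball (center 0) (1 / 5)) :
    load j x = 0 := by
  rw [load, Set.indicator_of_notMem hx, mul_zero]

lemma load_nonneg {j : ℝ} (hj : 0 ≤ j) (x : Plane) : 0 ≤ load j x :=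
  mul_nonneg hj (Set.indicator_nonneg (fun _ _ => zero_le_one) x)

lemma load_le {j : ℝ} (hj : 0 ≤ j) (x : Plane) : load j x ≤ j := by
  by_cases hx : x ∈ Metric.ball (center 0) (1 / 5)
  · rw [load_of_mem hx]
  · rwa [load_of_notMem hx]

lemma measurable_load (j : ℝ) : Measurable (load j) :=
  measurable_const.mul (measurable_const.indicator measurableSet_ball)

lemma memLp_load (j : ℝ) : MemLp (load j) 2 volume :=
  (memLp_indicator_const 2 measurableSet_ball 1 (Or.inr measure_ball_lt_top.ne)).const_mul j

lemma load_axisReflection (j : ℝ) (x : Plane) : load j (axisReflection x) = load j x := by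
  by_cases hx : x ∈ Metric.ball (center 0) (1 / 5)
  · rw [load_of_mem hx, load_of_mem]
    rwa [Metric.mem_ball, dist_axisReflection_center]
  · rw [load_of_notMem hx, load_of_notMem]
    rwa [Metric.mem_ball, dist_axisReflection_center]

/-- The part of `cone 0` of size `R`. -/
noncomputable def cap (R : ℝ) : Set Plane := cone 0 ∩ Metric.ball 0 R

lemma isOpen_cap (R : ℝ) : IsOpen (cap R) := isOpen_cone_zero.inter Metric.isOpen_ball

lemma isBounded_cap (R : ℝ) : Bornology.IsBounded (cap R) :=
  Metric.isBounded_ball.subset Set.inter_subset_right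

lemma side_nonneg_of_mem_frontier_cap {R : ℝ} {x : Plane} (hx : x ∈ frontier (cap R))
    (i : Fin 2) : 0 ≤ side i x :=
  side_nonneg_of_mem_closure (closure_mono Set.inter_subset_left hx.1) i

/-- A function satisfying the Euler-Lagrange inequalities of the obstacle problem. -/
structure IsCapSolution (j T : ℝ) (u : Plane → ℝ) (g : Plane → Plane) : Prop where
  mem : MemW012 (cap (6 * T)) u g
  symm : ∀ᵐ x, u (axisReflection x) = u x
  nonneg : ∀ᵐ x, 0 ≤ u x
  le_side : ∀ᵐ x, x ∈ cap (6 * T) → ∀ i, u x ≤ 9 * j * side i x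
  eq_zero : ∀ᵐ x, T ≤ axial x → u x = 0
  subsolution_le : ∀ᵐ x, x ∈ cap (6 * T) → subsolution x ≤ u x
  upper : ∀ ψ, IsTestFunction (cap (6 * T)) ψ → (∀ x, 0 ≤ ψ x) →
    ∫ x, inner ℝ (g x) (gradient ψ x) ≤
      ∫ x, (load j x - {x | 0 < u x}.indicator (fun _ => 1) x) * ψ x
  lower : ∀ ψ, IsTestFunction (cap (6 * T)) ψ → (∀ x, 0 ≤ ψ x) →
    ∫ x, (load j x - 1) * ψ x ≤ ∫ x, inner ℝ (g x) (gradient ψ x)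

lemma exp_two_lt_nine : Real.exp 2 < 9 := by
  have h := Real.exp_one_lt_three
  have : Real.exp 2 = Real.exp 1 * Real.exp 1 := by rw [← Real.exp_add]; norm_num
  nlinarith [Real.exp_pos 1]

lemma one_ninth_le_exp_neg {t : ℝ} (ht : t ≤ 2) : 1 / 9 ≤ Real.exp (-t) := by
  rw [Real.exp_neg, ← one_div]
  exact one_div_le_one_div_of_le (Real.exp_pos _)
    ((Real.exp_le_exp.2 ht).trans exp_two_lt_nine.le)

theorem exists_isCapSolution : ∃ j₀ : ℝ, 0 < j₀ ∧ ∀ j, j₀ ≤ j →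
    ∃ T u g, 2 ≤ T ∧ IsCapSolution j T u g := by
  obtain ⟨M, hM⟩ := exists_laplacian_subsolution_bound
  refine ⟨max 1 (1 - M), by positivity, fun j hj => ?_⟩
  have hj1 : 1 ≤ j := (le_max_left _ _).trans hj
  have hjM : 1 - M ≤ j := (le_max_right _ _).trans hj
  have hj0 : 0 ≤ j := by linarith
  set T : ℝ := 2 + 30 * j with hT
  set D := cap (6 * T) with hD
  have hDo : IsOpen D := isOpen_cap _
  have hDb : Bornology.IsBounded D := isBounded_cap _
  obtain ⟨u, g, hum, hu, hsymm, hEL⟩ := exists_relaxed_minimizer hDb (memLp_load j)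
    axisReflection axisReflection_axisReflection (fun x hx => by
      refine ⟨axisReflection_mem_cone.1 hx.1, ?_⟩
      have := hx.2
      rwa [mem_ball_zero_iff, axisReflection.norm_map, ← mem_ball_zero_iff] at this)
    (load_axisReflection j)
  have hum' : Measurable u := hum.measurable
  have hpos : MeasurableSet {x | 0 < u x} := measurableSet_lt measurable_const hum'
  have hnn : MeasurableSet {x | 0 ≤ u x} := measurableSet_le measurable_const hum'
  set a : Plane → ℝ := fun x => load j x - {x | 0 < u x}.indicator (fun _ => 1) x with ha
  set a' : Plane → ℝ := fun x => {x | 0 ≤ u x}.indicator (fun _ => 1) x - load j x with ha'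
  have ham : Measurable a := (measurable_load j).sub (measurable_const.indicator hpos)
  have ham' : Measurable a' := (measurable_const.indicator hnn).sub (measurable_load j)
  have hind : ∀ (s : Set Plane) x, 0 ≤ s.indicator (fun _ => (1 : ℝ)) x ∧
      s.indicator (fun _ => (1 : ℝ)) x ≤ 1 := fun s x =>
    ⟨Set.indicator_nonneg (fun _ _ => zero_le_one) x, Set.indicator_le_self' (by simp) x⟩
  have haM : ∀ x, |a x| ≤ j + 1 := fun x => by
    rw [abs_le]
    have := hind {x | 0 < u x} x
    have := load_nonneg hj0 x
    have := load_le hj0 x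
    constructor <;> simp only [ha] <;> linarith
  have haM' : ∀ x, |a' x| ≤ j + 1 := fun x => by
    rw [abs_le]
    have := hind {x | 0 ≤ u x} x
    have := load_nonneg hj0 x
    have := load_le hj0 x
    constructor <;> simp only [ha'] <;> linarith
  have hint : ∀ {c : Plane → ℝ}, Measurable c → (∀ x, |c x| ≤ j + 1) → ∀ {ψ},
      IsTestFunction D ψ → Integrable fun x => c x * ψ x := fun hc hb ψ hψ =>
    hψ.integrable.bdd_mul hc.aestronglyMeasurable (.of_forall fun x => hb x)
  have hload : ∀ x, |load j x| ≤ j + 1 := fun x => by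
    rw [abs_of_nonneg (load_nonneg hj0 x)]
    linarith [load_le hj0 x]
  have hupper : ∀ ψ, IsTestFunction D ψ → (∀ x, 0 ≤ ψ x) →
      ∫ x, inner ℝ (g x) (gradient ψ x) ≤ ∫ x, a x * ψ x := by
    intro ψ hψ hψ0
    have h1 := hEL _ (hψ.add_smul hψ (-1) 0)
    simp only [hψ.gradient_add_smul hψ] at h1
    simp only [neg_smul, one_smul, zero_smul, add_zero, inner_neg_right, zero_mul, neg_mul,
      one_mul, mul_neg] at h1
    rw [integral_neg, integral_neg] at h1
    have h2 : ∫ x, a x * ψ x = (∫ x, load j x * ψ x) + ∫ x, posDeriv (u x) (-ψ x) := by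
      have e : ∀ x, posDeriv (u x) (-ψ x) = a x * ψ x - load j x * ψ x := by
        intro x
        have := hψ0 x
        simp only [posDeriv, ha, Set.indicator_apply, Set.mem_ofPred_eq]
        split_ifs
        · ring
        · rw [max_eq_right (by linarith)]; ring
        · ring
      simp only [e]
      rw [integral_sub (hint ham haM hψ) (hint (measurable_load j) hload hψ)]
      ring
    rw [h2]
    linarith
  have hlower : ∀ ψ, IsTestFunction D ψ → (∀ x, 0 ≤ ψ x) →
      ∫ x, inner ℝ (-g x) (gradient ψ x) ≤ ∫ x, a' x * ψ x := by
    intro ψ hψ hψ0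
    have h1 := hEL _ hψ
    simp only [inner_neg_left]
    rw [integral_neg]
    have h2 : ∫ x, a' x * ψ x = (∫ x, posDeriv (u x) (ψ x)) - ∫ x, load j x * ψ x := by
      have e : ∀ x, posDeriv (u x) (ψ x) = a' x * ψ x + load j x * ψ x := by
        intro x
        have := hψ0 x
        simp only [posDeriv, ha', Set.indicator_apply, Set.mem_ofPred_eq]
        split_ifs <;> first | (exfalso; linarith) | skip
        · ring
        · rw [max_eq_left this]; ring
        · exact absurd (le_antisymm (by linarith) ‹0 ≤ u x›) ‹¬u x = 0›
        · ring
      simp only [e]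
      rw [integral_add (hint ham' haM' hψ) (hint (measurable_load j) hload hψ)]
      ring
    rw [h2]
    linarith
  have hoff : ∀ᵐ x, x ∉ D → u x = 0 := hu.ae_eq_zero hDo.measurableSet
  have hnonneg : ∀ᵐ x, 0 ≤ u x := by
    have h := hu.neg.le_of_laplacian_le (V := fun _ => 0) hDo hDb contDiff_const
      (fun _ _ => le_rfl) ham'.aestronglyMeasurable haM' hlower (.of_forall fun x _ hx => by
        have h0 : ¬ 0 ≤ u x := by linarith
        have : Laplacian.laplacian (fun _ : Plane => (0 : ℝ)) x = 0 :=
          congrFun InnerProductSpace.laplacian_const x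
        rw [this]
        simp only [ha', Set.indicator_apply, Set.mem_ofPred_eq, h0, if_false]
        linarith [load_nonneg hj0 x])
    filter_upwards [h, hoff] with x h1 h2
    by_cases hx : x ∈ D
    · linarith [h1 hx]
    · rw [h2 hx]
  have hside : ∀ x ∈ D, ∀ i, 0 < side i x := fun x hx => mem_cone_zero.1 hx.1
  have hle : ∀ i, ∀ᵐ x, x ∈ D → u x ≤ 9 * j * side i x := by
    intro i
    have hV : ContDiff ℝ ∞ fun y : Plane => 9 * j * (1 - Real.exp (-side i y)) :=
      contDiff_const.mul (contDiff_const.sub (Real.contDiff_exp.comp (contDiff_side i).neg))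
    have h := hu.le_of_laplacian_le hDo hDb hV (fun x hx => by
        have := side_nonneg_of_mem_frontier_cap hx i
        have : Real.exp (-side i x) ≤ 1 := Real.exp_le_one_iff.2 (by linarith)
        exact mul_nonneg (by positivity) (by linarith)) ham.aestronglyMeasurable haM hupper
      (.of_forall fun x _ _ => by
        rw [laplacian_linear_barrier, neg_neg]
        have h1 := (hind {x | 0 < u x} x).1
        have h2 : load j x ≤ 9 * j * Real.exp (-side i x) := by
          by_cases hx : x ∈ Metric.ball (center 0) (1 / 5)
          · rw [load_of_mem hx]
            have h3 := (abs_le.1 (abs_side_sub_le i x (center 0))).2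
            rw [Metric.mem_ball] at hx
            rw [side_center_zero] at h3
            have h4 : √3 ≤ 2 := Real.sqrt_le_iff.2 ⟨by norm_num, by norm_num⟩
            have h5 := one_ninth_le_exp_neg (t := side i x) (by linarith)
            nlinarith
          · rw [load_of_notMem hx]
            positivity
        simp only [ha]
        linarith)
    filter_upwards [h] with x hx hxD
    refine (hx hxD).trans ?_
    have := Real.add_one_le_exp (-side i x)
    exact mul_le_mul_of_nonneg_left (by linarith) (by positivity)
  have hcut : ∀ q : ℚ, T ≤ q → ∀ᵐ x, x ∈ D → u x ≤ (axial x - q) ^ 2 / 4 := by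
    intro q hq
    have hax : ∀ x : Plane, (∀ i, 0 ≤ side i x) → 0 ≤ axial x := fun x hx => by
      linarith [norm_le_two_mul_axial hx, norm_nonneg x]
    have hnn : ∀ x : Plane, (∀ i, 0 ≤ side i x) → 0 ≤ cutProfile q (axial x) := fun x hx => by
      have : Real.exp (-axial x) ≤ 1 := Real.exp_le_one_iff.2 (by linarith [hax x hx])
      exact mul_nonneg (by positivity) (by linarith)
    have hV : ContDiff ℝ ∞ fun y : Plane => cutProfile q (axial y) :=
      (contDiff_cutProfile q).comp (contDiff_inner_left (center 0))
    have h := hu.le_of_laplacian_le hDo hDb hV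
      (fun x hx => hnn x (side_nonneg_of_mem_frontier_cap hx)) ham.aestronglyMeasurable haM hupper
      (.of_forall fun x hxD hx => by
        have hs := fun i => (hside x hxD i).le
        have e : Laplacian.laplacian (fun y : Plane => cutProfile q (axial y)) x = _ :=
          laplacian_comp_inner (contDiff_cutProfile q) norm_center_zero x
        rw [e, deriv_deriv_cutProfile]
        change _ ≤ -(1 / 2 - Real.exp (-axial x) * ((q - axial x + 2) ^ 2 - 2) / 4)
        have hux : 0 < u x := (hnn x hs).trans_lt hx
        have h1 : a x = load j x - 1 := by simp [ha, hux]
        have h2 := hax x hs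
        have h3 : Real.exp (-axial x) ≤ 1 := Real.exp_le_one_iff.2 (by linarith)
        have h4 := Real.exp_pos (-axial x)
        rw [h1]
        by_cases hx : x ∈ Metric.ball (center 0) (1 / 5)
        · rw [load_of_mem hx]
          rw [Metric.mem_ball] at hx
          have h5 := (abs_le.1 (abs_axial_sub_one_le (x := x))).2
          have h6 := one_ninth_le_exp_neg (t := axial x) (by linarith)
          have h7 : 36 * j ≤ ((q : ℝ) - axial x + 2) ^ 2 - 2 := by nlinarith
          nlinarith
        · rw [load_of_notMem hx]
          nlinarith [sq_nonneg ((q : ℝ) - axial x + 2)])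
    filter_upwards [h] with x hx hxD
    refine (hx hxD).trans ?_
    have := Real.exp_pos (-axial x)
    unfold cutProfile
    nlinarith [sq_nonneg (axial x - q)]
  have hzero : ∀ᵐ x, T ≤ axial x → u x = 0 := by
    have hall : ∀ᵐ x, ∀ q : ℚ, T ≤ q → x ∈ D → u x ≤ (axial x - q) ^ 2 / 4 :=
      ae_all_iff.2 fun q => by
        by_cases hq : T ≤ q
        · filter_upwards [hcut q hq] with x hx _ using hx
        · exact .of_forall fun x h => absurd h hq
    filter_upwards [hall, hoff, hnonneg] with x h1 h2 h3 h4
    by_cases hx : x ∈ D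
    · refine le_antisymm (le_of_forall_pos_le_add fun ε hε => ?_) h3
      obtain ⟨q, hq1, hq2⟩ := exists_rat_btwn (show axial x < axial x + min 1 ε by
        linarith [lt_min one_pos hε])
      have h5 := h1 q (h4.trans hq1.le) hx
      have h6 := min_le_left 1 ε
      have h7 := min_le_right 1 ε
      nlinarith
    · exact h2 hx
  have hsub : ∀ᵐ x, x ∈ D → subsolution x ≤ u x := by
    have e : ∀ x, Laplacian.laplacian (fun y => -subsolution y) x =
        -Laplacian.laplacian subsolution x := fun x =>
      congrFun (InnerProductSpace.laplacian_neg (f := subsolution)) x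
    have h := hu.neg.le_of_laplacian_le (V := fun x => -subsolution x) hDo hDb
      contDiff_subsolution.neg (fun x hx => by
        have hs := side_nonneg_of_mem_frontier_cap hx
        rw [Left.nonneg_neg_iff]
        by_cases hc : x ∈ cone 0
        · refine subsolution_nonpos hs ?_
          have hxD : x ∉ D := by
            have := hx.2
            rwa [hDo.interior_eq] at this
          have h1 : 6 * T ≤ ‖x‖ := by
            by_contra h
            exact hxD ⟨hc, by simpa using h⟩
          have h2 := norm_sub_norm_le x (center 0)
          rw [norm_center_zero] at h2
          linarith
        · rw [mem_cone_zero, not_forall] at hc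
          obtain ⟨i, hi⟩ := hc
          have h0 : side i x = 0 := le_antisymm (not_lt.1 hi) (hs i)
          have : side 0 x * side 1 x = 0 := by fin_cases i <;> simp_all
          simp [subsolution, this]) ham'.aestronglyMeasurable haM' hlower (by
        filter_upwards [hnonneg] with x h0 hxD hx
        rw [e, neg_neg]
        have hs := fun i => (hside x hxD i).le
        have hw : ‖x - center 0‖ < 2 := by
          by_contra h
          linarith [subsolution_nonpos hs (not_lt.1 h)]
        have h1 := (hind {x | 0 ≤ u x} x).2
        by_cases hxB : x ∈ Metric.ball (center 0) (1 / 5)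
        · have := hM x hxB
          simp only [ha', load_of_mem hxB]
          linarith
        · have := one_le_laplacian_subsolution hs hw (by
            rw [Metric.mem_ball, dist_eq_norm] at hxB
            linarith)
          simp only [ha', load_of_notMem hxB]
          linarith)
    filter_upwards [h] with x hx hxD
    linarith [hx hxD]
  refine ⟨T, u, g, by linarith, hu, hsymm, hnonneg, ?_, hzero, hsub, hupper, ?_⟩
  · filter_upwards [ae_all_iff.2 hle] with x hx hxD i using hx i hxD
  · intro ψ hψ hψ0
    have h1 := hlower ψ hψ hψ0
    simp only [inner_neg_left] at h1
    rw [integral_neg] at h1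
    have h2 : ∫ x, (load j x - 1) * ψ x = -∫ x, a' x * ψ x := by
      rw [← integral_neg]
      refine integral_congr_ae ?_
      filter_upwards [hnonneg] with x hx
      simp only [ha', Set.indicator_apply, Set.mem_ofPred_eq, hx, if_true]
      ring
    linarith

/-! ### Mollification -/

/-- The convolution of `u` with `ρ`. -/
noncomputable def conv (u ρ : Plane → ℝ) (x : Plane) : ℝ := ∫ t, u t * ρ (x - t)

section Conv

variable {u ρ : Plane → ℝ}

lemma integrable_conv (hu : LocallyIntegrable u) (hρ : Continuous ρ) (hc : HasCompactSupport ρ)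
    (x : Plane) : Integrable (fun t => u t * ρ (x - t)) :=
  hc.convolutionExists_right (ContinuousLinearMap.lsmul ℝ ℝ) hu hρ x

lemma contDiff_conv (hu : LocallyIntegrable u) (hρ : ContDiff ℝ ∞ ρ) (hc : HasCompactSupport ρ) :
    ContDiff ℝ ∞ (conv u ρ) :=
  hc.contDiff_convolution_right (n := ⊤) (ContinuousLinearMap.lsmul ℝ ℝ) hu hρ

lemma pd_conv (hu : LocallyIntegrable u) (hρ : ContDiff ℝ 1 ρ) (hc : HasCompactSupport ρ)
    (i : Fin 2) (x : Plane) : pd i (conv u ρ) x = conv u (pd i ρ) x := by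
  have h := hc.hasFDerivAt_convolution_right (ContinuousLinearMap.lsmul ℝ ℝ) (μ := volume) hu hρ x
  have h' : HasFDerivAt (conv u ρ) _ x := h
  rw [pd, h'.fderiv, convolution_precompR_apply]
  · rfl
  · exact hu
  · exact hc.fderiv ℝ
  · exact hρ.continuous_fderiv (by simp)

lemma laplacian_conv (hu : LocallyIntegrable u) (hρ : ContDiff ℝ ∞ ρ) (hc : HasCompactSupport ρ)
    (x : Plane) : Laplacian.laplacian (conv u ρ) x = conv u (Laplacian.laplacian ρ) x := by
  have h1 : ContDiff ℝ ∞ (conv u ρ) := contDiff_conv hu hρ hc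
  rw [laplacian_eq (h1.of_le two_le_infty).contDiffAt]
  have h2 : ∀ i, pd i (conv u ρ) = conv u (pd i ρ) := fun i => by
    funext y
    exact pd_conv hu (hρ.of_le (by simp)) hc i y
  simp only [h2]
  have h3 : ∀ i, pd i (conv u (pd i ρ)) x = conv u (pd i (pd i ρ)) x := fun i =>
    pd_conv hu ((contDiff_pd_infty hρ i).of_le (by simp)) (hasCompactSupport_pd hc i) i x
  simp only [h3, conv]
  rw [← integral_finsetSum]
  · congr 1
    funext t
    rw [laplacian_eq (hρ.of_le two_le_infty).contDiffAt, Finset.mul_sum]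
  · intro i _
    exact integrable_conv hu
      (contDiff_pd_infty (contDiff_pd_infty hρ i) i).continuous
      (hasCompactSupport_pd (hasCompactSupport_pd hc i) i) x

end Conv

/-- The support radius of the `n`-th mollifier. -/
noncomputable def radius (n : ℕ) : ℝ := 1 / ((n : ℝ) + 1)

lemma radius_pos (n : ℕ) : 0 < radius n := Nat.one_div_pos_of_nat

lemma tendsto_radius : Tendsto radius atTop (𝓝 0) := tendsto_one_div_add_atTop_nhds_zero_nat

/-- A smooth bump function with support in the ball of radius `radius n`. -/
noncomputable def bump (n : ℕ) : ContDiffBump (0 : Plane) :=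
  ⟨radius n / 2, radius n, half_pos (radius_pos n), half_lt_self (radius_pos n)⟩

/-- The standard mollifiers. -/
noncomputable def mollifier (n : ℕ) : Plane → ℝ := (bump n).normed volume

lemma contDiff_mollifier (n : ℕ) : ContDiff ℝ ∞ (mollifier n) := (bump n).contDiff_normed

lemma mollifier_nonneg (n : ℕ) (x : Plane) : 0 ≤ mollifier n x := (bump n).nonneg_normed x

lemma integral_mollifier (n : ℕ) : ∫ x, mollifier n x = 1 := (bump n).integral_normed

lemma hasCompactSupport_mollifier (n : ℕ) : HasCompactSupport (mollifier n) :=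
  (bump n).hasCompactSupport_normed

lemma tsupport_mollifier (n : ℕ) : tsupport (mollifier n) = Metric.closedBall 0 (radius n) :=
  (bump n).tsupport_normed_eq

lemma mollifier_eq_zero {n : ℕ} {x : Plane} (hx : radius n ≤ ‖x‖) : mollifier n x = 0 := by
  have : x ∉ Function.support (mollifier n) := by
    rw [mollifier, (bump n).support_normed_eq, mem_ball_zero_iff, not_lt]
    exact hx
  simpa using this

lemma isTestFunction_mollifier {U : Set Plane} {n : ℕ} {x : Plane}
    (hx : Metric.closedBall x (radius n) ⊆ U) : IsTestFunction U fun t => mollifier n (x - t) := by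
  have hts : tsupport (fun t => mollifier n (x - t)) = Metric.closedBall x (radius n) := by
    have h := tsupport_comp_eq_preimage (mollifier n) (Homeomorph.subLeft x)
    have h2 : (mollifier n ∘ Homeomorph.subLeft x) = fun t => mollifier n (x - t) := rfl
    rw [h2, tsupport_mollifier] at h
    rw [h]
    ext t
    simp [dist_eq_norm, norm_sub_rev]
  refine ⟨(contDiff_mollifier n).comp (contDiff_const.sub contDiff_id), ?_, by rwa [hts]⟩
  rw [HasCompactSupport, hts]
  exact isCompact_closedBall _ _

lemma laplacian_comp_const_sub {f : Plane → ℝ} (hf : ContDiff ℝ 2 f) (x t : Plane) :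
    Laplacian.laplacian (fun t => f (x - t)) t = Laplacian.laplacian f (x - t) := by
  have h1 : ∀ s : Plane, x - s = x + (-1 : ℝ) • s := fun s => by
    rw [neg_one_smul, sub_eq_add_neg]
  simp only [h1]
  rw [laplacian_eq (contDiff_comp_affine hf x (-1)).contDiffAt, laplacian_eq hf.contDiffAt]
  refine Finset.sum_congr rfl fun i _ => ?_
  have h2 : pd i (fun y => f (x + (-1 : ℝ) • y)) = fun y => (-1) * pd i f (x + (-1 : ℝ) • y) := by
    funext y
    exact pd_comp_affine (hf.of_le (by norm_num)) x (-1) i y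
  rw [h2, pd_const_mul
    ((contDiff_comp_affine (contDiff_pd_one hf i) x (-1)).differentiable (by simp) t),
    pd_comp_affine (contDiff_pd_one hf i)]
  ring

/-- The `n`-th mollification of `u`. -/
noncomputable def mollify (n : ℕ) (u : Plane → ℝ) : Plane → ℝ := conv u (mollifier n)

section Mollify

variable {u : Plane → ℝ} {n : ℕ}

lemma contDiff_mollify (hu : LocallyIntegrable u) : ContDiff ℝ ∞ (mollify n u) :=
  contDiff_conv hu (contDiff_mollifier n) (hasCompactSupport_mollifier n)

lemma integral_mollifier_sub (n : ℕ) (x : Plane) : ∫ t, mollifier n (x - t) = 1 := by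
  rw [integral_sub_left_eq_self (fun t => mollifier n t) volume x, integral_mollifier]

lemma integrable_mollifier_sub (n : ℕ) (x : Plane) : Integrable fun t => mollifier n (x - t) :=
  ((contDiff_mollifier n).continuous.integrable_of_hasCompactSupport
    (hasCompactSupport_mollifier n)).comp_sub_left x

lemma mollify_le (hu : LocallyIntegrable u) {x : Plane} {b : ℝ}
    (h : ∀ᵐ t, t ∈ Metric.ball x (radius n) → u t ≤ b) : mollify n u x ≤ b := by
  have h1 : mollify n u x ≤ ∫ t, b * mollifier n (x - t) := by
    refine integral_mono_ae (integrable_conv hu (contDiff_mollifier n).continuous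
      (hasCompactSupport_mollifier n) x) ((integrable_mollifier_sub n x).const_mul b) ?_
    filter_upwards [h] with t ht
    by_cases hx : t ∈ Metric.ball x (radius n)
    · exact mul_le_mul_of_nonneg_right (ht hx) (mollifier_nonneg n _)
    · rw [Metric.mem_ball, not_lt, dist_comm, dist_eq_norm] at hx
      simp [mollifier_eq_zero hx]
  rwa [integral_const_mul, integral_mollifier_sub, mul_one] at h1

lemma le_mollify (hu : LocallyIntegrable u) {x : Plane} {b : ℝ}
    (h : ∀ᵐ t, t ∈ Metric.ball x (radius n) → b ≤ u t) : b ≤ mollify n u x := by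
  have h1 := mollify_le (n := n) (u := fun t => -u t) (x := x) (b := -b) hu.neg
    (by filter_upwards [h] with t ht hx using neg_le_neg (ht hx))
  have h2 : mollify n (fun t => -u t) x = -mollify n u x := by
    simp [mollify, conv, integral_neg]
  rw [h2] at h1
  linarith

lemma tendsto_mollify_ae (hu : LocallyIntegrable u) :
    ∀ᵐ x, Tendsto (fun n => mollify n u x) atTop (𝓝 (u x)) := by
  have h1 : Tendsto (fun n => (bump n).rOut) atTop (𝓝 0) := tendsto_radius
  have h2 : ∀ᶠ n in atTop, (bump n).rOut ≤ 2 * (bump n).rIn := .of_forall fun n => by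
    change radius n ≤ 2 * (radius n / 2)
    linarith
  filter_upwards [ContDiffBump.ae_convolution_tendsto_right_of_locallyIntegrable h1 h2 hu] with x hx
  refine hx.congr fun n => ?_
  rw [convolution_lsmul_swap]
  simp only [smul_eq_mul, mollify, conv, mollifier]
  congr 1
  funext t
  ring

end Mollify

lemma MemW012.locallyIntegrable {U : Set Plane} {u : Plane → ℝ} {g : Plane → Plane}
    (h : MemW012 U u g) : LocallyIntegrable u :=
  h.1.locallyIntegrable (by norm_num)

lemma MemW012.integral_mul_laplacian {U : Set Plane} {u : Plane → ℝ} {g : Plane → Plane}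
    (h : MemW012 U u g) {ψ : Plane → ℝ} (hψ : IsTestFunction Set.univ ψ) :
    ∫ x, u x * Laplacian.laplacian ψ x = -∫ x, inner ℝ (g x) (gradient ψ x) := by
  obtain ⟨hu, hg, φ, hφ, h1, h2⟩ := h
  have t1 := L2Tendsto.integral_mul (fun n => (hφ n).memLp) hu
    (fun _ => hψ.memLp_laplacian) hψ.memLp_laplacian h1 (l2Tendsto_const _)
  have t2 := L2Tendsto.integral_inner (fun n => (hφ n).memLp_gradient) hg
    (fun _ => hψ.memLp_gradient) hψ.memLp_gradient h2 (l2Tendsto_const _)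
  refine tendsto_nhds_unique t1 (t2.neg.congr fun n => ?_)
  exact (MPQD.integral_mul_laplacian (hφ n).contDiff_one hψ.contDiff_two (Or.inl (hφ n).2.1)).symm

lemma MemW012.laplacian_mollify {U : Set Plane} {u : Plane → ℝ} {g : Plane → Plane}
    (h : MemW012 U u g) (n : ℕ) (x : Plane) :
    Laplacian.laplacian (mollify n u) x =
      -∫ t, inner ℝ (g t) (gradient (fun t => mollifier n (x - t)) t) := by
  rw [mollify, laplacian_conv h.locallyIntegrable (contDiff_mollifier n)
    (hasCompactSupport_mollifier n),
    ← h.integral_mul_laplacian (isTestFunction_mollifier (n := n) (x := x) (Set.subset_univ _))]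
  unfold conv
  congr 1
  funext t
  rw [laplacian_comp_const_sub ((contDiff_mollifier n).of_le two_le_infty)]

/-! ### The Lipschitz representative of the solution -/

lemma forall_of_ae_of_isClosed {p : Plane → Prop} (hp : IsClosed {x | p x})
    (h : ∀ᵐ x, p x) (x : Plane) : p x := by
  have h1 : IsOpen {x | ¬p x} := hp.isOpen_compl
  have h2 : {x | ¬p x} = ∅ := (h1.measure_eq_zero_iff volume).1 (ae_iff.1 h)
  by_contra hx
  have : x ∈ {x | ¬p x} := hx
  simp [h2] at this

/-- A continuous solution of the obstacle problem. -/
structure IsLipschitzSolution (j T : ℝ) (u : Plane → ℝ) (g : Plane → Plane) : Prop where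
  lipschitz : ∃ L, LipschitzWith L u
  mem : MemW012 (cap (6 * T)) u g
  symm : ∀ x, u (axisReflection x) = u x
  nonneg : ∀ x, 0 ≤ u x
  le_side : ∀ x, x ∈ cone 0 → ∀ i, u x ≤ 9 * j * side i x
  eq_zero : ∀ x, x ∉ cone 0 → u x = 0
  eq_zero_of_le : ∀ x, T ≤ axial x → u x = 0
  subsolution_le : ∀ x, x ∈ cap (6 * T) → subsolution x ≤ u x
  upper : ∀ ψ, IsTestFunction (cap (6 * T)) ψ → (∀ x, 0 ≤ ψ x) →
    ∫ x, inner ℝ (g x) (gradient ψ x) ≤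
      ∫ x, (load j x - {x | 0 < u x}.indicator (fun _ => 1) x) * ψ x
  lower : ∀ ψ, IsTestFunction (cap (6 * T)) ψ → (∀ x, 0 ≤ ψ x) →
    ∫ x, (load j x - 1) * ψ x ≤ ∫ x, inner ℝ (g x) (gradient ψ x)

section

variable {j T : ℝ} {u : Plane → ℝ} {g : Plane → Plane}

lemma mul_mollifier_bounds {j : ℝ} (hj : 0 ≤ j) {e a : Plane → ℝ} (ha0 : ∀ x, 0 ≤ a x) (ha1 : ∀ x, a x ≤ 1) (n : ℕ) (x : Plane) (he : e = fun t => load j t - a t) :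
    |∫ t, e t * mollifier n (x - t)| ≤ j + 1 := by
  subst he
  have hb : ∀ t, |load j t - a t| ≤ j + 1 := fun t => by
    rw [abs_le]
    constructor <;> linarith [load_nonneg hj t, load_le hj t, ha0 t, ha1 t]
  have hi := (integrable_mollifier_sub n x).const_mul (j + 1)
  calc |∫ t, (load j t - a t) * mollifier n (x - t)|
      ≤ ∫ t, (j + 1) * mollifier n (x - t) := by
        refine norm_integral_le_of_norm_le (f := fun t => (load j t - a t) * mollifier n (x - t)) hi
          (.of_forall fun t => ?_)
        rw [Real.norm_eq_abs, abs_mul, abs_of_nonneg (mollifier_nonneg n _)]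
        exact mul_le_mul_of_nonneg_right (hb t) (mollifier_nonneg n _)
    _ = j + 1 := by rw [integral_const_mul, integral_mollifier_sub, mul_one]

lemma IsCapSolution.abs_laplacian_mollify_le (h : IsCapSolution j T u g) (hj : 0 ≤ j)
    {n : ℕ} {x : Plane} (hx : Metric.closedBall x (radius n) ⊆ cap (6 * T)) :
    |Laplacian.laplacian (mollify n u) x| ≤ j + 1 := by
  have ht := isTestFunction_mollifier hx
  have h1 := h.upper _ ht fun _ => mollifier_nonneg n _
  have h2 := h.lower _ ht fun _ => mollifier_nonneg n _
  have h3 := mul_mollifier_bounds hj (a := {x | 0 < u x}.indicator (fun _ => 1))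
    (Set.indicator_nonneg fun _ _ => zero_le_one)
    (fun x => Set.indicator_le_self' (f := fun _ => (1 : ℝ)) (fun _ _ => zero_le_one) x) n x rfl
  have h4 := mul_mollifier_bounds hj (a := fun _ => 1)
    (fun _ => zero_le_one) (fun x => le_rfl) n x rfl
  rw [abs_le] at h3 h4
  rw [h.mem.laplacian_mollify, abs_le]
  constructor <;> linarith

lemma ball_subset_cap (hT : 2 ≤ T) {x : Plane} {d : ℝ} (hx : ∀ i, d ≤ side i x) (hd : 0 < d)
    (hxT : axial x < T + 1) : Metric.ball x d ⊆ cap (6 * T) := by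
  intro y hy
  rw [Metric.mem_ball] at hy
  refine ⟨mem_cone_zero.2 fun i => ?_, ?_⟩
  · have := (abs_le.1 (abs_side_sub_le i y x)).1
    linarith [hx i]
  · have h1 := norm_le_two_mul_axial fun i => hd.le.trans (hx i)
    have h2 : side 0 x ≤ ‖x‖ := by simpa [side] using (le_abs_self _).trans (abs_side_sub_le 0 x 0)
    have h3 : ‖y‖ ≤ ‖x‖ + dist y x := by
      rw [dist_eq_norm]
      simpa using norm_add_le x (y - x)
    rw [mem_ball_zero_iff]
    linarith [hx 0]

lemma IsCapSolution.ae_of_notMem_cone (h : IsCapSolution j T u g) :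
    ∀ᵐ x, x ∉ cone 0 → u x = 0 := by
  filter_upwards [h.mem.ae_eq_zero (isOpen_cap _).measurableSet] with x hx hxC
  exact hx fun h => hxC h.1

lemma IsCapSolution.ae_le_side (h : IsCapSolution j T u g) (hj : 0 ≤ j) :
    ∀ᵐ x, x ∈ cone 0 → ∀ i, u x ≤ 9 * j * side i x := by
  filter_upwards [h.mem.ae_eq_zero (isOpen_cap _).measurableSet, h.le_side] with x h1 h2 hx i
  by_cases hxc : x ∈ cap (6 * T)
  · exact h2 hxc i
  · rw [h1 hxc]
    have := mem_cone_zero.1 hx i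
    positivity

lemma IsCapSolution.exists_gradient_mollify_bound (h : IsCapSolution j T u g) (hj : 0 ≤ j)
    (hT : 2 ≤ T) : ∃ L : ℝ, 9 * j ≤ L ∧ ∀ (n : ℕ) (x : Plane), (∀ i, 2 * radius n < side i x) →
      radius n ≤ 1 / 2 → ‖gradient (mollify n u) x‖ ≤ L := by
  obtain ⟨C, hC, hgrad⟩ := exists_gradient_bound
  have hloc := h.mem.locallyIntegrable
  have hL : 0 ≤ C * (27 * j + (j + 1) * (2 * T)) := by positivity
  refine ⟨9 * j + C * (27 * j + (j + 1) * (2 * T)), by linarith, fun n x hx hn => ?_⟩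
  have hr := radius_pos n
  by_cases hxT : axial x < T + 1
  swap
  · have h0 : mollify n u =ᶠ[𝓝 x] fun _ => 0 := by
      filter_upwards [Metric.ball_mem_nhds x (half_pos one_pos)] with y hy
      have hz : ∀ᵐ t, t ∈ Metric.ball y (radius n) → u t = 0 := by
        filter_upwards [h.eq_zero] with t ht hty
        rw [Metric.mem_ball] at hy hty
        refine ht ?_
        have h1 := (abs_le.1 (abs_axial_sub_le t y)).1
        have h2 := (abs_le.1 (abs_axial_sub_le y x)).1
        linarith
      exact le_antisymm (mollify_le hloc (by filter_upwards [hz] with t ht hty using (ht hty).le))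
        (le_mollify hloc (by filter_upwards [hz] with t ht hty using (ht hty).ge))
    rw [norm_gradient, h0.fderiv_eq]
    simp only [fderiv_fun_const, Pi.zero_apply, norm_zero]
    linarith
  obtain ⟨d, hdx, i₀, hi₀⟩ : ∃ d, (∀ i, d ≤ side i x) ∧ ∃ i, d = side i x :=
    ⟨min (side 0 x) (side 1 x), Fin.forall_fin_two.2 ⟨min_le_left _ _, min_le_right _ _⟩, by
      rcases min_choice (side 0 x) (side 1 x) with h | h
      · exact ⟨0, h⟩
      · exact ⟨1, h⟩⟩
  have hdr : 2 * radius n < d := hi₀ ▸ hx i₀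
  have hd : 0 < d := by linarith
  have hsub := ball_subset_cap hT hdx hd hxT
  have hg := hgrad (mollify n u) (contDiff_mollify hloc) x (d / 2) (j + 1) (by positivity)
    (fun y _ => le_mollify hloc (by filter_upwards [h.nonneg] with t ht _ using ht))
    (fun y hy => h.abs_laplacian_mollify_le hj fun z hz => hsub (by
      rw [Metric.mem_ball] at hy ⊢
      rw [Metric.mem_closedBall] at hz
      linarith [dist_triangle z y x]))
  have hux : mollify n u x ≤ 9 * j * (d + radius n) := by
    refine mollify_le hloc ?_
    filter_upwards [h.le_side] with t ht htx
    rw [Metric.mem_ball] at htx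
    refine (ht (hsub (by rw [Metric.mem_ball]; linarith)) i₀).trans ?_
    have := (abs_le.1 (abs_side_sub_le i₀ t x)).2
    exact mul_le_mul_of_nonneg_left (by linarith) (by positivity)
  have hdT : d ≤ 4 * T := by
    have h1 := norm_le_two_mul_axial fun i => hd.le.trans (hdx i)
    have h2 : side 0 x ≤ ‖x‖ := by simpa [side] using (le_abs_self _).trans (abs_side_sub_le 0 x 0)
    linarith [hdx 0]
  have h1 : mollify n u x / (d / 2) ≤ 27 * j := by
    rw [div_le_iff₀ (by positivity)]
    nlinarith
  have h2 : (j + 1) * (d / 2) ≤ (j + 1) * (2 * T) := by gcongr; linarith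
  have h3 : C * (mollify n u x / (d / 2) + (j + 1) * (d / 2)) ≤
      C * (27 * j + (j + 1) * (2 * T)) := by gcongr
  linarith

lemma convex_le_side (m : ℝ) : Convex ℝ {x | ∀ i, m ≤ side i x} := by
  have : {x | ∀ i, m ≤ side i x} = ⋂ i, {x | m ≤ side i x} := by
    ext x
    simp
  rw [this]
  exact convex_iInter fun i =>
    convex_halfSpace_ge (innerSL ℝ (normal i)).toLinearMap.isLinear m

theorem exists_isLipschitzSolution : ∃ j₀ : ℝ, 0 < j₀ ∧ ∀ j, j₀ ≤ j →
    ∃ T u g, 2 ≤ T ∧ IsLipschitzSolution j T u g := by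
  obtain ⟨j₀, hj₀, H⟩ := exists_isCapSolution
  refine ⟨j₀, hj₀, fun j hj => ?_⟩
  obtain ⟨T, u, g, hT, h⟩ := H j hj
  have hj0 : 0 ≤ j := hj₀.le.trans hj
  obtain ⟨L, hL9, hL⟩ := h.exists_gradient_mollify_bound hj0 hT
  have hL0 : 0 ≤ L := by linarith
  have hloc := h.mem.locallyIntegrable
  set G : Set Plane := {x | Tendsto (fun n => mollify n u x) atTop (𝓝 (u x)) ∧ 0 ≤ u x ∧
    (x ∈ cone 0 → ∀ i, u x ≤ 9 * j * side i x) ∧ (x ∉ cone 0 → u x = 0)} with hG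
  have hGae : ∀ᵐ x, x ∈ G := by
    filter_upwards [tendsto_mollify_ae hloc, h.nonneg, h.ae_le_side hj0, h.ae_of_notMem_cone]
      with x h1 h2 h3 h4 using ⟨h1, h2, h3, h4⟩
  have key : ∀ x ∈ G, ∀ y ∈ G, x ∈ cone 0 → u x - u y ≤ L * dist x y := by
    intro x hx y hy hxC
    have hxs := mem_cone_zero.1 hxC
    by_cases hyC : y ∈ cone 0
    · have hys := mem_cone_zero.1 hyC
      obtain ⟨m, hm, hmx, hmy⟩ : ∃ m, 0 < m ∧ (∀ i, m ≤ side i x) ∧ ∀ i, m ≤ side i y := by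
        refine ⟨min (min (side 0 x) (side 1 x)) (min (side 0 y) (side 1 y)),
          lt_min (lt_min (hxs 0) (hxs 1)) (lt_min (hys 0) (hys 1)), ?_, ?_⟩
        · exact Fin.forall_fin_two.2 ⟨(min_le_left _ _).trans (min_le_left _ _),
            (min_le_left _ _).trans (min_le_right _ _)⟩
        · exact Fin.forall_fin_two.2 ⟨(min_le_right _ _).trans (min_le_left _ _),
            (min_le_right _ _).trans (min_le_right _ _)⟩
      have hev : ∀ᶠ n in atTop, mollify n u x - mollify n u y ≤ L * dist x y := by
        filter_upwards [tendsto_radius.eventually_lt_const (show (0 : ℝ) < m / 2 by linarith),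
          tendsto_radius.eventually_lt_const (show (0 : ℝ) < 1 / 2 by norm_num)] with n h1 h2
        have := Convex.norm_image_sub_le_of_norm_fderiv_le (𝕜 := ℝ) (f := mollify n u) (C := L)
          (fun z _ => (contDiff_mollify hloc).differentiable (by simp) z)
          (fun z hz => by
            rw [← norm_gradient]
            exact hL n z (fun i => by linarith [hz i]) h2.le) (convex_le_side m) hmy hmx
        rw [dist_eq_norm]
        exact (le_abs_self _).trans this
      exact le_of_tendsto (hx.1.sub hy.1) hev
    · rw [hy.2.2.2 hyC, sub_zero]
      rw [mem_cone_zero, not_forall] at hyC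
      obtain ⟨i, hi⟩ := hyC
      have h1 := (abs_le.1 (abs_side_sub_le i x y)).2
      calc u x ≤ 9 * j * side i x := hx.2.2.1 hxC i
        _ ≤ L * side i x := mul_le_mul_of_nonneg_right hL9 (hxs i).le
        _ ≤ L * dist x y := mul_le_mul_of_nonneg_left (by linarith) hL0
  have hlip : LipschitzOnWith L.toNNReal u G := by
    refine LipschitzOnWith.of_le_add_mul _ fun x hx y hy => ?_
    rw [Real.coe_toNNReal L hL0]
    by_cases hxC : x ∈ cone 0
    · linarith [key x hx y hy hxC]
    · rw [hx.2.2.2 hxC]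
      have := hy.2.1
      positivity
  obtain ⟨v, hv, huv⟩ := hlip.extend_real
  have hae : u =ᵐ[volume] v := by filter_upwards [hGae] with x hx using huv hx
  have hvc := hv.continuous
  have hind : ∀ᵐ x, {x | 0 < u x}.indicator (fun _ => (1 : ℝ)) x =
      {x | 0 < v x}.indicator (fun _ => 1) x := by
    filter_upwards [hae] with x hx
    simp only [Set.indicator_apply, Set.mem_ofPred_eq, hx]
  have hv0 : ∀ x, 0 ≤ v x := by
    refine forall_of_ae_of_isClosed (isClosed_le continuous_const hvc) ?_
    filter_upwards [hae, h.nonneg] with x h1 h2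
    rwa [← h1]
  have hvle : ∀ x, x ∈ cone 0 → ∀ i, v x ≤ 9 * j * side i x := by
    intro x hx i
    refine forall_of_ae_of_isClosed (p := fun x => x ∈ cone 0 → v x ≤ 9 * j * side i x) ?_ ?_ x hx
    · have : {x | x ∈ cone 0 → v x ≤ 9 * j * side i x}ᶜ =
          cone 0 ∩ {x | 9 * j * side i x < v x} := by
        ext x
        simp
      rw [← isOpen_compl_iff, this]
      exact isOpen_cone_zero.inter
        (isOpen_lt (continuous_const.mul (continuous_side i)) hvc)
    · filter_upwards [hae, h.ae_le_side hj0] with x h1 h2 hx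
      rw [← h1]
      exact h2 hx i
  refine ⟨T, v, g, hT, ⟨_, hv⟩, h.mem.congr hae, ?_, hv0, hvle, ?_, ?_, ?_, ?_, h.lower⟩
  · refine forall_of_ae_of_isClosed
      (isClosed_eq (hvc.comp axisReflection.continuous) hvc) ?_
    have h2 : ∀ᵐ x, u (axisReflection x) = v (axisReflection x) :=
      axisReflection.measurePreserving.quasiMeasurePreserving.ae hae
    filter_upwards [h.symm, hae, h2] with x h1 h2 h3
    exact h3.symm.trans (h1.trans h2)
  · intro x hx
    rw [mem_cone_zero, not_forall] at hx
    obtain ⟨i, hi⟩ := hx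
    rw [not_lt] at hi
    refine le_antisymm ?_ (hv0 x)
    have : v x ≤ 9 * j * max (side i x) 0 := by
      refine forall_of_ae_of_isClosed (p := fun x => v x ≤ 9 * j * max (side i x) 0)
        (isClosed_le hvc (continuous_const.mul ((continuous_side i).max continuous_const))) ?_ x
      filter_upwards [hae, h.ae_of_notMem_cone] with y h1 h2
      by_cases hy : y ∈ cone 0
      · refine (hvle y hy i).trans ?_
        gcongr
        exact le_max_left _ _
      · rw [← h1, h2 hy]
        positivity
    rwa [max_eq_right hi, mul_zero] at this
  · intro x hx
    refine le_antisymm ?_ (hv0 x)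
    have hcont : Tendsto (fun s : ℝ => v (x + s • center 0)) (𝓝[>] 0) (𝓝 (v x)) := by
      have : Continuous fun s : ℝ => v (x + s • center 0) := by fun_prop
      have h1 := this.tendsto 0
      rw [zero_smul, add_zero] at h1
      exact h1.mono_left nhdsWithin_le_nhds
    refine le_of_tendsto hcont ?_
    filter_upwards [self_mem_nhdsWithin] with s hs
    refine forall_of_ae_of_isClosed (p := fun y => T < axial y → v y ≤ 0) ?_ ?_ _ ?_
    · have : {y | T < axial y → v y ≤ 0}ᶜ = {y | T < axial y} ∩ {y | 0 < v y} := by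
        ext y
        simp
      rw [← isOpen_compl_iff, this]
      exact (isOpen_lt continuous_const continuous_axial).inter (isOpen_lt continuous_const hvc)
    · filter_upwards [hae, h.eq_zero] with y h1 h2 hy
      rw [← h1, h2 hy.le]
    · have : axial (x + s • center 0) = axial x + s := by
        rw [axial, inner_add_right, inner_smul_right, real_inner_self_eq_norm_sq, norm_center_zero]
        simp [axial]
      rw [this]
      have hs' : (0 : ℝ) < s := hs
      linarith
  · intro x hx
    refine forall_of_ae_of_isClosed (p := fun x => x ∈ cap (6 * T) → subsolution x ≤ v x) ?_ ?_ x hx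
    · have : {x | x ∈ cap (6 * T) → subsolution x ≤ v x}ᶜ =
          cap (6 * T) ∩ {x | v x < subsolution x} := by
        ext x
        simp
      rw [← isOpen_compl_iff, this]
      exact (isOpen_cap _).inter (isOpen_lt hvc (contDiff_subsolution.continuous))
    · filter_upwards [hae, h.subsolution_le] with x h1 h2 hx
      rw [← h1]
      exact h2 hx
  · intro ψ hψ hψ0
    refine (h.upper ψ hψ hψ0).trans_eq (integral_congr_ae ?_)
    filter_upwards [hind] with x hx
    rw [hx]

end

/-! ### Cutoff functions -/

/-- Green's second identity for a function which is only defined on an open set. -/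
lemma integral_mul_laplacian_comm_of_contDiffOn {Ω : Set Plane} (hΩ : IsOpen Ω)
    {H w : Plane → ℝ} (hH : ContDiffOn ℝ 2 H Ω) (hw : IsTestFunction Ω w) :
    ∫ x, H x * Laplacian.laplacian w x = ∫ x, w x * Laplacian.laplacian H x := by
  obtain ⟨χ, hχ0, hχ1, -⟩ := exists_contMDiffMap_zero_one_nhds_of_isClosed
    (modelWithCornersSelf ℝ Plane) (n := ⊤) hΩ.isClosed_compl (isClosed_tsupport w)
    (Set.disjoint_left.2 fun x hx hxw => hx (hw.2.2 hxw))
  have hχ : ContDiff ℝ 2 χ := χ.contMDiff.contDiff.of_le two_le_infty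
  have hHχ : ContDiff ℝ 2 fun x => χ x * H x := by
    rw [contDiff_iff_contDiffAt]
    intro x
    by_cases hx : x ∈ Ω
    · exact hχ.contDiffAt.mul (hH.contDiffAt (hΩ.mem_nhds hx))
    · have : (fun x => χ x * H x) =ᶠ[𝓝 x] fun _ => 0 := by
        filter_upwards [eventually_nhdsSet_iff_forall.1 hχ0 x hx] with y hy
        rw [hy, zero_mul]
      exact contDiffAt_const.congr_of_eventuallyEq this
  have h := integral_mul_laplacian_comm hHχ hw.contDiff_two (Or.inr hw.2.1)
  have heq : ∀ x ∈ tsupport w, (fun x => χ x * H x) =ᶠ[𝓝 x] H := fun x hx => by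
    filter_upwards [eventually_nhdsSet_iff_forall.1 hχ1 x hx] with y hy
    rw [hy, one_mul]
  have h1 : ∀ x, χ x * H x * Laplacian.laplacian w x = H x * Laplacian.laplacian w x := fun x => by
    by_cases hx : x ∈ tsupport w
    · rw [(heq x hx).eq_of_nhds]
    · have : Laplacian.laplacian w x = 0 :=
        image_eq_zero_of_notMem_tsupport fun h => hx (tsupport_laplacian_subset w h)
      simp [this]
  have h2 : ∀ x, w x * Laplacian.laplacian (fun x => χ x * H x) x =
      w x * Laplacian.laplacian H x := fun x => by
    by_cases hx : x ∈ tsupport w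
    · rw [(InnerProductSpace.laplacian_congr_nhds (heq x hx)).eq_of_nhds]
    · simp [image_eq_zero_of_notMem_tsupport hx]
  simpa only [h1, h2] using h

/-- A smooth approximation of the positive part. -/
noncomputable def lift (m : ℕ) (t : ℝ) : ℝ :=
  t * Real.smoothTransition (2 + Real.log t / (m + 1))

lemma lift_zero (m : ℕ) : lift m 0 = 0 := by simp [lift]

lemma abs_lift_le (m : ℕ) (t : ℝ) : |lift m t| ≤ |t| := by
  rw [lift, abs_mul, abs_of_nonneg (Real.smoothTransition.nonneg _)]
  exact mul_le_of_le_one_right (abs_nonneg t) (Real.smoothTransition.le_one _)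

lemma lift_eventuallyEq_zero (m : ℕ) {t : ℝ} (ht : |t| < Real.exp (-(2 * (m + 1)))) :
    lift m =ᶠ[𝓝 t] fun _ => 0 := by
  filter_upwards [(continuous_abs.tendsto t).eventually_lt_const ht] with s hs
  rcases eq_or_ne s 0 with rfl | hs0
  · exact lift_zero m
  · have h1 : Real.log s < -(2 * (m + 1)) := by
      rw [← Real.log_abs]
      exact (Real.log_lt_iff_lt_exp (abs_pos.2 hs0)).2 hs
    rw [lift, Real.smoothTransition.zero_of_nonpos, mul_zero]
    have : Real.log s / (m + 1) ≤ -2 := by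
      rw [div_le_iff₀ (by positivity)]
      linarith
    linarith

lemma lift_eventuallyEq_id (m : ℕ) {t : ℝ} (ht : Real.exp (-(m + 1)) < t) :
    lift m =ᶠ[𝓝 t] id := by
  filter_upwards [lt_mem_nhds ht] with s hs
  have hs0 : 0 < s := (Real.exp_pos _).trans hs
  have h1 : -(m + 1) < Real.log s := (Real.lt_log_iff_exp_lt hs0).2 hs
  rw [lift, Real.smoothTransition.one_of_one_le, mul_one, id]
  have : -1 ≤ Real.log s / (m + 1) := by
    rw [le_div_iff₀ (by positivity)]
    linarith
  linarith

lemma contDiff_lift (m : ℕ) : ContDiff ℝ ∞ (lift m) := by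
  rw [contDiff_iff_contDiffAt]
  intro t
  by_cases ht : t = 0
  · exact contDiffAt_const.congr_of_eventuallyEq
      (lift_eventuallyEq_zero m (by rw [ht, abs_zero]; exact Real.exp_pos _))
  · exact contDiffAt_id.mul (Real.smoothTransition.contDiffAt.comp t
      (contDiffAt_const.add ((Real.contDiffAt_log.2 ht).div_const _)))

lemma deriv_lift (m : ℕ) {t : ℝ} (ht : t ≠ 0) :
    deriv (lift m) t = Real.smoothTransition (2 + Real.log t / (m + 1)) +
      deriv Real.smoothTransition (2 + Real.log t / (m + 1)) / (m + 1) := by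
  have h1 : HasDerivAt (fun t => 2 + Real.log t / ((m : ℝ) + 1)) (t⁻¹ / (m + 1)) t :=
    ((Real.hasDerivAt_log ht).div_const _).const_add 2
  have h2 := ((Real.smoothTransition.contDiffAt (n := 1)).differentiableAt
    (x := 2 + Real.log t / ((m : ℝ) + 1)) (by simp)).hasDerivAt.comp t h1
  have h3 := (hasDerivAt_id t).fun_mul h2
  have : deriv (lift m) t = _ := h3.deriv
  rw [this]
  simp only [Function.comp_apply, id]
  field_simp

lemma deriv_deriv_lift (m : ℕ) {t : ℝ} (ht : t ≠ 0) :
    t * deriv (deriv (lift m)) t =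
      deriv Real.smoothTransition (2 + Real.log t / (m + 1)) / (m + 1) +
      deriv (deriv Real.smoothTransition) (2 + Real.log t / (m + 1)) / (m + 1) ^ 2 := by
  have heq : deriv (lift m) =ᶠ[𝓝 t] fun t => Real.smoothTransition (2 + Real.log t / (m + 1)) +
      deriv Real.smoothTransition (2 + Real.log t / (m + 1)) / (m + 1) := by
    filter_upwards [isOpen_ne.mem_nhds ht] with s hs using deriv_lift m hs
  have h1 : HasDerivAt (fun t => 2 + Real.log t / ((m : ℝ) + 1)) (t⁻¹ / (m + 1)) t :=
    ((Real.hasDerivAt_log ht).div_const _).const_add 2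
  have h2 := ((Real.smoothTransition.contDiffAt (n := 1)).differentiableAt
    (x := 2 + Real.log t / ((m : ℝ) + 1)) (by simp)).hasDerivAt.comp t h1
  have h3 := ((contDiff_deriv_smoothTransition.differentiable (by simp))
    (2 + Real.log t / ((m : ℝ) + 1))).hasDerivAt.comp t h1
  have h4 : deriv (fun t => Real.smoothTransition (2 + Real.log t / (m + 1)) +
      deriv Real.smoothTransition (2 + Real.log t / (m + 1)) / (m + 1)) t = _ :=
    (h2.add (h3.div_const ((m : ℝ) + 1))).deriv
  rw [heq.deriv_eq, h4]
  field_simp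

section Bounds

variable {K : ℝ} (hK1 : 1 ≤ K) (hK : ∀ t, |deriv Real.smoothTransition t| ≤ K)
  (hK' : ∀ t, |deriv (deriv Real.smoothTransition) t| ≤ K)

lemma deriv_lift_zero (m : ℕ) : deriv (lift m) 0 = 0 := by
  rw [(lift_eventuallyEq_zero m (by rw [abs_zero]; exact Real.exp_pos _)).deriv_eq, deriv_const]

include hK1 hK in
lemma abs_deriv_lift_le (m : ℕ) (t : ℝ) : |deriv (lift m) t| ≤ 2 * K := by
  rcases eq_or_ne t 0 with rfl | ht
  · rw [deriv_lift_zero, abs_zero]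
    linarith
  · rw [deriv_lift m ht]
    have h1 := Real.smoothTransition.nonneg (2 + Real.log t / ((m : ℝ) + 1))
    have h2 := Real.smoothTransition.le_one (2 + Real.log t / ((m : ℝ) + 1))
    have h3 : |deriv Real.smoothTransition (2 + Real.log t / (m + 1)) / ((m : ℝ) + 1)| ≤ K := by
      rw [abs_div, abs_of_pos (show (0 : ℝ) < m + 1 by positivity)]
      exact (div_le_self (abs_nonneg _) (by linarith [(m.cast_nonneg : (0 : ℝ) ≤ m)])).trans (hK _)
    refine (abs_add_le _ _).trans ?_
    rw [abs_of_nonneg h1]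
    linarith

include hK hK' in
lemma abs_mul_deriv_deriv_lift_le (m : ℕ) (t : ℝ) :
    |t * deriv (deriv (lift m)) t| ≤ 2 * K / (m + 1) := by
  have hm : (0 : ℝ) < m + 1 := by positivity
  have hK0 : 0 ≤ K := (abs_nonneg _).trans (hK 0)
  rcases eq_or_ne t 0 with rfl | ht
  · rw [zero_mul, abs_zero]
    positivity
  · rw [deriv_deriv_lift m ht]
    refine (abs_add_le _ _).trans ?_
    rw [abs_div, abs_div, abs_of_pos hm, abs_of_pos (pow_pos hm 2)]
    have h1 : |deriv Real.smoothTransition (2 + Real.log t / (m + 1))| / ((m : ℝ) + 1) ≤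
        K / (m + 1) := by gcongr; exact hK _
    have h2 : |deriv (deriv Real.smoothTransition) (2 + Real.log t / (m + 1))| /
        ((m : ℝ) + 1) ^ 2 ≤ K / (m + 1) := by
      have : ((m : ℝ) + 1) ≤ (m + 1) ^ 2 := by
        nlinarith [(m.cast_nonneg : (0 : ℝ) ≤ m)]
      gcongr
      exact hK' _
    have h3 : 2 * K / ((m : ℝ) + 1) = K / (m + 1) + K / (m + 1) := by ring
    linarith

end Bounds

lemma tendsto_lift {t : ℝ} (ht : 0 < t) : ∀ᶠ m in atTop, lift m =ᶠ[𝓝 t] id := by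
  have h1 : Tendsto (fun m : ℕ => Real.exp (-((m : ℝ) + 1))) atTop (𝓝 0) :=
    Real.tendsto_exp_neg_atTop_nhds_zero.comp
      (tendsto_atTop_add_const_right _ _ tendsto_natCast_atTop_atTop)
  filter_upwards [h1.eventually_lt_const ht] with m hm using lift_eventuallyEq_id m hm

/-- A cutoff function in the variable `side i`. -/
noncomputable def sideCutoff (δ : ℝ) (i : Fin 2) (x : Plane) : ℝ :=
  Real.smoothTransition (side i x / δ - 1)

/-- A function cutting off a neighbourhood of the boundary of `cone 0`. -/
noncomputable def coneCutoff (δ : ℝ) (x : Plane) : ℝ := sideCutoff δ 0 x * sideCutoff δ 1 x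

section ConeCutoff

variable {δ : ℝ}

lemma contDiff_sideCutoff (δ : ℝ) (i : Fin 2) : ContDiff ℝ ∞ (sideCutoff δ i) :=
  Real.smoothTransition.contDiff.comp (((contDiff_side i).div_const δ).sub contDiff_const)

lemma contDiff_coneCutoff (δ : ℝ) : ContDiff ℝ ∞ (coneCutoff δ) :=
  (contDiff_sideCutoff δ 0).mul (contDiff_sideCutoff δ 1)

lemma sideCutoff_nonneg (i : Fin 2) (x : Plane) : 0 ≤ sideCutoff δ i x :=
  Real.smoothTransition.nonneg _

lemma sideCutoff_le_one (i : Fin 2) (x : Plane) : sideCutoff δ i x ≤ 1 :=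
  Real.smoothTransition.le_one _

lemma sideCutoff_eq_zero (hδ : 0 < δ) {i : Fin 2} {x : Plane} (hx : side i x ≤ δ) :
    sideCutoff δ i x = 0 :=
  Real.smoothTransition.zero_of_nonpos (by rw [sub_nonpos]; exact div_le_one_of_le₀ hx hδ.le)

lemma sideCutoff_eq_one (hδ : 0 < δ) {i : Fin 2} {x : Plane} (hx : 2 * δ ≤ side i x) :
    sideCutoff δ i x = 1 :=
  Real.smoothTransition.one_of_one_le (by
    have : 2 ≤ side i x / δ := by rwa [le_div_iff₀ hδ]
    linarith)

lemma coneCutoff_nonneg (x : Plane) : 0 ≤ coneCutoff δ x :=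
  mul_nonneg (sideCutoff_nonneg 0 x) (sideCutoff_nonneg 1 x)

lemma coneCutoff_le_one (x : Plane) : coneCutoff δ x ≤ 1 :=
  mul_le_one₀ (sideCutoff_le_one 0 x) (sideCutoff_nonneg 1 x) (sideCutoff_le_one 1 x)

lemma coneCutoff_eq_zero (hδ : 0 < δ) {i : Fin 2} {x : Plane} (hx : side i x ≤ δ) :
    coneCutoff δ x = 0 := by
  rw [coneCutoff]
  fin_cases i
  · rw [sideCutoff_eq_zero (i := 0) hδ hx, zero_mul]
  · rw [sideCutoff_eq_zero (i := 1) hδ hx, mul_zero]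

lemma coneCutoff_eq_one (hδ : 0 < δ) {x : Plane} (hx : ∀ i, 2 * δ ≤ side i x) :
    coneCutoff δ x = 1 := by
  rw [coneCutoff, sideCutoff_eq_one hδ (hx 0), sideCutoff_eq_one hδ (hx 1), one_mul]

lemma coneCutoff_eventuallyEq_one (hδ : 0 < δ) {x : Plane} (hx : ∀ i, 2 * δ < side i x) :
    coneCutoff δ =ᶠ[𝓝 x] fun _ => 1 := by
  have h : ∀ i : Fin 2, ∀ᶠ y in 𝓝 x, 2 * δ < side i y := fun i =>
    ((continuous_side i).tendsto x).eventually_const_lt (hx i)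
  filter_upwards [h 0, h 1] with y h0 h1
  exact coneCutoff_eq_one hδ (Fin.forall_fin_two.2 ⟨h0.le, h1.le⟩)

lemma gradient_sideCutoff (i : Fin 2) (x : Plane) : gradient (sideCutoff δ i) x =
    (deriv Real.smoothTransition (side i x / δ - 1) / δ) • normal i := by
  ext k
  have h0 : HasDerivAt (fun t : ℝ => t / δ - 1) (1 / δ) (side i x) :=
    ((hasDerivAt_id _).div_const δ).sub_const 1
  have h1 := ((Real.smoothTransition.contDiffAt (n := 1)).differentiableAt
    (x := side i x / δ - 1) (by simp)).hasDerivAt.comp (side i x) h0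
  have h2 := pd_comp (F := fun t => Real.smoothTransition (t / δ - 1)) (f := side i)
    h1.differentiableAt ((contDiff_side (n := 1) i).differentiable (by simp) x) k
  rw [gradient_apply]
  refine h2.trans ?_
  have h3 : deriv (fun t => Real.smoothTransition (t / δ - 1)) (side i x) = _ := h1.deriv
  have h4 : pd k (side i) x = normal i k := pd_inner _ _ _
  rw [h3, h4]
  simp
  left
  ring

lemma laplacian_sideCutoff (i : Fin 2) (x : Plane) : Laplacian.laplacian (sideCutoff δ i) x =
    deriv (deriv Real.smoothTransition) (side i x / δ - 1) / δ ^ 2 := by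
  have h0 : ∀ t : ℝ, HasDerivAt (fun t : ℝ => t / δ - 1) (1 / δ) t := fun t =>
    ((hasDerivAt_id _).div_const δ).sub_const 1
  have h1 : deriv (fun t => Real.smoothTransition (t / δ - 1)) =
      fun t => deriv Real.smoothTransition (t / δ - 1) * (1 / δ) := by
    funext t
    exact (((Real.smoothTransition.contDiffAt (n := 1)).differentiableAt
      (x := t / δ - 1) (by simp)).hasDerivAt.comp t (h0 t)).deriv
  have h2 : deriv (fun t => deriv Real.smoothTransition (t / δ - 1) * (1 / δ)) (side i x) =
      deriv (deriv Real.smoothTransition) (side i x / δ - 1) * (1 / δ) * (1 / δ) :=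
    ((((contDiff_deriv_smoothTransition.differentiable (by simp))
      (side i x / δ - 1)).hasDerivAt.comp (side i x) (h0 _)).mul_const (1 / δ)).deriv
  have h3 := laplacian_comp_inner (F := fun t => Real.smoothTransition (t / δ - 1))
    (Real.smoothTransition.contDiff.comp ((contDiff_id.div_const δ).sub contDiff_const))
    (norm_normal i) x
  refine h3.trans ?_
  change deriv (deriv _) (side i x) = _
  rw [h1, h2]
  ring

variable {K : ℝ} (hK1 : 1 ≤ K) (hK : ∀ t, |deriv Real.smoothTransition t| ≤ K)
  (hK' : ∀ t, |deriv (deriv Real.smoothTransition) t| ≤ K)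

include hK in
lemma norm_gradient_sideCutoff_le (hδ : 0 < δ) (i : Fin 2) (x : Plane) :
    ‖gradient (sideCutoff δ i) x‖ ≤ K / δ := by
  rw [gradient_sideCutoff, norm_smul, norm_normal, mul_one, norm_div, Real.norm_eq_abs,
    Real.norm_of_nonneg hδ.le]
  gcongr
  exact hK _

include hK in
lemma norm_gradient_coneCutoff_le (hδ : 0 < δ) (x : Plane) :
    ‖gradient (coneCutoff δ) x‖ ≤ 2 * K / δ := by
  have h : gradient (coneCutoff δ) x = sideCutoff δ 0 x • gradient (sideCutoff δ 1) x +
      sideCutoff δ 1 x • gradient (sideCutoff δ 0) x := by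
    ext k
    rw [gradient_apply]
    refine (pd_mul ((contDiff_sideCutoff δ 0).differentiable (by simp) x)
      ((contDiff_sideCutoff δ 1).differentiable (by simp) x) k).trans ?_
    simp [gradient_apply]
    ring
  have hb : ∀ i k, ‖sideCutoff δ i x • gradient (sideCutoff δ k) x‖ ≤ K / δ := fun i k => by
    rw [norm_smul, Real.norm_of_nonneg (sideCutoff_nonneg _ _)]
    exact (mul_le_of_le_one_left (norm_nonneg _) (sideCutoff_le_one _ _)).trans
      (norm_gradient_sideCutoff_le hK hδ k x)
  rw [h, show 2 * K / δ = K / δ + K / δ by ring]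
  exact (norm_add_le _ _).trans (add_le_add (hb 0 1) (hb 1 0))

include hK1 hK hK' in
lemma abs_laplacian_coneCutoff_le (hδ : 0 < δ) (x : Plane) :
    |Laplacian.laplacian (coneCutoff δ) x| ≤ 4 * K ^ 2 / δ ^ 2 := by
  have h : Laplacian.laplacian (coneCutoff δ) x = _ := laplacian_mul
    ((contDiff_sideCutoff δ 0).of_le two_le_infty) ((contDiff_sideCutoff δ 1).of_le two_le_infty) x
  have hb : ∀ i k, |sideCutoff δ i x * Laplacian.laplacian (sideCutoff δ k) x| ≤ K / δ ^ 2 :=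
    fun i k => by
    rw [abs_mul, abs_of_nonneg (sideCutoff_nonneg _ _), laplacian_sideCutoff, abs_div,
      abs_of_pos (pow_pos hδ 2)]
    refine (mul_le_of_le_one_left (by positivity) (sideCutoff_le_one _ _)).trans ?_
    gcongr
    exact hK' _
  have hc : |2 * inner ℝ (gradient (sideCutoff δ 0) x) (gradient (sideCutoff δ 1) x)| ≤
      2 * (K / δ * (K / δ)) := by
    rw [abs_mul, abs_two]
    gcongr
    exact (abs_real_inner_le_norm _ _).trans (mul_le_mul (norm_gradient_sideCutoff_le hK hδ 0 x)
      (norm_gradient_sideCutoff_le hK hδ 1 x) (norm_nonneg _) (by positivity))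
  have hKK : K / δ ^ 2 ≤ K ^ 2 / δ ^ 2 := by gcongr; nlinarith
  rw [h]
  calc _ ≤ K / δ ^ 2 + 2 * (K / δ * (K / δ)) + K / δ ^ 2 :=
        (abs_add_le _ _).trans (add_le_add ((abs_add_le _ _).trans (add_le_add (hb 0 1) hc)) (hb 1 0))
    _ ≤ 4 * K ^ 2 / δ ^ 2 := by
        rw [show 2 * (K / δ * (K / δ)) = 2 * (K ^ 2 / δ ^ 2) by field_simp,
          show 4 * K ^ 2 / δ ^ 2 = 4 * (K ^ 2 / δ ^ 2) by ring]
        linarith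

end ConeCutoff

/-- The points at distance less than `R` from the origin and close to the boundary of the cone. -/
def strip (R δ : ℝ) : Set Plane := {x | ‖x‖ ≤ R ∧ ∃ i, 0 ≤ side i x ∧ side i x ≤ δ}

lemma measurableSet_strip (R δ : ℝ) : MeasurableSet (strip R δ) := by
  have : strip R δ = {x | ‖x‖ ≤ R} ∩ ⋃ i, {x | 0 ≤ side i x} ∩ {x | side i x ≤ δ} := by
    ext x
    simp [strip]
  rw [this]
  exact (isClosed_le continuous_norm continuous_const).measurableSet.inter
    (MeasurableSet.iUnion fun i =>
      (isClosed_le continuous_const (continuous_side i)).measurableSet.inter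
        (isClosed_le (continuous_side i) continuous_const).measurableSet)

lemma volume_strip_le (R δ : ℝ) :
    volume (strip R δ) ≤ 2 * (ENNReal.ofReal (2 * R) * ENNReal.ofReal δ) := by
  set A : Set Plane := {x | ‖x‖ ≤ R ∧ 0 ≤ side 0 x ∧ side 0 x ≤ δ} with hA
  have hAv : volume A ≤ ENNReal.ofReal (2 * R) * ENNReal.ofReal δ := by
    set f : Fin 2 → Set ℝ := ![Set.Icc (-R) R, Set.Icc 0 δ]
    have hsub : A ⊆ (WithLp.ofLp : Plane → Fin 2 → ℝ) ⁻¹' (Set.univ.pi f) := by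
      intro x hx
      have h0 : |x 0| ≤ R := (PiLp.norm_apply_le x 0).trans hx.1
      have h1 : 0 ≤ x 1 ∧ x 1 ≤ δ := by simpa only [side_zero] using hx.2
      simp only [Set.mem_preimage, Set.mem_pi, Set.mem_univ, true_imp_iff, Fin.forall_fin_two]
      exact ⟨abs_le.1 h0, h1⟩
    refine (measure_mono hsub).trans ?_
    have hmp := PiLp.volume_preserving_ofLp (Fin 2)
    rw [hmp.measure_preimage (MeasurableSet.univ_pi fun i => by
      fin_cases i <;> exact measurableSet_Icc).nullMeasurableSet, volume_pi_pi]
    simp only [Fin.prod_univ_two, f, Matrix.cons_val_zero, Matrix.cons_val_one, Real.volume_Icc]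
    rw [sub_neg_eq_add, ← two_mul, sub_zero]
  have hsub : strip R δ ⊆ A ∪ axisReflection ⁻¹' A := by
    rintro x ⟨hx, i, hi⟩
    fin_cases i
    · exact Or.inl ⟨hx, hi⟩
    · refine Or.inr ⟨by rwa [axisReflection.norm_map], ?_⟩
      rw [side_zero_axisReflection]
      exact hi
  have hAm : MeasurableSet A := by
    have : A = {x | ‖x‖ ≤ R} ∩ ({x | 0 ≤ side 0 x} ∩ {x | side 0 x ≤ δ}) := rfl
    rw [this]
    exact (isClosed_le continuous_norm continuous_const).measurableSet.inter
      ((isClosed_le continuous_const (continuous_side 0)).measurableSet.inter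
        (isClosed_le (continuous_side 0) continuous_const).measurableSet)
  refine (measure_mono hsub).trans ((measure_union_le _ _).trans ?_)
  rw [axisReflection.measurePreserving.measure_preimage hAm.nullMeasurableSet, ← two_mul]
  gcongr

/-! ### Green's identity in the positivity set -/

section Mollify

variable {u : Plane → ℝ} {L : NNReal}

lemma abs_mollify_sub_le (hu : LipschitzWith L u) (n : ℕ) (x : Plane) :
    |mollify n u x - u x| ≤ L * radius n := by
  have hloc : LocallyIntegrable u := hu.continuous.locallyIntegrable
  have h : ∀ t ∈ Metric.ball x (radius n), |u t - u x| ≤ L * radius n := fun t ht => by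
    rw [Metric.mem_ball] at ht
    exact (hu.dist_le_mul t x).trans (by gcongr)
  rw [abs_le]
  constructor
  · have := le_mollify (n := n) (x := x) (b := u x - L * radius n) hloc
      (.of_forall fun t ht => by linarith [(abs_le.1 (h t ht)).1])
    linarith
  · have := mollify_le (n := n) (x := x) (b := u x + L * radius n) hloc
      (.of_forall fun t ht => by linarith [(abs_le.1 (h t ht)).2])
    linarith

lemma lipschitzWith_mollify (hu : LipschitzWith L u) (n : ℕ) :
    LipschitzWith L (mollify n u) := by
  have hloc : LocallyIntegrable u := hu.continuous.locallyIntegrable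
  have heq : ∀ x, mollify n u x = ∫ s, u (x - s) * mollifier n s := fun x => by
    rw [mollify, conv, ← integral_sub_left_eq_self _ volume x]
    simp
  have hint : ∀ x, Integrable fun s => u (x - s) * mollifier n s := fun x =>
    ((hu.continuous.comp (continuous_const.sub continuous_id)).mul
      (contDiff_mollifier n).continuous).integrable_of_hasCompactSupport
        ((hasCompactSupport_mollifier n).mul_left)
  have hm : Integrable (mollifier n) := (contDiff_mollifier n).continuous.integrable_of_hasCompactSupport
    (hasCompactSupport_mollifier n)
  refine LipschitzWith.of_le_add_mul _ fun x y => ?_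
  rw [heq, heq, ← sub_le_iff_le_add', ← integral_sub (hint x) (hint y)]
  calc ∫ s, (u (x - s) * mollifier n s - u (y - s) * mollifier n s)
      ≤ ∫ s, L * dist x y * mollifier n s := by
        refine integral_mono ((hint x).sub (hint y)) (hm.const_mul _) fun s => ?_
        have h1 := (le_abs_self _).trans (hu.dist_le_mul (x - s) (y - s))
        rw [dist_sub_right] at h1
        change u (x - s) * mollifier n s - u (y - s) * mollifier n s ≤ _
        rw [← sub_mul]
        exact mul_le_mul_of_nonneg_right h1 (mollifier_nonneg n s)
    _ = L * dist x y := by rw [integral_const_mul, integral_mollifier, mul_one]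

lemma norm_gradient_mollify_le (hu : LipschitzWith L u) (n : ℕ) (x : Plane) :
    ‖gradient (mollify n u) x‖ ≤ L := by
  rw [norm_gradient]
  exact norm_fderiv_le_of_lipschitz ℝ (lipschitzWith_mollify hu n)

end Mollify

section

variable {j T : ℝ} {u : Plane → ℝ} {g : Plane → Plane}

lemma IsLipschitzSolution.continuous (h : IsLipschitzSolution j T u g) : Continuous u :=
  h.lipschitz.choose_spec.continuous

lemma IsLipschitzSolution.isOpen (h : IsLipschitzSolution j T u g) : IsOpen {x | 0 < u x} :=
  isOpen_lt continuous_const h.continuous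

lemma IsLipschitzSolution.isCapSolution (h : IsLipschitzSolution j T u g) :
    IsCapSolution j T u g :=
  ⟨h.mem, .of_forall h.symm, .of_forall h.nonneg,
    .of_forall fun x hx => h.le_side x hx.1, .of_forall h.eq_zero_of_le,
    .of_forall h.subsolution_le, h.upper, h.lower⟩

lemma IsLipschitzSolution.mem_cone (h : IsLipschitzSolution j T u g) {x : Plane}
    (hx : 0 < u x) : x ∈ cone 0 := by
  by_contra hxC
  exact hx.ne' (h.eq_zero x hxC)

lemma IsLipschitzSolution.axial_lt (h : IsLipschitzSolution j T u g) {x : Plane}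
    (hx : 0 < u x) : axial x < T := by
  by_contra hxC
  exact hx.ne' (h.eq_zero_of_le x (not_lt.1 hxC))

lemma IsLipschitzSolution.norm_le (h : IsLipschitzSolution j T u g) {x : Plane}
    (hx : 0 < u x) : ‖x‖ ≤ 2 * T := by
  have h1 := norm_le_two_mul_axial fun i => (mem_cone_zero.1 (h.mem_cone hx) i).le
  linarith [h.axial_lt hx]

lemma IsLipschitzSolution.isBounded (h : IsLipschitzSolution j T u g) :
    Bornology.IsBounded {x | 0 < u x} :=
  Metric.isBounded_closedBall.subset fun _ hx => mem_closedBall_zero_iff.2 (h.norm_le hx)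

lemma IsLipschitzSolution.subset_cap (h : IsLipschitzSolution j T u g) (hT : 2 ≤ T) :
    {x | 0 < u x} ⊆ cap (6 * T) := fun _ hx =>
  ⟨h.mem_cone hx, mem_ball_zero_iff.2 ((h.norm_le hx).trans_lt (by linarith))⟩

lemma side_le_norm (i : Fin 2) (x : Plane) : side i x ≤ ‖x‖ := by
  simpa [side] using (le_abs_self _).trans (abs_side_sub_le i x 0)

lemma IsLipschitzSolution.le_const (h : IsLipschitzSolution j T u g) (hj : 0 ≤ j) (hT : 2 ≤ T)
    (x : Plane) : u x ≤ 18 * j * T := by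
  by_cases hx : 0 < u x
  · refine (h.le_side x (h.mem_cone hx) 0).trans ?_
    have := (side_le_norm 0 x).trans (h.norm_le hx)
    calc 9 * j * side 0 x ≤ 9 * j * (2 * T) := by gcongr
      _ = 18 * j * T := by ring
  · exact (not_lt.1 hx).trans (by positivity)

lemma IsLipschitzSolution.integral_inner_eq (h : IsLipschitzSolution j T u g) (hT : 2 ≤ T)
    {ψ : Plane → ℝ} (hψ : IsTestFunction {x | 0 < u x} ψ) (hψ0 : ∀ x, 0 ≤ ψ x) :
    ∫ x, inner ℝ (g x) (gradient ψ x) = ∫ x, (load j x - 1) * ψ x := by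
  refine le_antisymm ((h.upper ψ (hψ.mono (h.subset_cap hT)) hψ0).trans_eq ?_)
    (h.lower ψ (hψ.mono (h.subset_cap hT)) hψ0)
  congr 1
  funext x
  by_cases hx : x ∈ {x | 0 < u x}
  · rw [Set.indicator_of_mem hx]
  · rw [hψ.eq_zero hx, mul_zero, mul_zero]

lemma locallyIntegrable_one_sub_load (j : ℝ) : LocallyIntegrable fun x => 1 - load j x :=
  (locallyIntegrable_const 1).sub ((memLp_load j).locallyIntegrable (by norm_num))

lemma IsLipschitzSolution.laplacian_mollify (h : IsLipschitzSolution j T u g) (hT : 2 ≤ T)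
    {n : ℕ} {x : Plane} (hx : Metric.closedBall x (radius n) ⊆ {x | 0 < u x}) :
    Laplacian.laplacian (mollify n u) x = mollify n (fun x => 1 - load j x) x := by
  rw [h.mem.laplacian_mollify, h.integral_inner_eq hT (isTestFunction_mollifier hx)
    fun _ => mollifier_nonneg n _, ← integral_neg, mollify, conv]
  congr 1
  funext t
  ring

lemma abs_mollify_one_sub_load_le (hj : 0 ≤ j) (n : ℕ) (x : Plane) :
    |mollify n (fun x => 1 - load j x) x| ≤ j + 1 := by
  rw [abs_le]
  constructor
  · exact le_mollify (locallyIntegrable_one_sub_load j)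
      (.of_forall fun t _ => by linarith [load_le hj t])
  · exact mollify_le (locallyIntegrable_one_sub_load j)
      (.of_forall fun t _ => by linarith [load_nonneg hj t])

lemma IsLipschitzSolution.exists_norm_gradient_sq_le (h : IsLipschitzSolution j T u g)
    (hj : 0 ≤ j) (hT : 2 ≤ T) {δ : ℝ} (hδ : 0 < δ) : ∃ C, 0 ≤ C ∧ ∀ (n : ℕ) (x : Plane),
      radius n ≤ δ / 2 → (∀ i, δ ≤ side i x) → axial x < T → 0 < mollify n u x →
      ‖gradient (mollify n u) x‖ ^ 2 ≤ C * mollify n u x := by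
  obtain ⟨C, hC, hgrad⟩ := exists_gradient_bound
  have hloc := h.mem.locallyIntegrable
  set B := 18 * j * T with hB
  have hB0 : 0 ≤ B := by positivity
  set κ := δ / (2 * (B + 1)) with hκ
  have hκ0 : 0 < κ := by positivity
  refine ⟨(C * (1 / κ + (j + 1) * κ)) ^ 2, sq_nonneg _, fun n x hn hx hxT hpos => ?_⟩
  set v := mollify n u with hv
  have hvB : v x ≤ B := mollify_le hloc (.of_forall fun t _ => h.le_const hj hT t)
  have hs0 : 0 < √(v x) := Real.sqrt_pos.2 hpos
  have hsq : √(v x) * √(v x) = v x := Real.mul_self_sqrt hpos.le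
  have hsB : √(v x) ≤ B + 1 := by nlinarith
  have hsδ : κ * √(v x) ≤ δ / 2 := by
    calc κ * √(v x) ≤ κ * (B + 1) := by gcongr
      _ = δ / 2 := by rw [hκ]; field_simp
  have hsub := ball_subset_cap hT hx hδ (by linarith)
  have hg := hgrad v (contDiff_mollify hloc) x (κ * √(v x)) (j + 1) (by positivity)
    (fun y _ => le_mollify hloc (.of_forall fun t _ => h.nonneg t))
    (fun y hy => h.isCapSolution.abs_laplacian_mollify_le hj fun z hz => hsub (by
      rw [Metric.mem_ball] at hy ⊢
      rw [Metric.mem_closedBall] at hz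
      linarith [dist_triangle z y x]))
  have h1 : C * (v x / (κ * √(v x)) + (j + 1) * (κ * √(v x))) =
      C * (1 / κ + (j + 1) * κ) * √(v x) := by
    have : v x / (κ * √(v x)) = 1 / κ * √(v x) := by
      rw [div_eq_iff (by positivity)]
      field_simp
      nlinarith
    rw [this]
    ring
  rw [h1] at hg
  calc ‖gradient v x‖ ^ 2 ≤ (C * (1 / κ + (j + 1) * κ) * √(v x)) ^ 2 := by gcongr
    _ = (C * (1 / κ + (j + 1) * κ)) ^ 2 * v x := by rw [mul_pow, sq (√(v x)), hsq]

end

section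

variable {j T : ℝ} {u : Plane → ℝ} {g : Plane → Plane}

lemma gradient_comp {F : ℝ → ℝ} {f : Plane → ℝ} {x : Plane} (hF : DifferentiableAt ℝ F (f x))
    (hf : DifferentiableAt ℝ f x) :
    gradient (fun y => F (f y)) x = deriv F (f x) • gradient f x := by
  ext i
  rw [gradient_apply, pd_comp hF hf]
  simp [gradient_apply]

/-- The test function used in the proof of Green's identity. -/
noncomputable def cutSolution (u : Plane → ℝ) (m n : ℕ) (δ : ℝ) (x : Plane) : ℝ :=
  lift m (mollify n u x) * coneCutoff δ x

/-- The terms in the Laplacian of `cutSolution` which become small. -/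
noncomputable def cutError (u : Plane → ℝ) (m n : ℕ) (δ : ℝ) (x : Plane) : ℝ :=
  lift m (mollify n u x) * Laplacian.laplacian (coneCutoff δ) x +
    2 * (deriv (lift m) (mollify n u x) *
      inner ℝ (gradient (mollify n u) x) (gradient (coneCutoff δ) x)) +
    coneCutoff δ x * (deriv (deriv (lift m)) (mollify n u x) * ‖gradient (mollify n u) x‖ ^ 2)

lemma contDiff_cutSolution (hu : LocallyIntegrable u) (m n : ℕ) (δ : ℝ) :
    ContDiff ℝ ∞ (cutSolution u m n δ) :=
  ((contDiff_lift m).comp (contDiff_mollify hu)).mul (contDiff_coneCutoff δ)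

lemma laplacian_cutSolution (hu : LocallyIntegrable u) (m n : ℕ) (δ : ℝ) (x : Plane) :
    Laplacian.laplacian (cutSolution u m n δ) x =
      coneCutoff δ x * deriv (lift m) (mollify n u x) * Laplacian.laplacian (mollify n u) x +
        cutError u m n δ x := by
  have hv : ContDiff ℝ ∞ (mollify n u) := contDiff_mollify hu
  have h1 : Laplacian.laplacian (cutSolution u m n δ) x = _ :=
    laplacian_mul (f := fun x => lift m (mollify n u x))
    (((contDiff_lift m).comp hv).of_le two_le_infty)
    ((contDiff_coneCutoff δ).of_le two_le_infty) x
  rw [h1, laplacian_comp ((contDiff_lift m).of_le two_le_infty) (hv.of_le two_le_infty),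
    gradient_comp ((contDiff_lift m).differentiable (by simp) _) (hv.differentiable (by simp) x),
    inner_smul_left, cutError]
  simp only [conj_trivial]
  ring

lemma closedBall_subset_of_le_mollify {L : NNReal}
    (hL : LipschitzWith L u) {n : ℕ} {c : ℝ} (hn : 2 * (L * radius n) < c) {x : Plane}
    (hx : c ≤ mollify n u x) : Metric.closedBall x (radius n) ⊆ {x | 0 < u x} := by
  intro y hy
  rw [Metric.mem_closedBall, dist_comm] at hy
  have h1 := (abs_le.1 (abs_mollify_sub_le hL n x)).2
  have h2 := (le_abs_self _).trans (hL.dist_le_mul x y)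
  have h3 : L * dist x y ≤ L * radius n := by gcongr
  change 0 < u y
  linarith

lemma IsLipschitzSolution.isTestFunction_cutSolution (h : IsLipschitzSolution j T u g)
    {L : NNReal} (hL : LipschitzWith L u) {m n : ℕ} (hn : 2 * (L * radius n) <
      Real.exp (-(2 * (m + 1)))) (δ : ℝ) :
    IsTestFunction {x | 0 < u x} (cutSolution u m n δ) := by
  have hloc := h.mem.locallyIntegrable
  have hclosed : IsClosed {x | Real.exp (-(2 * ((m : ℝ) + 1))) ≤ mollify n u x} :=
    isClosed_le continuous_const (contDiff_mollify hloc).continuous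
  have hsub : tsupport (cutSolution u m n δ) ⊆
      {x | Real.exp (-(2 * ((m : ℝ) + 1))) ≤ mollify n u x} := by
    refine closure_minimal (fun x hx => ?_) hclosed
    by_contra hlt
    have h0 : 0 ≤ mollify n u x := le_mollify hloc (.of_forall fun t _ => h.nonneg t)
    have hlt' : |mollify n u x| < Real.exp (-(2 * ((m : ℝ) + 1))) := by
      rw [abs_of_nonneg h0]
      exact not_le.1 hlt
    apply hx
    rw [cutSolution, (lift_eventuallyEq_zero m hlt').eq_of_nhds, zero_mul]
  have hsub' : tsupport (cutSolution u m n δ) ⊆ {x | 0 < u x} := fun x hx =>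
    closedBall_subset_of_le_mollify hL hn (hsub hx) (Metric.mem_closedBall_self (radius_pos n).le)
  exact ⟨contDiff_cutSolution hloc m n δ,
    Metric.isCompact_of_isClosed_isBounded (isClosed_tsupport _) (h.isBounded.subset hsub'), hsub'⟩

lemma cutError_eq_zero {m n : ℕ} {δ : ℝ} {x : Plane}
    (hx : |mollify n u x| < Real.exp (-(2 * (m + 1)))) : cutError u m n δ x = 0 := by
  have h := lift_eventuallyEq_zero m hx
  have h1 : deriv (lift m) =ᶠ[𝓝 (mollify n u x)] fun _ => 0 := by
    simpa using h.deriv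
  rw [cutError, h.eq_of_nhds, h1.eq_of_nhds, h1.deriv_eq]
  simp

/-- The bound for the error terms. -/
lemma IsLipschitzSolution.exists_cutError_bound (h : IsLipschitzSolution j T u g) (hj : 0 ≤ j)
    (hT : 2 ≤ T) : ∃ A, 0 ≤ A ∧ ∀ δ, 0 < δ → ∃ C, 0 ≤ C ∧ ∀ m n : ℕ,
      radius n ≤ δ / 2 → ∀ x, 0 < u x → 0 < mollify n u x →
      |cutError u m n δ x| ≤ C / (m + 1) +
        (strip (2 * T) (2 * δ)).indicator (fun _ => A / δ) x := by
  obtain ⟨K, hK1, hK, hK'⟩ := exists_smoothTransition_bound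
  obtain ⟨L, hL⟩ := h.lipschitz
  have hK0 : 0 ≤ K := by linarith
  have hloc := h.mem.locallyIntegrable
  refine ⟨27 * j * (4 * K ^ 2) + 2 * (2 * K * (L * (2 * K))), by positivity, fun δ hδ => ?_⟩
  obtain ⟨C, hC0, hC⟩ := h.exists_norm_gradient_sq_le hj hT hδ
  refine ⟨C * (2 * K), by positivity, fun m n hn x hx hpos => ?_⟩
  set A := 27 * j * (4 * K ^ 2) + 2 * (2 * K * (L * (2 * K))) with hA
  set v := mollify n u with hv
  have hxs := mem_cone_zero.1 (h.mem_cone hx)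
  have e3 : |coneCutoff δ x * (deriv (deriv (lift m)) (v x) * ‖gradient v x‖ ^ 2)| ≤
      C * (2 * K) / (m + 1) := by
    by_cases hs : ∀ i, δ ≤ side i x
    · have h1 := hC n x hn hs (h.axial_lt hx) hpos
      have h2 := abs_mul_deriv_deriv_lift_le hK hK' m (v x)
      rw [abs_mul, abs_of_pos hpos] at h2
      rw [abs_mul, abs_of_nonneg (coneCutoff_nonneg x), abs_mul, abs_of_nonneg (sq_nonneg ‖_‖)]
      calc coneCutoff δ x * (|deriv (deriv (lift m)) (v x)| * ‖gradient v x‖ ^ 2)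
          ≤ |deriv (deriv (lift m)) (v x)| * ‖gradient v x‖ ^ 2 :=
            mul_le_of_le_one_left (by positivity) (coneCutoff_le_one x)
        _ ≤ |deriv (deriv (lift m)) (v x)| * (C * v x) := by gcongr
        _ = C * (v x * |deriv (deriv (lift m)) (v x)|) := by ring
        _ ≤ C * (2 * K / (m + 1)) := by gcongr
        _ = C * (2 * K) / (m + 1) := by ring
    · rw [not_forall] at hs
      obtain ⟨i, hi⟩ := hs
      rw [coneCutoff_eq_zero hδ (not_le.1 hi).le, zero_mul, abs_zero]
      positivity
  have e12 : |lift m (v x) * Laplacian.laplacian (coneCutoff δ) x +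
      2 * (deriv (lift m) (v x) * inner ℝ (gradient v x) (gradient (coneCutoff δ) x))| ≤
        (strip (2 * T) (2 * δ)).indicator (fun _ => A / δ) x := by
    by_cases hs : x ∈ strip (2 * T) (2 * δ)
    · rw [Set.indicator_of_mem hs]
      obtain ⟨-, i, hi0, hi⟩ := hs
      have hvx : |v x| ≤ 27 * j * δ := by
        rw [abs_of_pos hpos]
        refine mollify_le hloc (.of_forall fun t ht => ?_)
        rw [Metric.mem_ball] at ht
        by_cases htC : t ∈ cone 0
        · refine (h.le_side t htC i).trans ?_
          have := (abs_le.1 (abs_side_sub_le i t x)).2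
          calc 9 * j * side i t ≤ 9 * j * (3 * δ) := by gcongr; linarith
            _ = 27 * j * δ := by ring
        · rw [h.eq_zero t htC]
          positivity
      have h1 : |lift m (v x) * Laplacian.laplacian (coneCutoff δ) x| ≤
          27 * j * (4 * K ^ 2) / δ := by
        rw [abs_mul]
        calc |lift m (v x)| * |Laplacian.laplacian (coneCutoff δ) x|
            ≤ 27 * j * δ * (4 * K ^ 2 / δ ^ 2) :=
              mul_le_mul ((abs_lift_le m _).trans hvx) (abs_laplacian_coneCutoff_le hK1 hK hK' hδ x)
                (abs_nonneg _) (by positivity)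
          _ = 27 * j * (4 * K ^ 2) / δ := by field_simp
      have h2 : |2 * (deriv (lift m) (v x) *
          inner ℝ (gradient v x) (gradient (coneCutoff δ) x))| ≤
            2 * (2 * K * (L * (2 * K))) / δ := by
        rw [abs_mul, abs_two, abs_mul]
        calc 2 * (|deriv (lift m) (v x)| * |inner ℝ (gradient v x) (gradient (coneCutoff δ) x)|)
            ≤ 2 * (2 * K * (L * (2 * K / δ))) := by
              gcongr
              · exact abs_deriv_lift_le hK1 hK m _
              · exact (abs_real_inner_le_norm _ _).trans (mul_le_mul
                  (norm_gradient_mollify_le hL n x) (norm_gradient_coneCutoff_le hK hδ x)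
                  (norm_nonneg _) L.2)
          _ = 2 * (2 * K * (L * (2 * K))) / δ := by ring
      rw [hA, add_div]
      exact (abs_add_le _ _).trans (add_le_add h1 h2)
    · rw [Set.indicator_of_notMem hs]
      have hs' : ∀ i, 2 * δ < side i x := fun i => by
        by_contra hi
        exact hs ⟨h.norm_le hx, i, (hxs i).le, not_lt.1 hi⟩
      have h1 := coneCutoff_eventuallyEq_one hδ hs'
      have h2 : gradient (coneCutoff δ) x = 0 := by
        rw [← norm_eq_zero, norm_gradient, h1.fderiv_eq]
        simp
      have h3 : Laplacian.laplacian (coneCutoff δ) x = 0 := by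
        rw [laplacian_eq ((contDiff_coneCutoff δ).of_le two_le_infty).contDiffAt]
        refine Finset.sum_eq_zero fun i _ => ?_
        have : pd i (coneCutoff δ) =ᶠ[𝓝 x] fun _ => 0 := by
          filter_upwards [h1.eventually_nhds] with y hy
          rw [pd_congr hy, pd_const]
        rw [pd_congr this, pd_const]
      rw [h2, h3]
      simp
  rw [cutError, add_comm (C * (2 * K) / _)]
  exact (abs_add_le _ _).trans (add_le_add e12 e3)

/-- The approximate form of Green's identity. -/
lemma IsLipschitzSolution.exists_approximate_green (h : IsLipschitzSolution j T u g) (hj : 0 ≤ j)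
    (hT : 2 ≤ T) : ∃ A, 0 ≤ A ∧ ∀ H : Plane → ℝ, ContDiffOn ℝ 2 H {x | 0 < u x} →
      IntegrableOn H {x | 0 < u x} → ∀ δ ε : ℝ, 0 < δ → 0 ≤ ε →
      (∀ x, 0 < u x → ∀ i, side i x ≤ 2 * δ → |H x| ≤ ε) → ∃ C, 0 ≤ C ∧ ∀ m : ℕ, ∀ᶠ n in atTop,
        |(∫ x in {x | 0 < u x}, cutSolution u m n δ x * Laplacian.laplacian H x) -
          ∫ x in {x | 0 < u x}, H x * (coneCutoff δ x * deriv (lift m) (mollify n u x) *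
            mollify n (fun x => 1 - load j x) x)| ≤ C / (m + 1) + A * ε := by
  obtain ⟨A, hA, hE⟩ := h.exists_cutError_bound hj hT
  obtain ⟨K, hK1, hK, -⟩ := exists_smoothTransition_bound
  obtain ⟨L, hL⟩ := h.lipschitz
  have hloc := h.mem.locallyIntegrable
  refine ⟨A * (16 * T), by positivity, fun H hH hHi δ ε hδ hε hst => ?_⟩
  obtain ⟨C, hC, hE⟩ := hE δ hδ
  set Ω := {x | 0 < u x} with hΩ
  have hΩm : MeasurableSet Ω := h.isOpen.measurableSet
  have hN : 0 ≤ ∫ x in Ω, |H x| := integral_nonneg fun x => abs_nonneg _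
  refine ⟨C * ∫ x in Ω, |H x|, by positivity, fun m => ?_⟩
  have hLr : Tendsto (fun n => 2 * ((L : ℝ) * radius n)) atTop (𝓝 0) := by
    simpa using (tendsto_radius.const_mul (L : ℝ)).const_mul 2
  filter_upwards [hLr.eventually_lt_const (Real.exp_pos (-(2 * ((m : ℝ) + 1)))),
    tendsto_radius.eventually_lt_const (half_pos hδ)] with n hn hnδ
  have hw := h.isTestFunction_cutSolution hL hn δ
  have hv0 : ∀ x, 0 ≤ mollify n u x := fun x =>
    le_mollify hloc (.of_forall fun t _ => h.nonneg t)
  set f := mollify n (fun x => 1 - load j x) with hf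
  have hfc : Continuous f := (contDiff_mollify (locallyIntegrable_one_sub_load j)).continuous
  set q : Plane → ℝ := fun x => coneCutoff δ x * deriv (lift m) (mollify n u x) * f x with hq
  have hvc : Continuous (mollify n u) := (contDiff_mollify hloc).continuous
  have hqc : Continuous q := ((contDiff_coneCutoff δ).continuous.mul
    (((contDiff_lift m).continuous_deriv (by simp)).comp hvc)).mul hfc
  have hlap : ∀ x, Laplacian.laplacian (cutSolution u m n δ) x = q x + cutError u m n δ x := by
    intro x
    rw [laplacian_cutSolution hloc]
    congr 1
    by_cases hx : Real.exp (-(2 * ((m : ℝ) + 1))) ≤ mollify n u x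
    · rw [h.laplacian_mollify hT (closedBall_subset_of_le_mollify hL hn hx)]
    · have h1 := (lift_eventuallyEq_zero m (t := mollify n u x) (by
        rw [abs_of_nonneg (hv0 x)]
        exact not_le.1 hx)).deriv_eq
      simp [hq, h1]
  have hG := integral_mul_laplacian_comm_of_contDiffOn h.isOpen hH hw
  have hl0 : ∀ x, x ∉ Ω → Laplacian.laplacian (cutSolution u m n δ) x = 0 := fun x hx =>
    image_eq_zero_of_notMem_tsupport fun hx' => hx (hw.2.2 (tsupport_laplacian_subset _ hx'))
  have g1 := setIntegral_eq_integral_of_forall_compl_eq_zero (μ := volume) (s := Ω)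
    (f := fun x => H x * Laplacian.laplacian (cutSolution u m n δ) x)
    (fun x hx => by rw [hl0 x hx, mul_zero])
  have g2 := setIntegral_eq_integral_of_forall_compl_eq_zero (μ := volume) (s := Ω)
    (f := fun x => cutSolution u m n δ x * Laplacian.laplacian H x)
    (fun x hx => by rw [hw.eq_zero hx, zero_mul])
  rw [g2, ← hG, ← g1]
  have hqb : ∀ x, ‖q x‖ ≤ 2 * K * (j + 1) := fun x => by
    rw [hq, norm_mul, norm_mul, Real.norm_of_nonneg (coneCutoff_nonneg x)]
    exact mul_le_mul ((mul_le_of_le_one_left (norm_nonneg _) (coneCutoff_le_one x)).trans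
      (abs_deriv_lift_le hK1 hK m _)) (abs_mollify_one_sub_load_le hj n x) (norm_nonneg _)
      (by positivity)
  obtain ⟨M, hM⟩ := (hasCompactSupport_laplacian hw.2.1).exists_bound_of_continuous
    (continuous_laplacian hw.contDiff_two)
  have i1 : IntegrableOn (fun x => H x * Laplacian.laplacian (cutSolution u m n δ) x) Ω :=
    Integrable.mul_bdd hHi (continuous_laplacian hw.contDiff_two).aestronglyMeasurable
      (.of_forall hM)
  have i2 : IntegrableOn (fun x => H x * q x) Ω :=
    Integrable.mul_bdd hHi hqc.aestronglyMeasurable (.of_forall hqb)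
  rw [← integral_sub i1 i2]
  have hstm := measurableSet_strip (2 * T) (2 * δ)
  have hvol : volume.real (strip (2 * T) (2 * δ)) ≤ 16 * T * δ := by
    refine (ENNReal.toReal_mono (by finiteness) (volume_strip_le _ _)).trans_eq ?_
    rw [ENNReal.toReal_mul, ENNReal.toReal_mul, ENNReal.toReal_ofReal (by positivity),
      ENNReal.toReal_ofReal (by positivity)]
    simp
    ring
  have hfin : volume (strip (2 * T) (2 * δ)) ≠ ⊤ :=
    ne_top_of_le_ne_top (by finiteness) (volume_strip_le _ _)
  have j1 : IntegrableOn (fun x => C / (m + 1) * |H x|) Ω := hHi.abs.const_mul _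
  have j2 : Integrable ((strip (2 * T) (2 * δ)).indicator fun _ => A / δ * ε) :=
    (integrable_indicator_iff hstm).2 (integrableOn_const hfin)
  have hbound : ∀ x ∈ Ω, ‖H x * Laplacian.laplacian (cutSolution u m n δ) x - H x * q x‖ ≤
      C / (m + 1) * |H x| + (strip (2 * T) (2 * δ)).indicator (fun _ => A / δ * ε) x := by
    intro x hx
    have hE0 : |cutError u m n δ x| ≤ C / (m + 1) +
        (strip (2 * T) (2 * δ)).indicator (fun _ => A / δ) x := by
      rcases (hv0 x).eq_or_lt with hz | hz
      · rw [cutError_eq_zero (by rw [← hz, abs_zero]; exact Real.exp_pos _), abs_zero]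
        exact add_nonneg (by positivity) (Set.indicator_nonneg (fun _ _ => by positivity) _)
      · exact hE m n hnδ.le x hx hz
    rw [hlap, mul_add, add_sub_cancel_left, norm_mul, Real.norm_eq_abs, Real.norm_eq_abs]
    refine (mul_le_mul_of_nonneg_left hE0 (abs_nonneg _)).trans ?_
    rw [mul_add, mul_comm]
    gcongr
    by_cases hs : x ∈ strip (2 * T) (2 * δ)
    · rw [Set.indicator_of_mem hs, Set.indicator_of_mem hs, mul_comm]
      obtain ⟨-, i, -, hi⟩ := hs
      gcongr
      exact hst x hx i hi
    · rw [Set.indicator_of_notMem hs, Set.indicator_of_notMem hs, mul_zero]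
  rw [← Real.norm_eq_abs]
  calc _ ≤ ∫ x in Ω, (C / (m + 1) * |H x| +
        (strip (2 * T) (2 * δ)).indicator (fun _ => A / δ * ε) x) :=
      norm_integral_le_of_norm_le (j1.add j2.integrableOn)
        ((ae_restrict_iff' hΩm).2 (.of_forall hbound))
    _ = C / (m + 1) * (∫ x in Ω, |H x|) +
        ∫ x in Ω, (strip (2 * T) (2 * δ)).indicator (fun _ => A / δ * ε) x := by
      rw [integral_add j1 j2.integrableOn, integral_const_mul]
    _ ≤ C / (m + 1) * (∫ x in Ω, |H x|) +
        ∫ x, (strip (2 * T) (2 * δ)).indicator (fun _ => A / δ * ε) x := by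
      exact add_le_add le_rfl (setIntegral_le_integral j2
        (.of_forall fun x => Set.indicator_nonneg (fun _ _ => by positivity) _))
    _ ≤ C / (m + 1) * (∫ x in Ω, |H x|) + 16 * T * δ * (A / δ * ε) := by
      rw [integral_indicator hstm, setIntegral_const, smul_eq_mul]
      gcongr
    _ = C * (∫ x in Ω, |H x|) / (m + 1) + A * (16 * T) * ε := by
      field_simp

end

section

variable {j T : ℝ} {u : Plane → ℝ} {g : Plane → Plane}

lemma tendsto_mollify (hu : ∃ L, LipschitzWith L u) (x : Plane) :
    Tendsto (fun n => mollify n u x) atTop (𝓝 (u x)) := by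
  obtain ⟨L, hL⟩ := hu
  rw [tendsto_iff_norm_sub_tendsto_zero]
  refine squeeze_zero (fun n => norm_nonneg _) (fun n => abs_mollify_sub_le hL n x) ?_
  simpa using tendsto_radius.const_mul (L : ℝ)

/-- Green's identity for the solution of the obstacle problem and a function on its positivity set
which is small near the boundary of the cone. -/
theorem IsLipschitzSolution.green (h : IsLipschitzSolution j T u g) (hj : 0 ≤ j) (hT : 2 ≤ T)
    {H : Plane → ℝ} (hH : ContDiffOn ℝ 2 H {x | 0 < u x}) (hHi : IntegrableOn H {x | 0 < u x})
    (hLi : IntegrableOn (Laplacian.laplacian H) {x | 0 < u x})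
    (hst : ∀ ε, 0 < ε → ∃ δ, 0 < δ ∧ ∀ x, 0 < u x → ∀ i, side i x ≤ δ → |H x| ≤ ε) :
    ∫ x in {x | 0 < u x}, u x * Laplacian.laplacian H x =
      ∫ x in {x | 0 < u x}, H x * (1 - load j x) := by
  obtain ⟨A, hA, hG⟩ := h.exists_approximate_green hj hT
  obtain ⟨K, hK1, hK, -⟩ := exists_smoothTransition_bound
  have hloc := h.mem.locallyIntegrable
  have huc := h.continuous
  set Ω := {x | 0 < u x} with hΩ
  have hΩm : MeasurableSet Ω := h.isOpen.measurableSet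
  set B := 18 * j * T with hB
  have hB0 : 0 ≤ B := by positivity
  have huB : ∀ x, |u x| ≤ B := fun x => by
    rw [abs_of_nonneg (h.nonneg x)]
    exact h.le_const hj hT x
  have hvB : ∀ n x, |mollify n u x| ≤ B := fun n x => by
    rw [abs_of_nonneg (le_mollify hloc (.of_forall fun t _ => h.nonneg t))]
    exact mollify_le hloc (.of_forall fun t _ => h.le_const hj hT t)
  have hη : ∀ δ x, |coneCutoff δ x| ≤ 1 := fun δ x => by
    rw [abs_of_nonneg (coneCutoff_nonneg x)]
    exact coneCutoff_le_one x
  have hηc : ∀ δ, Continuous (coneCutoff δ) := fun δ => (contDiff_coneCutoff δ).continuous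
  have hfb : ∀ x, |1 - load j x| ≤ j + 1 := fun x => by
    rw [abs_le]
    constructor <;> linarith [load_nonneg hj x, load_le hj x]
  have hfm : Measurable fun x => 1 - load j x := measurable_const.sub (measurable_load j)
  have hf1 : LocallyIntegrable fun x => 1 - load j x := locallyIntegrable_one_sub_load j
  have hLm := hLi.aestronglyMeasurable
  have hHm := hHi.aestronglyMeasurable
  have step1 : ∀ δ ε : ℝ, 0 < δ → 0 ≤ ε → (∀ x, 0 < u x → ∀ i, side i x ≤ 2 * δ → |H x| ≤ ε) →
      |(∫ x in Ω, u x * coneCutoff δ x * Laplacian.laplacian H x) -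
        ∫ x in Ω, H x * (coneCutoff δ x * (1 - load j x))| ≤ A * ε := by
    intro δ ε hδ hε hs
    obtain ⟨C, -, hC⟩ := hG H hH hHi δ ε hδ hε hs
    have t1 : ∀ m : ℕ, |(∫ x in Ω, lift m (u x) * coneCutoff δ x * Laplacian.laplacian H x) -
        ∫ x in Ω, H x * (coneCutoff δ x * deriv (lift m) (u x) * (1 - load j x))| ≤
          C / (m + 1) + A * ε := by
      intro m
      have l1 : Tendsto (fun n => ∫ x in Ω, cutSolution u m n δ x * Laplacian.laplacian H x) atTop
          (𝓝 (∫ x in Ω, lift m (u x) * coneCutoff δ x * Laplacian.laplacian H x)) := by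
        refine tendsto_integral_of_dominated_convergence
          (fun x => B * |Laplacian.laplacian H x|) (fun n =>
            (contDiff_cutSolution hloc m n δ).continuous.aestronglyMeasurable.mul hLm)
          (hLi.abs.const_mul B) (fun n => .of_forall fun x => ?_) (.of_forall fun x => ?_)
        · rw [norm_mul]
          refine mul_le_mul_of_nonneg_right ?_ (norm_nonneg _)
          rw [cutSolution, norm_mul]
          exact (mul_le_of_le_one_right (norm_nonneg _) (hη δ x)).trans
            ((abs_lift_le m _).trans (hvB n x))
        · exact ((((contDiff_lift m).continuous.tendsto _).comp
            (tendsto_mollify h.lipschitz x)).mul_const _).mul_const _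
      have l2 : Tendsto (fun n => ∫ x in Ω, H x * (coneCutoff δ x *
          deriv (lift m) (mollify n u x) * mollify n (fun x => 1 - load j x) x)) atTop
          (𝓝 (∫ x in Ω, H x * (coneCutoff δ x * deriv (lift m) (u x) * (1 - load j x)))) := by
        have hdc : Continuous (deriv (lift m)) := (contDiff_lift m).continuous_deriv (by simp)
        refine tendsto_integral_of_dominated_convergence
          (fun x => |H x| * (2 * K * (j + 1))) (fun n => hHm.mul
            (((hηc δ).mul (hdc.comp (contDiff_mollify hloc).continuous)).mul
              (contDiff_mollify hf1).continuous).aestronglyMeasurable)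
          (hHi.abs.mul_const _) (fun n => .of_forall fun x => ?_) ?_
        · rw [norm_mul]
          refine mul_le_mul_of_nonneg_left ?_ (norm_nonneg _)
          rw [norm_mul, norm_mul]
          exact mul_le_mul ((mul_le_of_le_one_left (norm_nonneg _) (hη δ x)).trans
            (abs_deriv_lift_le hK1 hK m _)) (abs_mollify_one_sub_load_le hj n x) (norm_nonneg _)
            (by positivity)
        · filter_upwards [ae_restrict_of_ae (tendsto_mollify_ae hf1)] with x hx
          exact ((((hdc.tendsto _).comp (tendsto_mollify h.lipschitz x)).const_mul _).mul
            hx).const_mul _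
      exact le_of_tendsto (l1.sub l2).abs (hC m)
    have l1 : Tendsto (fun m : ℕ => ∫ x in Ω, lift m (u x) * coneCutoff δ x *
        Laplacian.laplacian H x) atTop
        (𝓝 (∫ x in Ω, u x * coneCutoff δ x * Laplacian.laplacian H x)) := by
      refine tendsto_integral_of_dominated_convergence
        (fun x => B * |Laplacian.laplacian H x|) (fun m =>
          (((contDiff_lift m).continuous.comp huc).mul (hηc δ)).aestronglyMeasurable.mul hLm)
        (hLi.abs.const_mul B) (fun m => .of_forall fun x => ?_) ?_
      · rw [norm_mul]
        refine mul_le_mul_of_nonneg_right ?_ (norm_nonneg _)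
        rw [norm_mul]
        exact (mul_le_of_le_one_right (norm_nonneg _) (hη δ x)).trans
          ((abs_lift_le m _).trans (huB x))
      · refine (ae_restrict_iff' hΩm).2 (.of_forall fun x hx => ?_)
        refine tendsto_const_nhds.congr' ?_
        filter_upwards [tendsto_lift hx] with m hm
        rw [hm.eq_of_nhds, id]
    have l2 : Tendsto (fun m : ℕ => ∫ x in Ω, H x * (coneCutoff δ x *
        deriv (lift m) (u x) * (1 - load j x))) atTop
        (𝓝 (∫ x in Ω, H x * (coneCutoff δ x * (1 - load j x)))) := by
      refine tendsto_integral_of_dominated_convergence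
        (fun x => |H x| * (2 * K * (j + 1))) (fun m => hHm.mul
          (((hηc δ).mul (((contDiff_lift m).continuous_deriv (by simp)).comp
            huc)).aestronglyMeasurable.mul hfm.aestronglyMeasurable))
        (hHi.abs.mul_const _) (fun m => .of_forall fun x => ?_) ?_
      · rw [norm_mul]
        refine mul_le_mul_of_nonneg_left ?_ (norm_nonneg _)
        rw [norm_mul, norm_mul]
        exact mul_le_mul ((mul_le_of_le_one_left (norm_nonneg _) (hη δ x)).trans
          (abs_deriv_lift_le hK1 hK m _)) (hfb x) (norm_nonneg _) (by positivity)
      · refine (ae_restrict_iff' hΩm).2 (.of_forall fun x hx => ?_)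
        refine tendsto_const_nhds.congr' ?_
        filter_upwards [tendsto_lift hx] with m hm
        rw [hm.deriv_eq, deriv_id, mul_one]
    have l3 : Tendsto (fun m : ℕ => C / ((m : ℝ) + 1) + A * ε) atTop (𝓝 (A * ε)) := by
      have h1 := (tendsto_radius.const_mul C).add_const (A * ε)
      rw [mul_zero, zero_add] at h1
      refine h1.congr fun m => ?_
      rw [radius, mul_one_div]
    exact le_of_tendsto_of_tendsto' (l1.sub l2).abs l3 t1
  have hev : ∀ δ : ℝ, 0 < δ → ∀ x ∈ Ω, ∀ᶠ k in atTop, coneCutoff (δ * radius k) x = 1 := by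
    intro δ hδ x hx
    have hxs := mem_cone_zero.1 (h.mem_cone hx)
    have hr : Tendsto (fun k => 2 * (δ * radius k)) atTop (𝓝 0) := by
      simpa using (tendsto_radius.const_mul δ).const_mul 2
    filter_upwards [hr.eventually_lt_const (hxs 0), hr.eventually_lt_const (hxs 1)] with k h0 h1
    exact coneCutoff_eq_one (mul_pos hδ (radius_pos k)) (Fin.forall_fin_two.2 ⟨h0.le, h1.le⟩)
  have step2 : ∀ ε, 0 < ε → |(∫ x in Ω, u x * Laplacian.laplacian H x) -
      ∫ x in Ω, H x * (1 - load j x)| ≤ A * ε := by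
    intro ε hε
    obtain ⟨δ, hδ, hs⟩ := hst ε hε
    have l1 : Tendsto (fun k => ∫ x in Ω, u x * coneCutoff (δ / 2 * radius k) x *
        Laplacian.laplacian H x) atTop (𝓝 (∫ x in Ω, u x * Laplacian.laplacian H x)) := by
      refine tendsto_integral_of_dominated_convergence
        (fun x => B * |Laplacian.laplacian H x|) (fun m =>
          (huc.mul (hηc _)).aestronglyMeasurable.mul hLm)
        (hLi.abs.const_mul B) (fun m => .of_forall fun x => ?_) ?_
      · rw [norm_mul]
        refine mul_le_mul_of_nonneg_right ?_ (norm_nonneg _)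
        rw [norm_mul]
        exact (mul_le_of_le_one_right (norm_nonneg _) (hη _ x)).trans (huB x)
      · refine (ae_restrict_iff' hΩm).2 (.of_forall fun x hx => ?_)
        refine tendsto_const_nhds.congr' ?_
        filter_upwards [hev (δ / 2) (half_pos hδ) x hx] with m hm
        rw [hm, mul_one]
    have l2 : Tendsto (fun k => ∫ x in Ω, H x * (coneCutoff (δ / 2 * radius k) x *
        (1 - load j x))) atTop (𝓝 (∫ x in Ω, H x * (1 - load j x))) := by
      refine tendsto_integral_of_dominated_convergence
        (fun x => |H x| * (j + 1)) (fun m => hHm.mul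
          ((hηc _).aestronglyMeasurable.mul hfm.aestronglyMeasurable))
        (hHi.abs.mul_const _) (fun m => .of_forall fun x => ?_) ?_
      · rw [norm_mul]
        refine mul_le_mul_of_nonneg_left ?_ (norm_nonneg _)
        rw [norm_mul]
        exact (mul_le_of_le_one_left (norm_nonneg _) (hη _ x)).trans (hfb x)
      · refine (ae_restrict_iff' hΩm).2 (.of_forall fun x hx => ?_)
        refine tendsto_const_nhds.congr' ?_
        filter_upwards [hev (δ / 2) (half_pos hδ) x hx] with m hm
        rw [hm, one_mul]
    refine le_of_tendsto (l1.sub l2).abs (.of_forall fun k => ?_)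
    refine step1 _ ε (mul_pos (half_pos hδ) (radius_pos k)) hε.le fun x hx i hi => ?_
    refine hs x hx i (hi.trans ?_)
    have hr1 : radius k ≤ 1 := by
      rw [radius, div_le_one (by positivity)]
      linarith [(k.cast_nonneg : (0 : ℝ) ≤ k)]
    nlinarith
  have : |(∫ x in Ω, u x * Laplacian.laplacian H x) - ∫ x in Ω, H x * (1 - load j x)| ≤ 0 := by
    have l : Tendsto (fun k => A * radius k) atTop (𝓝 0) := by
      simpa using tendsto_radius.const_mul A
    exact ge_of_tendsto' l fun k => step2 _ (radius_pos k)
  exact sub_eq_zero.1 (abs_nonpos_iff.1 this)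

end

/-! ### Minimality and connectedness -/

section

variable {j T : ℝ} {u : Plane → ℝ} {g : Plane → Plane}

lemma exists_side_bound {Ω : Set Plane} (hb : Bornology.IsBounded Ω) (hΩ : Ω ⊆ cone 0)
    {H : Plane → ℝ} (hH : ∀ x ∈ closure Ω, ∀ i, side i x = 0 → Tendsto H (𝓝[Ω] x) (𝓝 0))
    {ε : ℝ} (hε : 0 < ε) : ∃ δ, 0 < δ ∧ ∀ x ∈ Ω, ∀ i, side i x ≤ δ → |H x| ≤ ε := by
  have key : ∀ i, ∃ δ, 0 < δ ∧ ∀ x ∈ Ω, side i x ≤ δ → |H x| ≤ ε := by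
    intro i
    by_contra! hcon
    choose x hxΩ hxs hxH using fun n => hcon (radius n) (radius_pos n)
    obtain ⟨p, hp, φ, hφ, hlim⟩ := hb.isCompact_closure.tendsto_subseq
      fun n => subset_closure (hxΩ n)
    have h1 : side i p ≤ 0 := le_of_tendsto_of_tendsto' (((continuous_side i).tendsto p).comp hlim)
      (tendsto_radius.comp hφ.tendsto_atTop) fun n => hxs (φ n)
    have h2 : 0 ≤ side i p := side_nonneg_of_mem_closure (closure_mono hΩ hp) i
    have h3 : Tendsto (x ∘ φ) atTop (𝓝[Ω] p) :=
      tendsto_nhdsWithin_iff.2 ⟨hlim, .of_forall fun n => hxΩ _⟩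
    have h4 := ((hH p hp i (le_antisymm h1 h2)).comp h3).abs
    rw [abs_zero] at h4
    obtain ⟨n, hn⟩ := (h4.eventually_lt_const hε).exists
    exact absurd hn (not_lt.2 (hxH (φ n)).le)
  obtain ⟨δ₀, h0, h0'⟩ := key 0
  obtain ⟨δ₁, h1, h1'⟩ := key 1
  exact ⟨min δ₀ δ₁, lt_min h0 h1, fun x hx => Fin.forall_fin_two.2
    ⟨fun h => h0' x hx (h.trans (min_le_left _ _)), fun h => h1' x hx (h.trans (min_le_right _ _))⟩⟩

lemma MemW012.ae_gradient_eq_zero {U : Set Plane} (hU : MeasurableSet U) {u : Plane → ℝ}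
    {g : Plane → Plane} (h : MemW012 U u g) : ∀ᵐ x, x ∉ U → g x = 0 := by
  obtain ⟨hu, hg, φ, hφ, h1, h2⟩ := h
  have hm : MemLp (Uᶜ.indicator g) 2 volume := hg.indicator hU.compl
  have hz : MemLp (fun _ : Plane => (0 : Plane)) 2 volume := MemLp.zero'
  have h3 : L2Tendsto (fun _ _ => (0 : Plane)) (Uᶜ.indicator g) := by
    refine L2Tendsto.of_le h2 1 fun n => .of_forall fun x => ?_
    by_cases hx : x ∈ U
    · simp [hx]
    · have : gradient (φ n) x = 0 := image_eq_zero_of_notMem_tsupport fun h =>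
        hx ((hφ n).2.2 (tsupport_gradient_subset _ h))
      simp [hx, this]
  have h4 : Uᶜ.indicator g =ᵐ[volume] fun _ => (0 : Plane) :=
    h3.ae_eq (fun _ => hz) hm hz (l2Tendsto_const _)
  filter_upwards [h4] with x hx hxU
  rwa [Set.indicator_of_mem hxU] at hx

lemma IsLipschitzSolution.closedBall_center_subset (h : IsLipschitzSolution j T u g)
    (hT : 2 ≤ T) : Metric.closedBall (center 0) (1 / 5) ⊆ {x | 0 < u x} := by
  intro x hx
  have hxC := MPQD.closedBall_center_subset hx
  rw [Metric.mem_closedBall, dist_eq_norm] at hx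
  have hn : ‖x‖ ≤ 6 / 5 := by
    have := norm_add_le (x - center 0) (center 0)
    rw [sub_add_cancel, norm_center_zero] at this
    linarith
  exact (subsolution_pos (mem_cone_zero.1 hxC) (by linarith)).trans_le
    (h.subsolution_le x ⟨hxC, mem_ball_zero_iff.2 (by linarith)⟩)

lemma IsLipschitzSolution.load_eq_zero (h : IsLipschitzSolution j T u g) (hT : 2 ≤ T)
    {x : Plane} (hx : ¬0 < u x) : load j x = 0 :=
  load_of_notMem fun hxB => hx (h.closedBall_center_subset hT (Metric.ball_subset_closedBall hxB))

lemma IsLipschitzSolution.volume_lt_top (h : IsLipschitzSolution j T u g) :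
    volume {x | 0 < u x} < ⊤ := h.isBounded.measure_lt_top

/-- The weak form of the equation of `u`. -/
lemma IsLipschitzSolution.integral_inner_gradient (h : IsLipschitzSolution j T u g) (hj : 0 ≤ j)
    (hT : 2 ≤ T) {φ : Plane → ℝ} (hφ : IsTestFunction (cone 0) φ) :
    ∫ x, inner ℝ (g x) (gradient φ x) =
      ∫ x, {x | 0 < u x}.indicator (fun x => load j x - 1) x * φ x := by
  have hm : MeasurableSet {x | 0 < u x} := h.isOpen.measurableSet
  have h1 := h.mem.integral_mul_laplacian (hφ.mono (Set.subset_univ _))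
  have hLi : Integrable (Laplacian.laplacian φ) :=
    (continuous_laplacian hφ.contDiff_two).integrable_of_hasCompactSupport
      (hasCompactSupport_laplacian hφ.2.1)
  have h2 := h.green hj hT (H := φ) hφ.contDiff_two.contDiffOn hφ.integrable.integrableOn
    hLi.integrableOn fun ε hε => exists_side_bound h.isBounded (fun x hx => h.mem_cone hx)
      (fun x hx i hi => by
        have : φ x = 0 := hφ.eq_zero fun hC => (mem_cone_zero.1 hC i).ne' hi
        rw [← this]
        exact (hφ.continuous.tendsto x).mono_left nhdsWithin_le_nhds) hε
  have h3 := setIntegral_eq_integral_of_forall_compl_eq_zero (μ := volume) (s := {x | 0 < u x})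
    (f := fun x => u x * Laplacian.laplacian φ x) (fun x hx => by
      rw [le_antisymm (not_lt.1 hx) (h.nonneg x), zero_mul])
  rw [h3, h1, ← integral_indicator hm] at h2
  rw [neg_eq_iff_eq_neg.1 h2, ← integral_neg]
  congr 1
  funext x
  by_cases hx : x ∈ {x | 0 < u x}
  · rw [Set.indicator_of_mem hx, Set.indicator_of_mem hx]
    ring
  · rw [Set.indicator_of_notMem hx, Set.indicator_of_notMem hx]
    ring

lemma IsLipschitzSolution.integral_inner_competitor (h : IsLipschitzSolution j T u g)
    (hj : 0 ≤ j) (hT : 2 ≤ T) {v : Plane → ℝ} {g' : Plane → Plane} (hv : MemW012 (cone 0) v g') :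
    ∫ x, inner ℝ (g x) (g' x) =
      ∫ x, {x | 0 < u x}.indicator (fun x => load j x - 1) x * v x := by
  have hm : MeasurableSet {x | 0 < u x} := h.isOpen.measurableSet
  have ha : MemLp ({x | 0 < u x}.indicator fun x => load j x - 1) 2 volume := by
    have : ({x | 0 < u x}.indicator fun x => load j x - 1) = fun x =>
        {x | 0 < u x}.indicator (load j) x - {x | 0 < u x}.indicator (fun _ => 1) x := by
      funext x
      by_cases hx : x ∈ {x | 0 < u x}
      · simp only [Set.indicator_of_mem hx]
      · simp only [Set.indicator_of_notMem hx, sub_zero]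
    rw [this]
    exact ((memLp_load j).indicator hm).sub
      (memLp_indicator_const 2 hm 1 (Or.inr h.volume_lt_top.ne))
  obtain ⟨hv1, hg', φ, hφ, hφ1, hφ2⟩ := hv
  have t1 := L2Tendsto.integral_inner (fun _ => h.mem.2.1) h.mem.2.1
    (fun n => (hφ n).memLp_gradient) hg' (l2Tendsto_const _) hφ2
  have t2 := L2Tendsto.integral_mul (fun _ => ha) ha (fun n => (hφ n).memLp) hv1
    (l2Tendsto_const _) hφ1
  exact tendsto_nhds_unique t1 (t2.congr fun n => (h.integral_inner_gradient hj hT (hφ n)).symm)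

lemma force_eq (j : ℝ) (x : Plane) : force j x = load j x - 1 := by
  rw [force, load]
  ring

lemma energy_eq {v : Plane → ℝ} {g' : Plane → Plane}
    (hv : IsCompetitor (cone 0) (force j) v g') :
    Integrable (fun x => (load j x - 1) * v x) ∧
      energy (cone 0) (force j) v g' =
        1 / 2 * (∫ x, ‖g' x‖ ^ 2) - ∫ x, (load j x - 1) * v x := by
  have hCm : MeasurableSet (cone 0) := isOpen_cone_zero.measurableSet
  have h0 := hv.1.ae_eq_zero hCm
  have h1 := hv.1.ae_gradient_eq_zero hCm
  have hint : IntegrableOn (fun x => (load j x - 1) * v x) (cone 0) := by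
    simpa only [force_eq] using hv.2.2
  have hint' : Integrable (fun x => (load j x - 1) * v x) := by
    refine ((integrable_indicator_iff hCm).2 hint).congr ?_
    filter_upwards [h0] with x hx
    by_cases hxC : x ∈ cone 0
    · rw [Set.indicator_of_mem hxC]
    · rw [Set.indicator_of_notMem hxC, hx hxC, mul_zero]
  have hg := integrable_norm_sq hv.1.2.1
  refine ⟨hint', ?_⟩
  simp only [energy, force_eq]
  rw [integral_sub (hg.integrableOn.const_mul _) hint, integral_const_mul,
    setIntegral_eq_integral_of_ae_compl_eq_zero (f := fun x => ‖g' x‖ ^ 2)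
      (by filter_upwards [h1] with x hx hxC; simp [hx hxC]),
    setIntegral_eq_integral_of_ae_compl_eq_zero (f := fun x => (load j x - 1) * v x)
      (by filter_upwards [h0] with x hx hxC; simp [hx hxC])]

theorem IsLipschitzSolution.isObstacleMinimizer (h : IsLipschitzSolution j T u g) (hj : 0 ≤ j)
    (hT : 2 ≤ T) : IsObstacleMinimizer (cone 0) (force j) u := by
  have hu : MemW012 (cone 0) u g := h.mem.mono Set.inter_subset_left
  have hind : ∀ x, {x | 0 < u x}.indicator (fun x => load j x - 1) x * u x =
      (load j x - 1) * u x := fun x => by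
    by_cases hx : x ∈ {x | 0 < u x}
    · rw [Set.indicator_of_mem hx]
    · rw [le_antisymm (not_lt.1 hx) (h.nonneg x), mul_zero, mul_zero]
  have hcomp : IsCompetitor (cone 0) (force j) u g := by
    refine ⟨hu, .of_forall h.nonneg, Integrable.integrableOn ?_⟩
    have hui : Integrable u := h.continuous.integrable_of_hasCompactSupport
      (HasCompactSupport.intro h.isBounded.isCompact_closure fun x hx =>
        le_antisymm (not_lt.1 fun hpos => hx (subset_closure hpos)) (h.nonneg x))
    have : (fun x => force j x * u x) = fun x => load j x * u x - u x := by
      funext x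
      rw [force_eq]
      ring
    rw [this]
    exact (integrable_mul_of_memLp (memLp_load j) h.mem.1).sub hui
  refine ⟨g, hcomp, fun v g' hv => ?_⟩
  obtain ⟨-, e1⟩ := energy_eq hcomp
  obtain ⟨hiv, e2⟩ := energy_eq hv
  have a1 := h.integral_inner_competitor hj hT hu
  have a2 := h.integral_inner_competitor hj hT hv.1
  simp only [hind, real_inner_self_eq_norm_sq] at a1
  have hle : ∫ x, (load j x - 1) * v x ≤
      ∫ x, {x | 0 < u x}.indicator (fun x => load j x - 1) x * v x := by
    have hm : MeasurableSet {x | 0 < u x} := h.isOpen.measurableSet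
    refine integral_mono_ae hiv ?_ ?_
    · refine (hiv.indicator hm).congr (.of_forall fun x => ?_)
      by_cases hx : x ∈ {x | 0 < u x}
      · simp only [Set.indicator_of_mem hx]
      · simp only [Set.indicator_of_notMem hx, zero_mul]
    · filter_upwards [hv.2.1] with x hx
      by_cases hxu : x ∈ {x | 0 < u x}
      · rw [Set.indicator_of_mem hxu]
      · rw [Set.indicator_of_notMem hxu, h.load_eq_zero hT hxu]
        linarith
  have hg := integrable_norm_sq h.mem.2.1
  have hg' := integrable_norm_sq hv.1.2.1
  have hgg' := integrable_inner_of_memLp h.mem.2.1 hv.1.2.1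
  have hcs : ∫ x, inner ℝ (g x) (g' x) ≤
      1 / 2 * (∫ x, ‖g x‖ ^ 2) + 1 / 2 * ∫ x, ‖g' x‖ ^ 2 := by
    rw [← integral_const_mul, ← integral_const_mul,
      ← integral_add (hg.const_mul _) (hg'.const_mul _)]
    refine integral_mono hgg' ((hg.const_mul _).add (hg'.const_mul _)) fun x => ?_
    have h1 := real_inner_le_norm (g x) (g' x)
    change inner ℝ (g x) (g' x) ≤ 1 / 2 * ‖g x‖ ^ 2 + 1 / 2 * ‖g' x‖ ^ 2
    nlinarith [sq_nonneg (‖g x‖ - ‖g' x‖)]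
  linarith

lemma mollify_one_sub_load {n : ℕ} {x : Plane}
    (hx : Disjoint (Metric.ball x (radius n)) (Metric.ball (center 0) (1 / 5))) :
    mollify n (fun x => 1 - load j x) x = 1 := by
  have hl : ∀ t ∈ Metric.ball x (radius n), load j t = 0 := fun t ht =>
    load_of_notMem fun ht' => Set.disjoint_left.1 hx ht ht'
  exact le_antisymm
    (mollify_le (locallyIntegrable_one_sub_load j) (.of_forall fun t ht => by rw [hl t ht, sub_zero]))
    (le_mollify (locallyIntegrable_one_sub_load j) (.of_forall fun t ht => by rw [hl t ht, sub_zero]))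

/-- Away from the load, `u` has no local maximum in its positivity set. -/
lemma IsLipschitzSolution.exists_gt (h : IsLipschitzSolution j T u g) (hT : 2 ≤ T) {p : Plane}
    {s : ℝ} (hs : 0 < s) (hp : Metric.ball p s ⊆ {x | 0 < u x})
    (hd : Disjoint (Metric.ball p s) (Metric.ball (center 0) (1 / 5))) :
    ∃ y ∈ Metric.ball p s, u p < u y := by
  by_contra! hmax
  have hloc := h.mem.locallyIntegrable
  set c1 := ∫ y, kernel 1 y with hc1
  set c2 := ∫ y, kernel 2 y
  have hc1p : 0 < c1 := integral_kernel_pos 0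
  have hc2p : 0 < c2 := integral_kernel_pos 1
  have hev : ∀ᶠ n in atTop, mollify n u p * c1 + (s / 2) ^ 2 / 8 * c2 ≤ u p * c1 := by
    filter_upwards [tendsto_radius.eventually_lt_const (half_pos hs)] with n hn
    have hv : ContDiff ℝ ∞ (mollify n u) := contDiff_mollify hloc
    have hsub : ∀ y ∈ Metric.ball p (s / 2), Metric.closedBall y (radius n) ⊆ Metric.ball p s :=
      fun y hy z hz => by
        rw [Metric.mem_ball] at hy ⊢
        rw [Metric.mem_closedBall] at hz
        linarith [dist_triangle z y p]
    have h1 := le_average (hv.of_le two_le_infty) (x := p) (Λ := 1) (half_pos hs) (fun y hy => by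
      rw [h.laplacian_mollify hT ((hsub y hy).trans hp), mollify_one_sub_load
        (hd.mono_left (Metric.ball_subset_closedBall.trans (hsub y hy)))]) 0
    have h2 : ∫ y, mollify n u (p + (s / 2) • y) * kernel (0 + 1) y ≤
        ∫ y, u p * kernel (0 + 1) y := by
      refine integral_mono (integrable_mul_kernel (hv.continuous.comp (by fun_prop)) 0)
        (integrable_mul_kernel continuous_const 0) fun y => ?_
      by_cases hy : ‖y‖ < 1
      · refine mul_le_mul_of_nonneg_right (mollify_le hloc (.of_forall fun t ht => hmax t ?_))
          (kernel_nonneg _ _)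
        refine hsub (p + (s / 2) • y) ?_ (Metric.ball_subset_closedBall ht)
        rw [mem_ball_iff_norm, add_sub_cancel_left, norm_smul, Real.norm_of_nonneg (by positivity)]
        nlinarith
      · simp only [kernel_eq_zero (m := 0) (not_lt.1 hy), mul_zero, le_refl]
    rw [integral_const_mul] at h2
    norm_num at h1 h2
    have h3 : (s / 2) ^ 2 / 8 * c2 = (s / 2) ^ 2 / 8 * ∫ y, kernel 2 y := rfl
    norm_num at h3
    linarith
  have hlim := le_of_tendsto (((tendsto_mollify h.lipschitz p).mul_const c1).add_const
    ((s / 2) ^ 2 / 8 * c2)) hev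
  have : 0 < (s / 2) ^ 2 / 8 * c2 := by positivity
  linarith

theorem IsLipschitzSolution.isConnected (h : IsLipschitzSolution j T u g) (hT : 2 ≤ T) :
    IsConnected {x | 0 < u x} := by
  set Ω := {x | 0 < u x} with hΩ
  have hB : Metric.ball (center 0) (1 / 5) ⊆ Ω :=
    Metric.ball_subset_closedBall.trans (h.closedBall_center_subset hT)
  have hc : center 0 ∈ Metric.ball (center 0) (1 / 5 : ℝ) := Metric.mem_ball_self (by norm_num)
  have key : ∀ x ∈ Ω, x ∈ connectedComponentIn Ω (center 0) := by
    intro x hx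
    by_contra hxc
    set W := connectedComponentIn Ω x with hW
    have hWo : IsOpen W := h.isOpen.connectedComponentIn
    have hWΩ : W ⊆ Ω := connectedComponentIn_subset _ _
    have hd : Disjoint W (Metric.ball (center 0) (1 / 5)) := by
      rw [Set.disjoint_left]
      intro y hyW hyB
      have h1 := (convex_ball (center 0) (1 / 5 : ℝ)).isPreconnected.subset_connectedComponentIn
        hyB hB hc
      rw [← connectedComponentIn_eq hyW] at h1
      apply hxc
      rw [← connectedComponentIn_eq h1]
      exact mem_connectedComponentIn hx
    obtain ⟨p, hp, hmax⟩ := (h.isBounded.subset hWΩ).isCompact_closure.exists_isMaxOn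
      ⟨x, subset_closure (mem_connectedComponentIn hx)⟩ h.continuous.continuousOn
    have hpΩ : p ∈ Ω :=
      lt_of_lt_of_le (show 0 < u x from hx) (hmax (subset_closure (mem_connectedComponentIn hx)))
    have hpW : p ∈ W := by
      have hn : connectedComponentIn Ω p ∈ 𝓝 p :=
        h.isOpen.connectedComponentIn.mem_nhds (mem_connectedComponentIn hpΩ)
      obtain ⟨y, hyp, hyW⟩ := mem_closure_iff_nhds.1 hp _ hn
      rw [hW, connectedComponentIn_eq hyW, ← connectedComponentIn_eq hyp]
      exact mem_connectedComponentIn hpΩ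
    obtain ⟨s, hs, hsW⟩ := Metric.isOpen_iff.1 hWo p hpW
    obtain ⟨y, hy, hlt⟩ := h.exists_gt hT hs (hsW.trans hWΩ) (hd.mono_left hsW)
    exact absurd (hmax (subset_closure (hsW hy))) (not_le.2 hlt)
  have heq : Ω = connectedComponentIn Ω (center 0) :=
    Set.Subset.antisymm key (connectedComponentIn_subset _ _)
  rw [heq]
  exact isConnected_connectedComponentIn_iff.2 (hB hc)

end

/-! ### The reflected solutions -/

lemma laplacian_comp_isometry (f : Plane → ℝ) (a : Plane ≃ₗᵢ[ℝ] Plane) (x : Plane) :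
    Laplacian.laplacian (fun x => f (a x)) x = Laplacian.laplacian f (a x) := by
  have h := a.toContinuousLinearEquiv.iteratedFDerivWithin_comp_right (f := f) (s := Set.univ)
    uniqueDiffOn_univ (x := x) (Set.mem_univ _) 2
  rw [Set.preimage_univ, iteratedFDerivWithin_univ, iteratedFDerivWithin_univ] at h
  have h' : iteratedFDeriv ℝ 2 (fun x => f (a x)) x = _ := h
  rw [InnerProductSpace.laplacian_eq_iteratedFDeriv_orthonormalBasis f
      ((EuclideanSpace.basisFun (Fin 2) ℝ).map a),
    InnerProductSpace.laplacian_eq_iteratedFDeriv_orthonormalBasis _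
      (EuclideanSpace.basisFun (Fin 2) ℝ)]
  refine Finset.sum_congr rfl fun i _ => ?_
  rw [h', ContinuousMultilinearMap.compContinuousLinearMap_apply]
  congr 1
  funext k
  fin_cases k <;> simp

lemma setIntegral_comp_isometry (f : Plane → ℝ) (a : Plane ≃ₗᵢ[ℝ] Plane) (s : Set Plane) :
    ∫ x in a ⁻¹' s, f (a x) = ∫ x in s, f x :=
  a.measurePreserving.setIntegral_preimage_emb a.toHomeomorph.measurableEmbedding f s

lemma integrableOn_comp_isometry {f : Plane → ℝ} (a : Plane ≃ₗᵢ[ℝ] Plane) {s : Set Plane}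
    (hf : IntegrableOn f s) : IntegrableOn (fun x => f (a x)) (a ⁻¹' s) :=
  (a.measurePreserving.integrableOn_comp_preimage a.toHomeomorph.measurableEmbedding).2 hf

/-- The isometries mapping the three cones to `cone 0`. -/
noncomputable def foldMap : Fin 3 → Plane ≃ₗᵢ[ℝ] Plane :=
  ![.refl ℝ Plane, (Submodule.span ℝ {polarPoint 1 (2 * Real.pi / 3)}).reflection,
    (Submodule.span ℝ {polarPoint 1 0}).reflection]

lemma foldMap_zero (x : Plane) : foldMap 0 x = x := rfl

lemma foldMap_one (x : Plane) : foldMap 1 x = rayReflection (2 * Real.pi / 3) x := rfl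

lemma foldMap_two (x : Plane) : foldMap 2 x = rayReflection 0 x := rfl

lemma foldMap_foldMap (i : Fin 3) (x : Plane) : foldMap i (foldMap i x) = x := by
  fin_cases i
  · rfl
  · exact Submodule.reflection_reflection _ _
  · exact Submodule.reflection_reflection _ _

lemma reflectedTriple_apply (u : Plane → ℝ) (i : Fin 3) (x : Plane) :
    reflectedTriple u i x = u (foldMap i x) := by
  fin_cases i <;> rfl

lemma polarPoint_add_two_pi (r t : ℝ) : polarPoint r (t + 2 * Real.pi) = polarPoint r t := by
  simp [polarPoint]

lemma foldMap_center (i : Fin 3) : foldMap i (center i) = center 0 := by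
  fin_cases i
  · rfl
  · change rayReflection (2 * Real.pi / 3) (polarPoint 1 _) = polarPoint 1 _
    rw [rayReflection_polarPoint]
    congr 1
    simp
    ring
  · change rayReflection 0 (polarPoint 1 _) = polarPoint 1 _
    rw [rayReflection_polarPoint, ← polarPoint_add_two_pi]
    congr 1
    simp
    ring

lemma foldMap_center_zero (i : Fin 3) : foldMap i (center 0) = center i := by
  rw [← foldMap_center i, foldMap_foldMap]

lemma foldMap_mem_cone {i : Fin 3} {x : Plane} (hx : x ∈ cone i) : foldMap i x ∈ cone 0 := by
  obtain ⟨r, t, hr, h1, h2, rfl⟩ := hx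
  fin_cases i
  · exact ⟨r, t, hr, h1, h2, rfl⟩
  · simp at h1 h2
    change rayReflection (2 * Real.pi / 3) (polarPoint r t) ∈ _
    rw [rayReflection_polarPoint]
    refine ⟨r, _, hr, ?_, ?_, rfl⟩
    · simp
      linarith
    · simp
      linarith
  · simp at h1 h2
    change rayReflection 0 (polarPoint r t) ∈ _
    rw [rayReflection_polarPoint, ← polarPoint_add_two_pi]
    refine ⟨r, _, hr, ?_, ?_, rfl⟩
    · simp
      linarith
    · simp
      linarith

lemma cos_four_pi_div_three : Real.cos (2 * (2 * Real.pi / 3)) = -(1 / 2) := by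
  rw [show 2 * (2 * Real.pi / 3) = Real.pi / 3 + Real.pi by ring, Real.cos_add_pi,
    Real.cos_pi_div_three]

lemma sin_four_pi_div_three : Real.sin (2 * (2 * Real.pi / 3)) = -(√3 / 2) := by
  rw [show 2 * (2 * Real.pi / 3) = Real.pi / 3 + Real.pi by ring, Real.sin_add_pi,
    Real.sin_pi_div_three]

lemma side_zero_foldMap_one (x : Plane) : side 0 (foldMap 1 x) = side 0 x - side 1 x := by
  rw [foldMap_one, side_zero, rayReflection_apply_one, cos_four_pi_div_three,
    sin_four_pi_div_three, side_zero, side_one]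
  ring

lemma side_one_foldMap_one (x : Plane) : side 1 (foldMap 1 x) = -side 1 x := by
  rw [foldMap_one, side_one, rayReflection_apply_one, rayReflection_apply_zero,
    cos_four_pi_div_three, sin_four_pi_div_three, side_one]
  linear_combination (-(x 1) / 4) * sqrt_three_sq

lemma side_zero_foldMap_two (x : Plane) : side 0 (foldMap 2 x) = -side 0 x := by
  rw [foldMap_two, side_zero, rayReflection_apply_one, side_zero]
  simp

lemma side_one_foldMap_two (x : Plane) : side 1 (foldMap 2 x) = side 1 x - side 0 x := by
  rw [foldMap_two, side_one, rayReflection_apply_one, rayReflection_apply_zero, side_zero, side_one]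
  simp
  ring

lemma eq_of_foldMap_mem_cone {i l : Fin 3} {x : Plane} (hi : foldMap i x ∈ cone 0)
    (hl : foldMap l x ∈ cone 0) : i = l := by
  rw [mem_cone_zero, Fin.forall_fin_two] at hi hl
  have h0 := foldMap_zero x
  have h1 := side_zero_foldMap_one x
  have h2 := side_one_foldMap_one x
  have h3 := side_zero_foldMap_two x
  have h4 := side_one_foldMap_two x
  fin_cases i <;> fin_cases l <;> first | rfl | (exfalso; simp [h0, h1, h2, h3, h4] at hi hl; linarith [hi.1, hi.2, hl.1, hl.2])

lemma side_ext {x y : Plane} (h : ∀ i, side i x = side i y) : x = y := by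
  have h0 := h 0
  have h1 := h 1
  simp only [side_zero, side_one] at h0 h1
  have h3 : (0 : ℝ) < √3 := Real.sqrt_pos.2 (by norm_num)
  refine plane_ext (mul_left_cancel₀ h3.ne' ?_) h0
  linarith

lemma foldMap_one_of_side {x : Plane} (hx : side 1 x = 0) : foldMap 1 x = x :=
  side_ext (Fin.forall_fin_two.2 ⟨by rw [side_zero_foldMap_one, hx, sub_zero],
    by rw [side_one_foldMap_one, hx, neg_zero]⟩)

lemma foldMap_two_of_side {x : Plane} (hx : side 0 x = 0) : foldMap 2 x = x :=
  side_ext (Fin.forall_fin_two.2 ⟨by rw [side_zero_foldMap_two, hx, neg_zero],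
    by rw [side_one_foldMap_two, hx, sub_zero]⟩)

lemma foldMap_two_axisReflection {x : Plane} (hx : side 0 x = 0) :
    foldMap 2 (axisReflection x) = foldMap 1 x :=
  side_ext (Fin.forall_fin_two.2 ⟨by
    rw [side_zero_foldMap_two, side_zero_foldMap_one, side_zero_axisReflection, hx, zero_sub], by
    rw [side_one_foldMap_two, side_one_foldMap_one, side_zero_axisReflection,
      side_one_axisReflection, hx, zero_sub]⟩)

lemma foldMap_one_axisReflection {x : Plane} (hx : side 1 x = 0) :
    foldMap 1 (axisReflection x) = foldMap 2 x := by
  have := foldMap_two_axisReflection (x := axisReflection x)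
    (by rw [side_zero_axisReflection, hx])
  rw [axisReflection_axisReflection] at this
  exact this.symm

/-- Two isometries onto the phases `i` and `l`, which agree on one side of the cone and map the
other side to the boundary of the third phase. -/
structure IsGluing (i l : Fin 3) (a b : Plane ≃ₗᵢ[ℝ] Plane) : Prop where
  left : ∀ x, foldMap i (a x) = x ∨ foldMap i (a x) = axisReflection x
  right : ∀ x, foldMap l (b x) = x ∨ foldMap l (b x) = axisReflection x
  center_left : a (center 0) = center i
  center_right : b (center 0) = center l
  side : ∀ s : Fin 2, (∀ x, MPQD.side s x = 0 → a x = b x) ∨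
    ∃ (k : Fin 3) (c d : Plane ≃ₗᵢ[ℝ] Plane), k ≠ i ∧ k ≠ l ∧
      (∀ x, foldMap k (c x) = x ∨ foldMap k (c x) = axisReflection x) ∧
      (∀ x, foldMap k (d x) = x ∨ foldMap k (d x) = axisReflection x) ∧
      ∀ x, MPQD.side s x = 0 → a x = c x ∧ b x = d x

lemma IsGluing.swap {i l : Fin 3} {a b : Plane ≃ₗᵢ[ℝ] Plane} (h : IsGluing i l a b) :
    IsGluing l i b a where
  left := h.right
  right := h.left
  center_left := h.center_right
  center_right := h.center_left
  side s := by
    rcases h.side s with h | ⟨k, c, d, hi, hl, hc, hd, hs⟩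
    · exact Or.inl fun x hx => (h x hx).symm
    · exact Or.inr ⟨k, d, c, hl, hi, hd, hc, fun x hx => (hs x hx).symm⟩

lemma exists_isGluing {i l : Fin 3} (hil : i ≠ l) : ∃ a b, IsGluing i l a b := by
  have hσ : ∀ k x, (axisReflection.trans (foldMap k)) x = foldMap k (axisReflection x) :=
    fun k x => rfl
  have h1 : ∀ k x, foldMap k (foldMap k x) = x ∨ foldMap k (foldMap k x) = axisReflection x :=
    fun k x => Or.inl (foldMap_foldMap k x)
  have h2 : ∀ k x, foldMap k ((axisReflection.trans (foldMap k)) x) = x ∨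
      foldMap k ((axisReflection.trans (foldMap k)) x) = axisReflection x :=
    fun k x => Or.inr (foldMap_foldMap k _)
  have h3 : ∀ k, (axisReflection.trans (foldMap k)) (center 0) = center k := fun k => by
    rw [hσ, axisReflection_center, foldMap_center_zero]
  have g01 : IsGluing 0 1 (foldMap 0) (foldMap 1) := by
    refine ⟨h1 0, h1 1, foldMap_center_zero 0, foldMap_center_zero 1, Fin.forall_fin_two.2 ⟨?_, ?_⟩⟩
    · refine Or.inr ⟨2, foldMap 2, axisReflection.trans (foldMap 2), by decide, by decide, h1 2,
        h2 2, fun x hx => ⟨(foldMap_two_of_side hx).symm, (foldMap_two_axisReflection hx).symm⟩⟩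
    · exact Or.inl fun x hx => (foldMap_one_of_side hx).symm
  have g02 : IsGluing 0 2 (foldMap 0) (foldMap 2) := by
    refine ⟨h1 0, h1 2, foldMap_center_zero 0, foldMap_center_zero 2, Fin.forall_fin_two.2 ⟨?_, ?_⟩⟩
    · exact Or.inl fun x hx => (foldMap_two_of_side hx).symm
    · refine Or.inr ⟨1, foldMap 1, axisReflection.trans (foldMap 1), by decide, by decide, h1 1,
        h2 1, fun x hx => ⟨(foldMap_one_of_side hx).symm, (foldMap_one_axisReflection hx).symm⟩⟩
  have g12 : IsGluing 1 2 (foldMap 1) (axisReflection.trans (foldMap 2)) := by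
    refine ⟨h1 1, h2 2, foldMap_center_zero 1, h3 2, Fin.forall_fin_two.2 ⟨?_, ?_⟩⟩
    · exact Or.inl fun x hx => (foldMap_two_axisReflection hx).symm
    · refine Or.inr ⟨0, foldMap 0, axisReflection.trans (foldMap 0), by decide, by decide, h1 0,
        h2 0, fun x hx => ⟨foldMap_one_of_side hx, ?_⟩⟩
      exact foldMap_two_of_side ((side_zero_axisReflection x).trans hx)
  fin_cases i <;> fin_cases l
  · exact absurd rfl hil
  · exact ⟨_, _, g01⟩
  · exact ⟨_, _, g02⟩
  · exact ⟨_, _, g01.swap⟩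
  · exact absurd rfl hil
  · exact ⟨_, _, g12⟩
  · exact ⟨_, _, g02.swap⟩
  · exact ⟨_, _, g12.swap⟩
  · exact absurd rfl hil

section

variable {j T : ℝ} {u : Plane → ℝ} {g : Plane → Plane} {i l : Fin 3} {a b : Plane ≃ₗᵢ[ℝ] Plane}

lemma support_phaseMeasure_subset (j : ℝ) (i : Fin 3) :
    (phaseMeasure j i).support ⊆ Metric.closedBall (center i) (1 / 5) := by
  intro x hx
  by_contra hxc
  have h1 := (Measure.mem_support_iff_forall x).1 hx _
    (Metric.isClosed_closedBall.isOpen_compl.mem_nhds hxc)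
  have h2 : (Metric.closedBall (center i) (1 / 5))ᶜ ∩ Metric.ball (center i) (1 / 5) = ∅ := by
    rw [← Set.disjoint_iff_inter_eq_empty]
    exact Set.disjoint_left.2 fun y hy hyb => hy (Metric.ball_subset_closedBall hyb)
  rw [phaseMeasure, Measure.smul_apply,
    Measure.restrict_apply Metric.isClosed_closedBall.measurableSet.compl, h2] at h1
  simp at h1

lemma isFiniteMeasure_phaseMeasure (j : ℝ) (i : Fin 3) : IsFiniteMeasure (phaseMeasure j i) := by
  constructor
  rw [phaseMeasure, Measure.smul_apply, Measure.restrict_apply_univ, smul_eq_mul]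
  exact ENNReal.mul_lt_top ENNReal.ofReal_lt_top Metric.isBounded_ball.measure_lt_top

lemma integral_phaseMeasure (hj : 0 ≤ j) (f : Plane → ℝ) :
    ∫ x, f x ∂phaseMeasure j i = j * ∫ x in Metric.ball (center i) (1 / 5), f x := by
  rw [phaseMeasure, integral_smul_measure, ENNReal.toReal_ofReal hj, smul_eq_mul]

lemma IsLipschitzSolution.reflectedTriple_eq (h : IsLipschitzSolution j T u g)
    (ha : ∀ x, foldMap i (a x) = x ∨ foldMap i (a x) = axisReflection x) (x : Plane) :
    reflectedTriple u i (a x) = u x := by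
  rw [reflectedTriple_apply]
  rcases ha x with h1 | h1
  · rw [h1]
  · rw [h1, h.symm]

lemma IsLipschitzSolution.preimage_eq (h : IsLipschitzSolution j T u g)
    (ha : ∀ x, foldMap i (a x) = x ∨ foldMap i (a x) = axisReflection x) :
    a ⁻¹' {x | 0 < reflectedTriple u i x} = {x | 0 < u x} := by
  ext x
  simp only [Set.mem_preimage, Set.mem_ofPred_eq, h.reflectedTriple_eq ha]

lemma IsLipschitzSolution.continuous_reflectedTriple (h : IsLipschitzSolution j T u g)
    (i : Fin 3) : Continuous (reflectedTriple u i) := by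
  have : reflectedTriple u i = fun x => u (foldMap i x) := funext (reflectedTriple_apply u i)
  rw [this]
  exact h.continuous.comp (foldMap i).continuous

lemma IsLipschitzSolution.isOpen_phase (h : IsLipschitzSolution j T u g) (i : Fin 3) :
    IsOpen {x | 0 < reflectedTriple u i x} :=
  isOpen_lt continuous_const (h.continuous_reflectedTriple i)

lemma IsLipschitzSolution.mem_frontier (h : IsLipschitzSolution j T u g)
    (ha : ∀ x, foldMap i (a x) = x ∨ foldMap i (a x) = axisReflection x) {x : Plane}
    (hx : x ∈ closure {x | 0 < u x}) {s : Fin 2} (hs : side s x = 0) :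
    a x ∈ frontier {x | 0 < reflectedTriple u i x} := by
  rw [(h.isOpen_phase i).frontier_eq]
  refine ⟨map_mem_closure a.continuous hx fun y hy => ?_, fun hx' => ?_⟩
  · change 0 < reflectedTriple u i (a y)
    rwa [h.reflectedTriple_eq ha]
  · change 0 < reflectedTriple u i (a x) at hx'
    rw [h.reflectedTriple_eq ha] at hx'
    exact (mem_cone_zero.1 (h.mem_cone hx') s).ne' hs

lemma IsLipschitzSolution.integral_phaseMeasure_eq (h : IsLipschitzSolution j T u g)
    (hj : 0 ≤ j) (hT : 2 ≤ T) (ha : a (center 0) = center i) (f : Plane → ℝ) :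
    ∫ x, f x ∂phaseMeasure j i = ∫ x in {x | 0 < u x}, f (a x) * load j x := by
  have hB : Metric.ball (center 0) (1 / 5) ⊆ {x | 0 < u x} :=
    Metric.ball_subset_closedBall.trans (h.closedBall_center_subset hT)
  have hpre : a ⁻¹' Metric.ball (center i) (1 / 5) = Metric.ball (center 0) (1 / 5) := by
    ext x
    rw [Set.mem_preimage, Metric.mem_ball, Metric.mem_ball, ← ha, a.dist_map]
  have hload : ∀ x, f (a x) * load j x =
      (Metric.ball (center 0) (1 / 5)).indicator (fun x => j * f (a x)) x := fun x => by
    by_cases hx : x ∈ Metric.ball (center 0) (1 / 5)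
    · rw [load_of_mem hx, Set.indicator_of_mem hx, mul_comm]
    · rw [load_of_notMem hx, Set.indicator_of_notMem hx, mul_zero]
  rw [integral_phaseMeasure hj, ← setIntegral_comp_isometry f a, hpre]
  simp only [hload]
  rw [setIntegral_indicator measurableSet_ball, Set.inter_eq_right.2 hB, integral_const_mul]

/-- The quadrature identity for a pair of phases, in terms of `a` and `b`. -/
lemma IsLipschitzSolution.pair_identity (h : IsLipschitzSolution j T u g) (hj : 0 ≤ j)
    (hT : 2 ≤ T) (hil : i ≠ l) {f : Plane → ℝ}
    (hf2 : ContDiffOn ℝ 2 f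
      ({x | 0 < reflectedTriple u i x} ∪ {x | 0 < reflectedTriple u l x}))
    (hfi : IntegrableOn f
      ({x | 0 < reflectedTriple u i x} ∪ {x | 0 < reflectedTriple u l x}))
    (hLi : IntegrableOn (Laplacian.laplacian f)
      ({x | 0 < reflectedTriple u i x} ∪ {x | 0 < reflectedTriple u l x}))
    (hfc : ContinuousOn f ({x | 0 < reflectedTriple u i x} ∪ {x | 0 < reflectedTriple u l x} ∪
      (frontier {x | 0 < reflectedTriple u i x} ∩ frontier {x | 0 < reflectedTriple u l x}) ∪
      ⋃ k ∈ {k | k ≠ i ∧ k ≠ l}, frontier {x | 0 < reflectedTriple u k x}))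
    (hf0 : ∀ k, k ≠ i → k ≠ l → ∀ x ∈ frontier {x | 0 < reflectedTriple u k x}, f x = 0) :
    (∫ x in {x | 0 < reflectedTriple u i x}, reflectedTriple u i x * Laplacian.laplacian f x) -
      ∫ x in {x | 0 < reflectedTriple u l x}, reflectedTriple u l x * Laplacian.laplacian f x =
    ((∫ x in {x | 0 < reflectedTriple u i x}, f x) -
      ∫ x in {x | 0 < reflectedTriple u l x}, f x) -
      ((∫ x, f x ∂phaseMeasure j i) - ∫ x, f x ∂phaseMeasure j l) := by
  obtain ⟨a, b, hG⟩ := exists_isGluing hil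
  set Ω := {x | 0 < u x} with hΩ
  set Ωi := {x | 0 < reflectedTriple u i x} with hΩi
  set Ωl := {x | 0 < reflectedTriple u l x} with hΩl
  have hpa : a ⁻¹' Ωi = Ω := h.preimage_eq hG.left
  have hpb : b ⁻¹' Ωl = Ω := h.preimage_eq hG.right
  have hma : ∀ x ∈ Ω, a x ∈ Ωi := fun x hx => by rwa [← Set.mem_preimage, hpa]
  have hmb : ∀ x ∈ Ω, b x ∈ Ωl := fun x hx => by rwa [← Set.mem_preimage, hpb]
  have hΩm : MeasurableSet Ω := h.isOpen.measurableSet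
  have hfa : IntegrableOn (fun x => f (a x)) Ω := by
    rw [← hpa]
    exact integrableOn_comp_isometry a (hfi.mono_set Set.subset_union_left)
  have hfb : IntegrableOn (fun x => f (b x)) Ω := by
    rw [← hpb]
    exact integrableOn_comp_isometry b (hfi.mono_set Set.subset_union_right)
  have hLa : IntegrableOn (fun x => Laplacian.laplacian f (a x)) Ω := by
    rw [← hpa]
    exact integrableOn_comp_isometry a (hLi.mono_set Set.subset_union_left)
  have hLb : IntegrableOn (fun x => Laplacian.laplacian f (b x)) Ω := by
    rw [← hpb]
    exact integrableOn_comp_isometry b (hLi.mono_set Set.subset_union_right)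
  have ca : ∀ x ∈ Ω, ContDiffAt ℝ 2 (fun x => f (a x)) x := fun x hx =>
    (hf2.contDiffAt (((h.isOpen_phase i).union (h.isOpen_phase l)).mem_nhds
      (Or.inl (hma x hx)))).comp x a.contDiff.contDiffAt
  have cb : ∀ x ∈ Ω, ContDiffAt ℝ 2 (fun x => f (b x)) x := fun x hx =>
    (hf2.contDiffAt (((h.isOpen_phase i).union (h.isOpen_phase l)).mem_nhds
      (Or.inr (hmb x hx)))).comp x b.contDiff.contDiffAt
  have hL : ∀ x ∈ Ω, Laplacian.laplacian (fun x => f (a x) - f (b x)) x =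
      Laplacian.laplacian f (a x) - Laplacian.laplacian f (b x) := fun x hx => by
    rw [← laplacian_comp_isometry, ← laplacian_comp_isometry]
    exact (ca x hx).laplacian_sub (cb x hx)
  have hbd : ∀ x ∈ closure Ω, ∀ s, side s x = 0 →
      Tendsto (fun x => f (a x) - f (b x)) (𝓝[Ω] x) (𝓝 0) := by
    intro x hx s hs
    have key : f (a x) - f (b x) = 0 ∧
        a x ∈ Ωi ∪ Ωl ∪ (frontier Ωi ∩ frontier Ωl) ∪
          ⋃ k ∈ {k | k ≠ i ∧ k ≠ l}, frontier {x | 0 < reflectedTriple u k x} ∧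
        b x ∈ Ωi ∪ Ωl ∪ (frontier Ωi ∩ frontier Ωl) ∪
          ⋃ k ∈ {k | k ≠ i ∧ k ≠ l}, frontier {x | 0 < reflectedTriple u k x} := by
      rcases hG.side s with hab | ⟨k, c, d, hki, hkl, hc, hd, hcd⟩
      · have h1 := h.mem_frontier hG.left hx hs
        have h2 := h.mem_frontier hG.right hx hs
        rw [← hab x hs] at h2 ⊢
        exact ⟨sub_self _, Or.inl (Or.inr ⟨h1, h2⟩), Or.inl (Or.inr ⟨h1, h2⟩)⟩
      · have h1 := h.mem_frontier hc hx hs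
        have h2 := h.mem_frontier hd hx hs
        rw [(hcd x hs).1, (hcd x hs).2, hf0 k hki hkl _ h1, hf0 k hki hkl _ h2]
        exact ⟨sub_self _, Or.inr (Set.mem_biUnion (⟨hki, hkl⟩ : k ≠ i ∧ k ≠ l) h1),
          Or.inr (Set.mem_biUnion (⟨hki, hkl⟩ : k ≠ i ∧ k ≠ l) h2)⟩
    obtain ⟨h0, h1, h2⟩ := key
    rw [← h0]
    refine Tendsto.sub ?_ ?_
    · exact (hfc _ h1).tendsto.comp (tendsto_nhdsWithin_iff.2
        ⟨(a.continuous.tendsto x).mono_left nhdsWithin_le_nhds,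
          eventually_nhdsWithin_of_forall fun y hy => Or.inl (Or.inl (Or.inl (hma y hy)))⟩)
    · exact (hfc _ h2).tendsto.comp (tendsto_nhdsWithin_iff.2
        ⟨(b.continuous.tendsto x).mono_left nhdsWithin_le_nhds,
          eventually_nhdsWithin_of_forall fun y hy => Or.inl (Or.inl (Or.inr (hmb y hy)))⟩)
  have hgreen := h.green hj hT (H := fun x => f (a x) - f (b x))
    (fun x hx => ((ca x hx).sub (cb x hx)).contDiffWithinAt) (hfa.sub hfb)
    ((hLa.sub hLb).congr_fun (fun x hx => (hL x hx).symm) hΩm)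
    (fun ε hε => exists_side_bound h.isBounded (fun x hx => h.mem_cone hx) hbd hε)
  have hub : ∀ x, ‖u x‖ ≤ 18 * j * T := fun x => by
    rw [Real.norm_of_nonneg (h.nonneg x)]
    exact h.le_const hj hT x
  have hlb : ∀ x, ‖load j x‖ ≤ j := fun x => by
    rw [Real.norm_of_nonneg (load_nonneg hj x)]
    exact load_le hj x
  have hlm := (measurable_load j).aestronglyMeasurable (μ := volume.restrict Ω)
  have e1 : ∫ x in Ω, u x * Laplacian.laplacian (fun x => f (a x) - f (b x)) x =
      (∫ x in Ω, u x * Laplacian.laplacian f (a x)) - ∫ x in Ω, u x * Laplacian.laplacian f (b x) := by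
    rw [← integral_sub (Integrable.bdd_mul hLa h.continuous.aestronglyMeasurable (.of_forall hub))
      (Integrable.bdd_mul hLb h.continuous.aestronglyMeasurable (.of_forall hub))]
    exact setIntegral_congr_fun hΩm fun x hx => by
      simp only [hL x hx]
      ring
  have ia : IntegrableOn (fun x => f (a x) * load j x) Ω := Integrable.mul_bdd hfa hlm (.of_forall hlb)
  have ib : IntegrableOn (fun x => f (b x) * load j x) Ω := Integrable.mul_bdd hfb hlm (.of_forall hlb)
  have e2 : ∫ x in Ω, (f (a x) - f (b x)) * (1 - load j x) =
      ((∫ x in Ω, f (a x)) - ∫ x in Ω, f (b x)) -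
        ((∫ x in Ω, f (a x) * load j x) - ∫ x in Ω, f (b x) * load j x) := by
    rw [← integral_sub hfa hfb, ← integral_sub ia ib, ← integral_sub]
    · congr 1
      funext x
      ring
    · exact hfa.sub hfb
    · exact ia.sub ib
  have e3 : ∫ x in Ωi, reflectedTriple u i x * Laplacian.laplacian f x =
      ∫ x in Ω, u x * Laplacian.laplacian f (a x) := by
    rw [← setIntegral_comp_isometry _ a, hpa]
    simp only [h.reflectedTriple_eq hG.left]
  have e4 : ∫ x in Ωl, reflectedTriple u l x * Laplacian.laplacian f x =
      ∫ x in Ω, u x * Laplacian.laplacian f (b x) := by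
    rw [← setIntegral_comp_isometry _ b, hpb]
    simp only [h.reflectedTriple_eq hG.right]
  rw [e3, e4, ← e1, hgreen, e2, h.integral_phaseMeasure_eq hj hT hG.center_left,
    h.integral_phaseMeasure_eq hj hT hG.center_right, ← setIntegral_comp_isometry f a Ωi, hpa,
    ← setIntegral_comp_isometry f b Ωl, hpb]

lemma IsLipschitzSolution.disjoint_phases (h : IsLipschitzSolution j T u g) (hil : i ≠ l) :
    Disjoint {x | 0 < reflectedTriple u i x} {x | 0 < reflectedTriple u l x} := by
  refine Set.disjoint_left.2 fun x hi hl => hil ?_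
  simp only [Set.mem_ofPred_eq, reflectedTriple_apply] at hi hl
  exact eq_of_foldMap_mem_cone (h.mem_cone hi) (h.mem_cone hl)

lemma IsLipschitzSolution.setIntegral_phase (h : IsLipschitzSolution j T u g) (f : Plane → ℝ) :
    ∫ x in {x | 0 < reflectedTriple u i x}, reflectedTriple u i x * f x =
      ∫ x, reflectedTriple u i x * f x := by
  refine setIntegral_eq_integral_of_forall_compl_eq_zero fun x hx => ?_
  rw [reflectedTriple_apply, le_antisymm (b := 0) _ (h.nonneg _), zero_mul]
  have : ¬0 < reflectedTriple u i x := hx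
  rw [reflectedTriple_apply] at this
  exact not_lt.1 this

theorem IsLipschitzSolution.isMultiPhaseSolution (h : IsLipschitzSolution j T u g) (hj : 0 ≤ j)
    (hT : 2 ≤ T) : IsMultiPhaseSolution (phaseMeasure j) (fun _ => 1) (reflectedTriple u) where
  locallyIntegrable i := (h.continuous_reflectedTriple i).locallyIntegrable
  nonneg i x := by
    rw [reflectedTriple_apply]
    exact h.nonneg _
  disjoint i l hil := h.disjoint_phases hil
  equation i l hil φ hφ := by
    have hLi : Integrable (Laplacian.laplacian φ) :=
      (continuous_laplacian hφ.contDiff_two).integrable_of_hasCompactSupport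
        (hasCompactSupport_laplacian hφ.2.1)
    have hid := h.pair_identity hj hT hil (f := φ) hφ.contDiff_two.contDiffOn
      hφ.integrable.integrableOn hLi.integrableOn hφ.continuous.continuousOn
      fun k hki hkl x hx => hφ.eq_zero fun hxc =>
        hxc (Set.mem_biUnion (⟨hki, hkl⟩ : k ≠ i ∧ k ≠ l) hx.1)
    have hint : ∀ i, Integrable fun x => reflectedTriple u i x * Laplacian.laplacian φ x := fun i =>
      ((h.continuous_reflectedTriple i).mul
        (continuous_laplacian hφ.contDiff_two)).integrable_of_hasCompactSupport
          (hasCompactSupport_laplacian hφ.2.1).mul_left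
    rw [h.setIntegral_phase, h.setIntegral_phase, ← integral_sub (hint i) (hint l)] at hid
    simpa only [sub_mul, one_mul] using hid

lemma IsLipschitzSolution.closedBall_subset_phase (h : IsLipschitzSolution j T u g)
    (hT : 2 ≤ T) (i : Fin 3) :
    Metric.closedBall (center i) (1 / 5) ⊆ {x | 0 < reflectedTriple u i x} := by
  intro x hx
  rw [Set.mem_ofPred_eq, reflectedTriple_apply]
  refine h.closedBall_center_subset hT ?_
  rwa [Metric.mem_closedBall, ← foldMap_center i, (foldMap i).dist_map]

lemma phase_eq_image (u : Plane → ℝ) (i : Fin 3) :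
    {x | 0 < reflectedTriple u i x} = foldMap i '' {x | 0 < u x} := by
  ext x
  rw [Set.mem_ofPred_eq, reflectedTriple_apply]
  constructor
  · exact fun hx => ⟨foldMap i x, hx, foldMap_foldMap i x⟩
  · rintro ⟨y, hy, rfl⟩
    rwa [foldMap_foldMap]

theorem IsLipschitzSolution.isMultiPhaseQD (h : IsLipschitzSolution j T u g) (hj : 0 ≤ j)
    (hT : 2 ≤ T) : IsMultiPhaseQD (phaseMeasure j) (fun _ => 1)
      (fun i => {x | 0 < reflectedTriple u i x}) where
  finite := isFiniteMeasure_phaseMeasure j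
  lam_pos _ := one_pos
  isOpen := h.isOpen_phase
  isConnected i := by
    rw [phase_eq_image]
    exact (h.isConnected hT).image _ (foldMap i).continuous.continuousOn
  disjoint i l hil := h.disjoint_phases hil
  support_subset i := (support_phaseMeasure_subset j i).trans (h.closedBall_subset_phase hT i)
  identity i l hil f hf := by
    have hcont : ContinuousOn f
        ({x | 0 < reflectedTriple u i x} ∪ {x | 0 < reflectedTriple u l x}) :=
      hf.harmonic.contDiffOn.continuousOn
    have hint : ∀ k, Metric.closedBall (center k) (1 / 5) ⊆
        {x | 0 < reflectedTriple u i x} ∪ {x | 0 < reflectedTriple u l x} →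
        Integrable f (phaseMeasure j k) := fun k hk => by
      refine Integrable.smul_measure ?_ ENNReal.ofReal_ne_top
      exact ((hcont.mono hk).integrableOn_compact (isCompact_closedBall _ _)).mono_set
        Metric.ball_subset_closedBall
    have hlap : ∀ x ∈ {x | 0 < reflectedTriple u i x} ∪ {x | 0 < reflectedTriple u l x},
        Laplacian.laplacian f x = 0 := fun x hx => (hf.harmonic x hx).2.eq_of_nhds
    refine ⟨hint i ((h.closedBall_subset_phase hT i).trans Set.subset_union_left),
      hint l ((h.closedBall_subset_phase hT l).trans Set.subset_union_right), ?_⟩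
    have hid := h.pair_identity hj hT hil hf.harmonic.contDiffOn hf.integrable
      (integrableOn_zero.congr_fun (fun x hx => (hlap x hx).symm)
        ((h.isOpen_phase i).union (h.isOpen_phase l)).measurableSet) hf.continuous hf.zero
    have z : ∀ k, {x | 0 < reflectedTriple u k x} ⊆
        {x | 0 < reflectedTriple u i x} ∪ {x | 0 < reflectedTriple u l x} →
        ∫ x in {x | 0 < reflectedTriple u k x}, reflectedTriple u k x *
          Laplacian.laplacian f x = 0 := fun k hk =>
      setIntegral_eq_zero_of_forall_eq_zero fun x hx => by rw [hlap x (hk hx), mul_zero]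
    rw [z i Set.subset_union_left, z l Set.subset_union_right, sub_zero] at hid
    simp only [mul_one]
    linarith

lemma norm_center (i : Fin 3) : ‖center i‖ = 1 := norm_polarPoint _

lemma disjoint_support_phaseMeasure (j : ℝ) (i : Fin 3) :
    Disjoint (Metric.ball (0 : Plane) (3 / 4)) (phaseMeasure j i).support := by
  refine Set.disjoint_left.2 fun x hx hxs => ?_
  have h1 := support_phaseMeasure_subset j i hxs
  rw [Metric.mem_closedBall, dist_eq_norm] at h1
  rw [mem_ball_zero_iff] at hx
  have h2 := norm_sub_le x (x - center i)
  rw [sub_sub_cancel, norm_center] at h2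
  linarith

lemma IsLipschitzSolution.mul_le (h : IsLipschitzSolution j T u g) (hT : 2 ≤ T) {x : Plane}
    (hx : x ∈ Metric.ball (0 : Plane) (3 / 4) ∩ cone 0) : side 0 x * side 1 x ≤ u x := by
  have hn := mem_ball_zero_iff.1 hx.1
  exact (subsolution_ge (fun i => (mem_cone_zero.1 hx.2 i).le) hn).trans
    (h.subsolution_le x ⟨hx.2, mem_ball_zero_iff.2 (by linarith)⟩)

lemma IsLipschitzSolution.ball_inter_cone_subset (h : IsLipschitzSolution j T u g) (hT : 2 ≤ T)
    (i : Fin 3) :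
    Metric.ball (0 : Plane) (3 / 4) ∩ cone i ⊆ {x | 0 < reflectedTriple u i x} := by
  intro x hx
  rw [Set.mem_ofPred_eq, reflectedTriple_apply]
  have hc := foldMap_mem_cone hx.2
  have hx1 := mem_ball_zero_iff.1 hx.1
  have hs := mem_cone_zero.1 hc
  exact (mul_pos (hs 0) (hs 1)).trans_le
    (h.mul_le hT ⟨mem_ball_zero_iff.2 (by rwa [(foldMap i).norm_map]), hc⟩)

lemma IsLipschitzSolution.isJunctionPoint (h : IsLipschitzSolution j T u g) (hT : 2 ≤ T) :
    IsJunctionPoint (fun i => {x | 0 < reflectedTriple u i x}) 0 := by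
  intro i
  have h0 : (0 : Plane) ∈ closure {x | 0 < u x} := by
    have hcont : Continuous fun t : ℝ => t • center 0 := by fun_prop
    have hlim := (hcont.tendsto 0).mono_left (nhdsWithin_le_nhds (s := Set.Ioi 0))
    rw [zero_smul] at hlim
    refine mem_closure_of_tendsto hlim ?_
    filter_upwards [Ioo_mem_nhdsGT (show (0 : ℝ) < 3 / 4 by norm_num)] with t ht
    have hside : ∀ i, side i (t • center 0) = t * (√3 / 2) := fun i => by
      rw [← side_center_zero i, side, inner_smul_right, side]
    have hpos : 0 < t * (√3 / 2) := mul_pos ht.1 (by positivity)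
    have hmem : t • center 0 ∈ Metric.ball (0 : Plane) (3 / 4) ∩ cone 0 := by
      refine ⟨?_, mem_cone_zero.2 fun i => by rw [hside]; exact hpos⟩
      rw [mem_ball_zero_iff, norm_smul, norm_center, mul_one, Real.norm_of_nonneg ht.1.le]
      exact ht.2
    have := h.mul_le hT hmem
    rw [hside, hside] at this
    exact (mul_pos hpos hpos).trans_le this
  have h1 := h.mem_frontier (i := i) (a := foldMap i) (fun x => Or.inl (foldMap_foldMap i x)) h0
    (s := 0) (by simp [side])
  rwa [(foldMap i).map_zero] at h1

end

end MPQD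

theorem mainTheorem4 :
    ∃ j₀ : ℝ, 0 < j₀ ∧ ∀ j : ℝ, j₀ ≤ j →
      ∃ u : MPQD.Plane → ℝ,
        Continuous u ∧
        MPQD.IsObstacleMinimizer (MPQD.cone 0) (MPQD.force j) u ∧
        MPQD.IsMultiPhaseSolution (MPQD.phaseMeasure j) (fun _ => 1) (MPQD.reflectedTriple u) ∧
        MPQD.IsMultiPhaseQD (MPQD.phaseMeasure j) (fun _ => 1)
          (fun i => {x | 0 < MPQD.reflectedTriple u i x}) ∧
        (∀ i, Bornology.IsBounded {x | 0 < MPQD.reflectedTriple u i x}) ∧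
        (∀ x ∈ Metric.ball (0 : MPQD.Plane) (3 / 4) ∩ MPQD.cone 0,
          x 1 * (x 1 + √3 * x 0) / 2 ≤ u x) ∧
        (∀ i, Metric.ball (0 : MPQD.Plane) (3 / 4) ∩ MPQD.cone i ⊆
          {x | 0 < MPQD.reflectedTriple u i x}) ∧
        MPQD.IsJunctionPoint (fun i => {x | 0 < MPQD.reflectedTriple u i x}) 0 ∧
        (∀ i, Disjoint (Metric.ball (0 : MPQD.Plane) (3 / 4))
          (MPQD.phaseMeasure j i).support) := by
  obtain ⟨j₀, hj₀, H⟩ := MPQD.exists_isLipschitzSolution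
  refine ⟨j₀, hj₀, fun j hj => ?_⟩
  obtain ⟨T, u, g, hT, h⟩ := H j hj
  have hj0 : 0 ≤ j := hj₀.le.trans hj
  refine ⟨u, h.continuous, h.isObstacleMinimizer hj0 hT, h.isMultiPhaseSolution hj0 hT,
    h.isMultiPhaseQD hj0 hT, fun i => ?_, fun x hx => ?_, h.ball_inter_cone_subset hT,
    h.isJunctionPoint hT, MPQD.disjoint_support_phaseMeasure j⟩
  · rw [MPQD.phase_eq_image]
    exact (MPQD.foldMap i).lipschitz.isBounded_image h.isBounded
  · refine le_trans (le_of_eq ?_) (h.mul_le hT hx)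
    rw [MPQD.side_zero, MPQD.side_one]
    ring
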